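/- Let $k$ be an arbitrary field, $V\subset\mathbf{P}^3$ a smooth cubic surface over $k$, and $p:V\to\mathbf{P}^2$ a birational morphism defined over $k$. A *blown-down line* is a line of $V$ over $\bar k$ that $p$ contracts to a point; let $P\subset V(k)$ be the set of $k$-points of $V$ that lie on no blown-down line. For a $k$-rational plane section $C$ of $V$, the image $p(C)\subset\mathbf{P}^2$ is a plane cubic curve without multiple components, defined over $k$. For $x,y\in C(k)$ let $x\circ_{(C,p)}y$ be the (multivalued) composition whose values are all $z\in C(k)$ such that $p(x),p(y),p(z)$ are collinear on $p(C)$: either $p(x)+p(y)+p(z)$ is the intersection cycle of $p(C)$ with a $k$-line of $\mathbf{P}^2$, or the three points lie on a $k$-line contained in $p(C)$. If $C$ contains no blown-down line, then $p$ embeds $C$ into $\mathbf{P}^2$. Then for every point $x\in P$: 1. $P$ is generated by $x$ under the operations $\circ_{(C,p)}$, where $C$ runs through the $k$-rational plane sections containing no blown-down line: $P$ is the smallest set that contains $x$ and that contains, together with any $u,w$ (possibly equal), all points of $P$ that are values of $u\circ_{(C,p)}w$ for such $C$. 2. In fact, every $y\in P$ is a value of $x\circ_{(C,p)}x$ for a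 suitable $k$-rational plane section $C$ of $V$ through $x$; here any blown-down line contained in $C$ is itself defined over $k$ (so that, if no blown-down line is defined over $k$, $C$ contains no blown-down line). -/

import Mathlib

open scoped LinearAlgebra.Projectivization

/-- Geometric points of projective `n`-space over `k`, i.e. points with coordinates in the
algebraic closure of `k`. -/
abbrev GeomPoint (k : Type*) [Field k] (n : ℕ) : Type _ :=
  ℙ (AlgebraicClosure k) (Fin (n + 1) → AlgebraicClosure k)

namespace GeomPoint

/-- The form `f` with coefficients in `k` vanishes at the geometric point `v`.
(Used only for homogeneous `f`, where the choice of coordinates of `v` is irrelevant.) -/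
def Vanishes {k : Type*} [Field k] {n : ℕ} (f : MvPolynomial (Fin (n + 1)) k)
    (v : GeomPoint k n) : Prop :=
  MvPolynomial.aeval v.rep f = 0

/-- The geometric point `v` is `k`-rational: it has coordinates in `k`. -/
def IsRational {k : Type*} [Field k] {n : ℕ} (v : GeomPoint k n) : Prop :=
  ∃ (u : Fin (n + 1) → k) (h : (fun i => algebraMap k (AlgebraicClosure k) (u i)) ≠ 0),
    v = Projectivization.mk (AlgebraicClosure k) _ h

end GeomPoint

/-- A nonzero linear form over `k`; in three variables it is a `k`-rational line of the plane,
in four variables a `k`-rational plane of three-space. -/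
def IsLinearForm {k : Type*} [Field k] {n : ℕ} (h : MvPolynomial (Fin (n + 1)) k) : Prop :=
  h.IsHomogeneous 1 ∧ h ≠ 0

/-- Collinearity of three points `a, b, c` (possibly coinciding) on the plane cubic curve `g = 0`:
there is a `k`-line `l = 0` through them such that either the line is contained in the curve, or
the restriction of `g` to the line is a product of three nonzero linear forms vanishing at
`a`, `b`, `c` respectively, i.e. `a + b + c` is the intersection cycle of the curve with the line.
(`¬ l ∣ α` says that the linear form `α` is not identically zero on the line, and
`l ∣ g - α * β * γ` that `g` and `α * β * γ` agree on the line.) -/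
def CollinearOnCubic {k : Type*} [Field k] (g : MvPolynomial (Fin 3) k)
    (a b c : GeomPoint k 2) : Prop :=
  ∃ l : MvPolynomial (Fin 3) k, IsLinearForm l ∧
    a.Vanishes l ∧ b.Vanishes l ∧ c.Vanishes l ∧
    (l ∣ g ∨
      ∃ α β γ : MvPolynomial (Fin 3) k,
        α.IsHomogeneous 1 ∧ β.IsHomogeneous 1 ∧ γ.IsHomogeneous 1 ∧
        ¬ l ∣ α ∧ ¬ l ∣ β ∧ ¬ l ∣ γ ∧
        a.Vanishes α ∧ b.Vanishes β ∧ c.Vanishes γ ∧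
        l ∣ g - α * β * γ)

/-- A smooth cubic surface over `k`, given by its equation in projective three-space; smoothness
is the Jacobian criterion at all points over the algebraic closure. -/
structure SmoothCubicSurface (k : Type*) [Field k] where
  /-- the equation -/
  form : MvPolynomial (Fin 4) k
  isHomogeneous : form.IsHomogeneous 3
  smooth : ∀ v : Fin 4 → AlgebraicClosure k, v ≠ 0 → MvPolynomial.aeval v form = 0 →
    ∃ i, MvPolynomial.aeval v (MvPolynomial.pderiv i form) ≠ 0

namespace SmoothCubicSurface

/-- The set of geometric points of the surface. -/
def points {k : Type*} [Field k] (V : SmoothCubicSurface k) : Set (GeomPoint k 3) :=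
  {v | v.Vanishes V.form}

/-- A morphism `V → ℙ²` defined over `k`: a map on geometric points which near every point is
given by a triple of forms of the same degree with coefficients in `k`. -/
structure MorphismToPlane {k : Type*} [Field k] (V : SmoothCubicSurface k) where
  /-- the map on geometric points -/
  toFun : V.points → GeomPoint k 2
  regular : ∀ v : V.points, ∃ (d : ℕ) (f : Fin 3 → MvPolynomial (Fin 4) k),
    (∀ j, (f j).IsHomogeneous d) ∧
    (∃ j, ¬ v.1.Vanishes (f j)) ∧
    ∀ (w : V.points) (hw : (fun j => MvPolynomial.aeval w.1.rep (f j)) ≠ 0),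
      toFun w = Projectivization.mk (AlgebraicClosure k) _ hw

namespace MorphismToPlane

/-- The morphism `p` is birational (over `k`): there is a rational map `q : ℙ² ⇢ V` over `k`,
given by forms `q 0, …, q 3` of the same degree, such that `q ∘ p` is the identity on a nonempty
open subset (`r ≠ 0`) of `V` and `p ∘ q` is the identity on a nonempty open subset (`s ≠ 0`)
of `ℙ²`. -/
def IsBirational {k : Type*} [Field k] {V : SmoothCubicSurface k} (p : V.MorphismToPlane) :
    Prop :=
  ∃ (e : ℕ) (q : Fin 4 → MvPolynomial (Fin 3) k), (∀ i, (q i).IsHomogeneous e) ∧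
    (∃ (d : ℕ) (r : MvPolynomial (Fin 4) k), r.IsHomogeneous d ∧
      (∃ v : V.points, ¬ v.1.Vanishes r) ∧
      ∀ v : V.points, ¬ v.1.Vanishes r →
        ∃ h : (fun i => MvPolynomial.aeval (p.toFun v).rep (q i)) ≠ 0,
          Projectivization.mk (AlgebraicClosure k) _ h = v.1) ∧
    (∃ (d : ℕ) (s : MvPolynomial (Fin 3) k), s.IsHomogeneous d ∧ s ≠ 0 ∧
      ∀ y : GeomPoint k 2, ¬ y.Vanishes s →
        ∃ (h : (fun i => MvPolynomial.aeval y.rep (q i)) ≠ 0)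
          (hV : Projectivization.mk (AlgebraicClosure k) _ h ∈ V.points),
          p.toFun ⟨Projectivization.mk (AlgebraicClosure k) _ h, hV⟩ = y)

/-- `L` (a two-dimensional linear subspace, i.e. a line of three-space over the algebraic closure)
is a line blown down by `p`: it lies on `V` and `p` contracts it to a point. -/
def IsBlownDownLine {k : Type*} [Field k] {V : SmoothCubicSurface k} (p : V.MorphismToPlane)
    (L : Submodule (AlgebraicClosure k) (Fin 4 → AlgebraicClosure k)) : Prop :=
  Module.finrank (AlgebraicClosure k) L = 2 ∧
    (∀ w : GeomPoint k 3, w.submodule ≤ L → w ∈ V.points) ∧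
    ∃ c : GeomPoint k 2, ∀ w : V.points, w.1.submodule ≤ L → p.toFun w = c

/-- The complement in `V(k)` to all the blown-down lines. -/
def complement {k : Type*} [Field k] {V : SmoothCubicSurface k} (p : V.MorphismToPlane) :
    Set V.points :=
  {x | x.1.IsRational ∧
    ∀ L : Submodule (AlgebraicClosure k) (Fin 4 → AlgebraicClosure k),
      p.IsBlownDownLine L → ¬ x.1.submodule ≤ L}

/-- The plane section `C` of `V` by the plane `H = 0` has as its image `p(C)` the cubic curve
`g = 0` without multiple components. (Every plane section of a smooth cubic surface is reduced,
so `p(C)` is reduced and is determined by its set of geometric points.) -/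
def IsImageCubic {k : Type*} [Field k] {V : SmoothCubicSurface k} (p : V.MorphismToPlane)
    (H : MvPolynomial (Fin 4) k) (g : MvPolynomial (Fin 3) k) : Prop :=
  g.IsHomogeneous 3 ∧
    Squarefree (MvPolynomial.map (algebraMap k (AlgebraicClosure k)) g) ∧
    ∀ y : GeomPoint k 2, y.Vanishes g ↔ ∃ v : V.points, v.1.Vanishes H ∧ p.toFun v = y

/-- The (multivalued) composition `x ∘_{(C,p)} y`, where `C` is the section of `V` by the plane
`H = 0`: the set of all `k`-points `z` of `C` such that `p(x), p(y), p(z)` are collinear on the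
cubic curve `p(C)`. It is empty unless `x` and `y` lie on `C`. -/
def comp {k : Type*} [Field k] {V : SmoothCubicSurface k} (p : V.MorphismToPlane)
    (H : MvPolynomial (Fin 4) k) (x y : V.points) : Set V.points :=
  {z | x.1.Vanishes H ∧ y.1.Vanishes H ∧ z.1.Vanishes H ∧ z.1.IsRational ∧
    ∃ g : MvPolynomial (Fin 3) k, p.IsImageCubic H g ∧
      CollinearOnCubic g (p.toFun x) (p.toFun y) (p.toFun z)}

end MorphismToPlane

end SmoothCubicSurface

/-- The line `L` is contained in the plane `H = 0`. -/
def LineInPlane {k : Type*} [Field k]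
    (L : Submodule (AlgebraicClosure k) (Fin 4 → AlgebraicClosure k))
    (H : MvPolynomial (Fin 4) k) : Prop :=
  ∀ w ∈ L, MvPolynomial.aeval w H = 0

/-- The linear subspace `L` is defined over `k`: it is spanned by vectors with coordinates
in `k`. -/
def LineDefinedOver {k : Type*} [Field k]
    (L : Submodule (AlgebraicClosure k) (Fin 4 → AlgebraicClosure k)) : Prop :=
  ∃ S : Set (Fin 4 → k),
    L = Submodule.span (AlgebraicClosure k)
      ((fun u i => algebraMap k (AlgebraicClosure k) (u i)) '' S)

namespace SmoothCubicSurface.MorphismToPlane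

/-- `p.IsAdmissible H`: `H = 0` is a `k`-rational plane whose section `C` of `V` contains none of
the blown-down lines; these are the plane sections embedded by `p` as plane cubic curves. -/
def IsAdmissible {k : Type*} [Field k] {V : SmoothCubicSurface k} (p : V.MorphismToPlane)
    (H : MvPolynomial (Fin 4) k) : Prop :=
  IsLinearForm H ∧
    ∀ L : Submodule (AlgebraicClosure k) (Fin 4 → AlgebraicClosure k),
      p.IsBlownDownLine L → ¬ LineInPlane L H

/-- The points generated by `x` inside the complement `P` to the blown-down lines: the smallest
set which contains `x` and which, together with `u` and `w` (possibly equal), contains every point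
of `P` that is a value of `u ∘_{(C,p)} w` for some `k`-rational plane section `C` containing no
blown-down line. -/
inductive GeneratedBy {k : Type*} [Field k] {V : SmoothCubicSurface k} (p : V.MorphismToPlane)
    (x : V.points) : V.points → Prop
  | base : GeneratedBy p x x
  | step (H : MvPolynomial (Fin 4) k) (u w z : V.points) :
      p.IsAdmissible H → GeneratedBy p x u → GeneratedBy p x w →
      z ∈ p.complement → z ∈ p.comp H u w → GeneratedBy p x z

end SmoothCubicSurface.MorphismToPlane

/-! The proof moves the question from the surface to a linear system of plane cubics. Let `Q` be
coprime forms over `k` that define the inverse of `p`. The maximal minors of the Jacobian of `Q` are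
orthogonal to the tangent planes of the surface, so they are a common factor times a coordinate
times the gradient of the surface (`InverseData.exists_crossProduct₄_eq`). Since `p` inverts `Q`,
this factor has no zero outside the base locus; it is a constant, and comparing degrees shows that
the forms `Q` are cubic (`InverseData.degree_eq_three`). This is the identity of anticanonical and
hyperplane classes in coordinates. Along arcs, the same identity shows that the differential of `Q`
has rank two at every base point `s` (`InverseData.parallel_of_dirVec_eq_zero`), and the fibre of
`p` above `s` is the line of all `dirVec Q s t` (`InverseData.exists_eq_dirVec`). So the blown-down
lines are these exceptional lines, `P` is the set of `k`-points of the plane outside the base locus,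
and the section by a plane `H` has as its image the cubic `∑ H i * Q i`, which is singular at `s`
exactly when `H` contains the line above `s`.

For the second claim, four coefficients of `H` and one scalar face the four coefficients of a binary
cubic. Hence any three points on a line are its contact with some section, unless that section
contains the line (`exists_contact`). This is applied to the line through `p(x)` and `p(y)` with
`p(x)` taken twice. Exceptional lines above different base points are skew, so a plane over `k`
contains at most one of them. Its base point is fixed by every `k`-embedding, and it is separable
over `k` because the differential there has rank two; so it is rational
(`RationalPlaneModel.exists_parallel_extVec`).

For the first claim the sections must contain no exceptional line. A line through a base point and a
rational point outside the base locus lies in such a section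
(`RationalPlaneModel.exists_section_of_meetsBase`), so on it every point of `P` is reached from
every other. On a line without base points a triple can fail only if it is obstructed: the section
cutting it out contains the line above a rational base point `s`. For given `s` the obstructing
plane is determined by any one point of the triple, and if `x` counts twice and is collinear with
`s` and another base point, it is the tangent plane at `x`. The rest is incidence geometry
(`Configuration.ProjectivePlane.mem_of_obstructions`). With three or more rational base points, an
unreachable point would put `x` on two lines that each join two base points. With at most two, a
third point of the line through `x` and the target helps. Only three points per line are used, so no
field is excluded. -/

namespace MvPolynomial

/-- The derivative of the polynomial `G` at `v` in the direction `w`. -/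
noncomputable def dirDeriv {K A σ : Type*} [Fintype σ] [CommRing K] [CommRing A] [Algebra K A]
    (G : MvPolynomial σ K) (v w : σ → A) : A :=
  ∑ i, aeval v (pderiv i G) * w i

/-! ### Directional derivatives and expansions of cubic forms. -/

section dirDeriv

variable {K A σ : Type*} [Fintype σ] [CommRing K] [CommRing A] [Algebra K A]

theorem dirDeriv_add (G : MvPolynomial σ K) (v w w' : σ → A) :
    dirDeriv G v (w + w') = dirDeriv G v w + dirDeriv G v w' := by
  simp [dirDeriv, mul_add, Finset.sum_add_distrib]

theorem dirDeriv_smul (G : MvPolynomial σ K) (v w : σ → A) (c : A) :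
    dirDeriv G v (c • w) = c * dirDeriv G v w := by
  simp [dirDeriv, Finset.mul_sum]
  exact Finset.sum_congr rfl fun i _ => by ring

theorem dirDeriv_poly_add (G G' : MvPolynomial σ K) (v w : σ → A) :
    dirDeriv (G + G') v w = dirDeriv G v w + dirDeriv G' v w := by
  simp [dirDeriv, add_mul, Finset.sum_add_distrib]

theorem dirDeriv_poly_mul (G G' : MvPolynomial σ K) (v w : σ → A) :
    dirDeriv (G * G') v w = aeval v G * dirDeriv G' v w + aeval v G' * dirDeriv G v w := by
  simp only [dirDeriv, Finset.mul_sum, ← Finset.sum_add_distrib]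
  exact Finset.sum_congr rfl fun i _ => by simp [Derivation.leibniz]; ring

theorem dirDeriv_C (c : K) (v w : σ → A) : dirDeriv (C c) v w = 0 := by
  simp [dirDeriv]

theorem dirDeriv_X (i : σ) (v w : σ → A) : dirDeriv (X i : MvPolynomial σ K) v w = w i := by
  classical
  simp [dirDeriv, pderiv_X, Pi.single_apply, apply_ite, ite_mul]

theorem dirDeriv_sum {ι : Type*} (s : Finset ι) (G : ι → MvPolynomial σ K) (v w : σ → A) :
    dirDeriv (∑ j ∈ s, G j) v w = ∑ j ∈ s, dirDeriv (G j) v w := by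
  simp only [dirDeriv, map_sum, Finset.sum_mul]
  exact Finset.sum_comm

theorem map_dirDeriv {B : Type*} [CommRing B] [Algebra K B] (φ : A →ₐ[K] B)
    (G : MvPolynomial σ K) (v w : σ → A) :
    φ (dirDeriv G v w) = dirDeriv G (fun i => φ (v i)) (fun i => φ (w i)) := by
  simp only [dirDeriv, map_sum, map_mul]
  refine Finset.sum_congr rfl fun i _ => ?_
  congr 1
  exact (comp_aeval_apply v φ _).symm ▸ rfl

theorem derivation_aeval {M : Type*} [AddCommGroup M] [Module K M] [Module A M]
    [IsScalarTower K A M] (D : Derivation K A M) (G : MvPolynomial σ K) (v : σ → A) :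
    D (aeval v G) = ∑ i, aeval v (pderiv i G) • D (v i) := by
  classical
  induction G using MvPolynomial.induction_on with
  | C a => simp
  | add p q hp hq => simp [hp, hq, add_smul, Finset.sum_add_distrib]
  | mul_X p j hp =>
    simp only [map_mul, aeval_X, Derivation.leibniz, hp, pderiv_X, map_add, smul_eq_mul,
      add_smul, Finset.sum_add_distrib, mul_smul, Finset.smul_sum, Pi.single_apply]
    congr 1
    rw [Finset.sum_eq_single j] <;> simp +contextual [eq_comm]

theorem dirDeriv_self {n : ℕ} {G : MvPolynomial σ K} (hG : G.IsHomogeneous n)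
    (v : σ → A) : dirDeriv G v v = n * aeval v G := by
  have h := congrArg (aeval v) hG.sum_X_mul_pderiv
  simp only [map_sum, map_mul, aeval_X, nsmul_eq_mul, map_natCast] at h
  rw [← h, dirDeriv]
  exact Finset.sum_congr rfl fun i _ => mul_comm _ _

end dirDeriv

theorem aeval_smul_of_isHomogeneous {K A σ : Type*} [CommRing K] [CommRing A] [Algebra K A]
    {n : ℕ} {G : MvPolynomial σ K} (hG : G.IsHomogeneous n)
    (c : A) (v : σ → A) : aeval (c • v) G = c ^ n * aeval v G := by
  classical
  rw [G.as_sum, map_sum, map_sum, Finset.mul_sum]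
  refine Finset.sum_congr rfl fun d hd => ?_
  have hdeg : d.degree = n := by
    by_contra h
    exact (mem_support_iff.1 hd) (hG.coeff_eq_zero h)
  simp only [aeval_monomial, Pi.smul_apply, smul_eq_mul, mul_pow, Finsupp.prod,
    Finset.prod_mul_distrib, Finset.prod_pow_eq_pow_sum]
  rw [← hdeg, Finsupp.degree_apply]
  ring

theorem exists_single_add_of_degree {σ : Type*} {d : σ →₀ ℕ} {n : ℕ} (h : d.degree = n + 1) :
    ∃ (i : σ) (d' : σ →₀ ℕ), d = Finsupp.single i 1 + d' ∧ d'.degree = n := by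
  have hd : d ≠ 0 := by
    rintro rfl
    simp at h
  obtain ⟨i, hi⟩ := Finsupp.ne_iff.1 hd
  have hle : Finsupp.single i 1 ≤ d := by
    rw [Finsupp.single_le_iff]
    exact Nat.one_le_iff_ne_zero.2 hi
  refine ⟨i, d - Finsupp.single i 1, (add_tsub_cancel_of_le hle).symm, ?_⟩
  have := congrArg Finsupp.degree (add_tsub_cancel_of_le hle)
  rw [map_add, h, Finsupp.degree_single] at this
  omega

/-- A cubic form is a sum of terms `c * X i * X j * X l`. Expansions along a line, checked on such a
term by `ring`, thus hold in every characteristic, without division by factorials. -/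
theorem induction_cubic {K σ : Type*} [CommRing K]
    {motive : MvPolynomial σ K → Prop} {G : MvPolynomial σ K} (hG : G.IsHomogeneous 3)
    (zero : motive 0) (add : ∀ p q, motive p → motive q → motive (p + q))
    (mon : ∀ c i j l, motive (C c * (X i * X j * X l))) : motive G := by
  classical
  rw [G.as_sum]
  refine Finset.sum_induction _ motive add zero fun d hd => ?_
  have hdeg : d.degree = 2 + 1 := by
    by_contra h
    exact (mem_support_iff.1 hd) (hG.coeff_eq_zero h)
  obtain ⟨i, d1, rfl, h1⟩ := exists_single_add_of_degree hdeg
  obtain ⟨j, d2, rfl, h2⟩ := exists_single_add_of_degree (n := 1) h1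
  obtain ⟨l, d3, rfl, h3⟩ := exists_single_add_of_degree (n := 0) h2
  rw [Finsupp.degree_eq_zero_iff] at h3
  subst h3
  convert mon (coeff (Finsupp.single i 1 + (Finsupp.single j 1 + (Finsupp.single l 1 + 0))) G) i j l
    using 1
  simp only [X, monomial_mul, C_mul_monomial, mul_one, add_zero, add_assoc]

/-- The expansion of a cubic form along a pair of vectors. -/
theorem aeval_smul_add_smul {K A σ : Type*} [Fintype σ] [CommRing K] [CommRing A]
    [Algebra K A] {G : MvPolynomial σ K} (hG : G.IsHomogeneous 3) (a b : A) (v w : σ → A) :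
    aeval (a • v + b • w) G = a ^ 3 * aeval v G + a ^ 2 * b * dirDeriv G v w
      + a * b ^ 2 * dirDeriv G w v + b ^ 3 * aeval w G := by
  refine induction_cubic (motive := fun G => aeval (a • v + b • w) G = a ^ 3 * aeval v G
    + a ^ 2 * b * dirDeriv G v w + a * b ^ 2 * dirDeriv G w v + b ^ 3 * aeval w G)
    hG (by simp [dirDeriv]) (fun p q hp hq => ?_) (fun c i j l => ?_)
  · simp only [map_add, hp, hq, dirDeriv_poly_add]
    ring
  · simp only [map_mul, aeval_C, aeval_X, dirDeriv_poly_mul, dirDeriv_C, dirDeriv_X, Pi.add_apply,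
      Pi.smul_apply, smul_eq_mul]
    ring

theorem dirDeriv_smul_add_smul {K A σ : Type*} [Fintype σ] [CommRing K] [CommRing A]
    [Algebra K A] {G : MvPolynomial σ K} (hG : G.IsHomogeneous 3) (a b : A) (v w : σ → A) :
    dirDeriv G (a • v + b • w) w = a ^ 2 * dirDeriv G v w
      + 2 * a * b * dirDeriv G w v + 3 * b ^ 2 * aeval w G := by
  refine induction_cubic (motive := fun G => dirDeriv G (a • v + b • w) w = a ^ 2 * dirDeriv G v w
    + 2 * a * b * dirDeriv G w v + 3 * b ^ 2 * aeval w G)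
    hG (by simp [dirDeriv]) (fun p q hp hq => ?_) (fun c i j l => ?_)
  · simp only [map_add, hp, hq, dirDeriv_poly_add]
    ring
  · simp only [map_mul, aeval_C, aeval_X, dirDeriv_poly_mul, dirDeriv_C, dirDeriv_X, Pi.add_apply,
      Pi.smul_apply, smul_eq_mul]
    ring

/-- The derivative of a cubic form along a line is a quadratic polynomial. -/
theorem exists_dirDeriv_smul_add_smul {K A σ : Type*} [Fintype σ] [CommRing K]
    [CommRing A] [Algebra K A] {G : MvPolynomial σ K} (hG : G.IsHomogeneous 3) (v w z : σ → A) :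
    ∃ m : A, ∀ a b : A, dirDeriv G (a • v + b • w) z = a ^ 2 * dirDeriv G v z
      + a * b * m + b ^ 2 * dirDeriv G w z := by
  refine induction_cubic (motive := fun G => ∃ m : A, ∀ a b : A,
    dirDeriv G (a • v + b • w) z = a ^ 2 * dirDeriv G v z + a * b * m + b ^ 2 * dirDeriv G w z)
    hG ⟨0, by simp [dirDeriv]⟩ (fun p q hp hq => ?_) (fun c i j l => ?_)
  · obtain ⟨m, hm⟩ := hp
    obtain ⟨m', hm'⟩ := hq
    refine ⟨m + m', fun a b => ?_⟩
    simp only [hm, hm', dirDeriv_poly_add]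
    ring
  · refine ⟨algebraMap K A c * (v i * w j * z l + w i * v j * z l + v i * z j * w l
      + w i * z j * v l + z i * v j * w l + z i * w j * v l), fun a b => ?_⟩
    simp only [map_mul, aeval_C, aeval_X, dirDeriv_poly_mul, dirDeriv_C, dirDeriv_X, Pi.add_apply,
      Pi.smul_apply, smul_eq_mul]
    ring

/-! ### Factors of forms, zeros of prime polynomials, proportional families. -/

section factors

variable {K σ : Type*} [CommRing K]

/-- Scaling all variables by a new variable `T` records the grading as the powers of `T`. -/
theorem coeff_aeval_C_X_mul_X (a : MvPolynomial σ K) (n : ℕ) :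
    (aeval (fun i => Polynomial.C (X i : MvPolynomial σ K) * Polynomial.X) a).coeff n
      = homogeneousComponent n a := by
  classical
  induction a using MvPolynomial.induction_on' with
  | monomial d c =>
    have h1 : (aeval (fun i => Polynomial.C (X i : MvPolynomial σ K) * Polynomial.X)
        (monomial d c)) = Polynomial.C (monomial d c) * Polynomial.X ^ d.degree := by
      rw [aeval_monomial, Finsupp.prod]
      simp only [mul_pow, Finset.prod_mul_distrib, Finset.prod_pow_eq_pow_sum, ← map_pow,
        ← map_prod]
      rw [← mul_assoc, Finsupp.degree_apply]
      congr 1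
      rw [monomial_eq, Finsupp.prod, map_mul]
      rfl
    rw [h1, Polynomial.coeff_C_mul_X_pow]
    split_ifs with h
    · rw [homogeneousComponent_of_mem (isHomogeneous_monomial c h.symm), if_pos rfl]
    · rw [homogeneousComponent_of_mem (isHomogeneous_monomial c rfl), if_neg h]
  | add p q hp hq => simp [hp, hq]

/-- After the substitution `X i ↦ X i * T`, both the degree and the trailing degree in `T` are
additive. They agree for the product, so they agree for each factor. -/
theorem isHomogeneous_of_mul [IsDomain K] {a b : MvPolynomial σ K} {n : ℕ} (h : (a * b).IsHomogeneous n)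
    (h0 : a * b ≠ 0) : ∃ i j, a.IsHomogeneous i ∧ b.IsHomogeneous j ∧ i + j = n := by
  classical
  let φ : MvPolynomial σ K →ₐ[K] Polynomial (MvPolynomial σ K) :=
    aeval (fun i => Polynomial.C (X i : MvPolynomial σ K) * Polynomial.X)
  have hφ : ∀ a n, (φ a).coeff n = homogeneousComponent n a := coeff_aeval_C_X_mul_X
  have hinj : ∀ a, a ≠ 0 → φ a ≠ 0 := by
    intro a ha h
    apply ha
    rw [← sum_homogeneousComponent a]
    exact Finset.sum_eq_zero fun i _ => by rw [← hφ, h, Polynomial.coeff_zero]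
  have hhom : ∀ a m, (φ a).natDegree = m → (φ a).natTrailingDegree = m → a.IsHomogeneous m := by
    intro a m hd ht
    rw [← sum_homogeneousComponent a]
    refine IsHomogeneous.sum _ _ _ fun i _ => ?_
    by_cases hi : i = m
    · rw [← hi]
      exact homogeneousComponent_isHomogeneous _ _
    · have : homogeneousComponent i a = 0 := by
        rw [← hφ]
        rcases lt_or_gt_of_ne hi with h | h
        · exact Polynomial.coeff_eq_zero_of_lt_natTrailingDegree (ht ▸ h)
        · exact Polynomial.coeff_eq_zero_of_natDegree_lt (hd ▸ h)
      rw [this]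
      exact isHomogeneous_zero _ _ _
  have ha : φ a ≠ 0 := hinj _ (left_ne_zero_of_mul h0)
  have hb : φ b ≠ 0 := hinj _ (right_ne_zero_of_mul h0)
  have hab : ∀ m, (φ a * φ b).coeff m = if m = n then a * b else 0 := by
    intro m
    rw [← map_mul, hφ, homogeneousComponent_of_mem h]
  have hab0 : φ a * φ b ≠ 0 := mul_ne_zero ha hb
  have h1 : (φ a * φ b).natDegree = n := by
    by_contra hne
    have := hab (φ a * φ b).natDegree
    rw [if_neg hne] at this
    exact hab0 (Polynomial.leadingCoeff_eq_zero.1 this)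
  have h2 : (φ a * φ b).natTrailingDegree = n := by
    by_contra hne
    have := hab (φ a * φ b).natTrailingDegree
    rw [if_neg hne] at this
    exact hab0 (Polynomial.trailingCoeff_eq_zero.1 this)
  rw [Polynomial.natDegree_mul ha hb] at h1
  rw [Polynomial.natTrailingDegree_mul ha hb] at h2
  have h3 := Polynomial.natTrailingDegree_le_natDegree (φ a)
  have h4 := Polynomial.natTrailingDegree_le_natDegree (φ b)
  exact ⟨_, _, hhom a _ rfl (by omega), hhom b _ rfl (by omega), h1⟩

end factors

section algClosed

variable {K σ : Type*} [Field K] [IsAlgClosed K] [Finite σ]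

/-- The Nullstellensatz for a principal prime ideal. -/
theorem dvd_of_forall_aeval_eq_zero {π G : MvPolynomial σ K} (hπ : Prime π)
    (h : ∀ v : σ → K, aeval v π = 0 → aeval v G = 0) : π ∣ G := by
  have hp : (Ideal.span {π}).IsPrime := (Ideal.span_singleton_prime hπ.ne_zero).2 hπ
  rw [← Ideal.mem_span_singleton, ← IsPrime.vanishingIdeal_zeroLocus (K := K) (Ideal.span {π})]
  rw [mem_vanishingIdeal_iff]
  intro v hv
  refine h v ?_
  rw [mem_zeroLocus_iff] at hv
  exact hv π (Ideal.mem_span_singleton_self π)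

end algClosed

theorem eq_zero_of_forall_aeval_eq_zero_of_ne {K σ : Type*} [Field K] [Infinite K] 
    {s G : MvPolynomial σ K} (hs : s ≠ 0)
    (h : ∀ v : σ → K, aeval v s ≠ 0 → aeval v G = 0) : G = 0 := by
  have : s * G = 0 := by
    refine funext fun v => ?_
    rw [map_mul, map_zero, ← coe_aeval_eq_eval]
    by_cases hv : aeval v s = 0
    · exact mul_eq_zero_of_left hv _
    · exact mul_eq_zero_of_right _ (h v hv)
  exact (mul_eq_zero.1 this).resolve_left hs

end MvPolynomial

/-- Cancelling the gcd of one pair leaves `M i * b = a * F i` with `a` and `b` coprime. Then `b`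
divides every `F i`, and is a unit since the family has no common prime factor. -/
theorem exists_eq_mul_of_forall_mul_eq_mul {R ι : Type*} [CommRing R] [IsDomain R]
    [UniqueFactorizationMonoid R] {M F : ι → R} (h : ∀ i j, M i * F j = M j * F i)
    (hF : ∃ i, F i ≠ 0) (hprime : ∀ π, Prime π → ¬ ∀ i, π ∣ F i) : ∃ μ, ∀ i, M i = μ * F i := by
  classical
  let _ : NormalizedGCDMonoid R := Classical.choice inferInstance
  obtain ⟨j, hj⟩ := hF
  obtain ⟨a, b, ha, hb, hu⟩ := extract_gcd (M j) (F j)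
  have hd : gcd (M j) (F j) ≠ 0 := fun h => hj (by rw [hb, h, zero_mul])
  have hrel : ∀ i, M i * b = a * F i := by
    intro i
    apply mul_left_cancel₀ hd
    calc gcd (M j) (F j) * (M i * b) = M i * (gcd (M j) (F j) * b) := by ring
      _ = M j * F i := by rw [← hb, h]
      _ = gcd (M j) (F j) * (a * F i) := by rw [← mul_assoc, ← ha]
  have hbF : ∀ i, b ∣ F i := fun i =>
    ((gcd_isUnit_iff_isRelPrime.1 hu).symm).dvd_of_dvd_mul_left ⟨M i, by rw [← hrel, mul_comm]⟩
  have hb0 : b ≠ 0 := fun h => hj (by rw [hb, h, mul_zero])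
  have hbu : IsUnit b := by
    by_contra hbu
    obtain ⟨π, hπ, hπb⟩ := WfDvdMonoid.exists_irreducible_factor hbu hb0
    exact hprime π hπ.prime fun i => hπb.trans (hbF i)
  obtain ⟨u, rfl⟩ := hbu
  refine ⟨a * ↑u⁻¹, fun i => ?_⟩
  rw [mul_right_comm, ← hrel, mul_assoc, Units.mul_inv, mul_one]

/-! ### Proportional vectors and maximal minors. -/

open MvPolynomial

/-- Two vectors are parallel if all their `2 × 2` minors vanish. -/
def Parallel {ι A : Type*} [Mul A] (a b : ι → A) : Prop :=
  ∀ i j, a i * b j = a j * b i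

namespace Parallel

variable {ι A : Type*}

theorem symm [CommRing A] {a b : ι → A} (h : Parallel a b) : Parallel b a := fun i j => by
  rw [mul_comm, h j i, mul_comm]

theorem refl [CommRing A] (a : ι → A) : Parallel a a := fun _ _ => mul_comm _ _

theorem trans [CommRing A] [IsDomain A] {a b c : ι → A} (hb : b ≠ 0) (h : Parallel a b)
    (h' : Parallel b c) : Parallel a c := by
  obtain ⟨l, hl⟩ := Function.ne_iff.1 hb
  intro i j
  apply mul_left_cancel₀ hl
  rw [Pi.zero_apply] at hl
  apply mul_left_cancel₀ hl
  linear_combination (c j * b l) * h l i * (-1) + (c i * b l) * h l j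
    + a l * b l * h' i j

theorem exists_smul [Field A] {a b : ι → A} (hb : b ≠ 0) (h : Parallel a b) :
    ∃ c : A, a = c • b := by
  obtain ⟨l, hl⟩ := Function.ne_iff.1 hb
  rw [Pi.zero_apply] at hl
  refine ⟨a l / b l, funext fun i => ?_⟩
  rw [Pi.smul_apply, smul_eq_mul, div_mul_eq_mul_div, eq_div_iff hl]
  exact h i l

theorem smul_left [CommRing A] {a b : ι → A} (c : A) (h : Parallel a b) :
    Parallel (c • a) b := fun i j => by
  simp only [Pi.smul_apply, smul_eq_mul, mul_assoc, h i j]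

theorem of_smul_left [CommRing A] [IsDomain A] {a b : ι → A} {c : A} (hc : c ≠ 0)
    (h : Parallel (c • a) b) : Parallel a b := fun i j => by
  have := h i j
  simp only [Pi.smul_apply, smul_eq_mul, mul_assoc] at this
  exact mul_left_cancel₀ hc this

end Parallel

/-- The vector of signed maximal minors of three vectors in a four-dimensional space. -/
def crossProduct₄ {A : Type*} [CommRing A] (u v w : Fin 4 → A) : Fin 4 → A :=
  ![u 1 * (v 2 * w 3 - v 3 * w 2) - u 2 * (v 1 * w 3 - v 3 * w 1) + u 3 * (v 1 * w 2 - v 2 * w 1),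
    -(u 0 * (v 2 * w 3 - v 3 * w 2) - u 2 * (v 0 * w 3 - v 3 * w 0)
      + u 3 * (v 0 * w 2 - v 2 * w 0)),
    u 0 * (v 1 * w 3 - v 3 * w 1) - u 1 * (v 0 * w 3 - v 3 * w 0) + u 3 * (v 0 * w 1 - v 1 * w 0),
    -(u 0 * (v 1 * w 2 - v 2 * w 1) - u 1 * (v 0 * w 2 - v 2 * w 0)
      + u 2 * (v 0 * w 1 - v 1 * w 0))]

section crossProduct₄

variable {A : Type*} [CommRing A] (u v w : Fin 4 → A)

/-- Cramer's rule: each minor of the pair is an explicit combination of the three orthogonality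
relations, so no rank assumption is needed. -/
theorem crossProduct₄_parallel {z : Fin 4 → A} (hu : ∑ i, z i * u i = 0)
    (hv : ∑ i, z i * v i = 0) (hw : ∑ i, z i * w i = 0) :
    Parallel (crossProduct₄ u v w) z := by
  simp only [Fin.sum_univ_four] at hu hv hw
  have h01 : crossProduct₄ u v w 0 * z 1 = crossProduct₄ u v w 1 * z 0 := by
    simp only [crossProduct₄, Matrix.cons_val]
    linear_combination (v 2 * w 3 - v 3 * w 2) * hu - (u 2 * w 3 - u 3 * w 2) * hv
      + (u 2 * v 3 - u 3 * v 2) * hw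
  have h02 : crossProduct₄ u v w 0 * z 2 = crossProduct₄ u v w 2 * z 0 := by
    simp only [crossProduct₄, Matrix.cons_val]
    linear_combination (v 3 * w 1 - v 1 * w 3) * hu - (u 3 * w 1 - u 1 * w 3) * hv
      + (u 3 * v 1 - u 1 * v 3) * hw
  have h03 : crossProduct₄ u v w 0 * z 3 = crossProduct₄ u v w 3 * z 0 := by
    simp only [crossProduct₄, Matrix.cons_val]
    linear_combination (v 1 * w 2 - v 2 * w 1) * hu - (u 1 * w 2 - u 2 * w 1) * hv
      + (u 1 * v 2 - u 2 * v 1) * hw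
  have h12 : crossProduct₄ u v w 1 * z 2 = crossProduct₄ u v w 2 * z 1 := by
    simp only [crossProduct₄, Matrix.cons_val]
    linear_combination (v 0 * w 3 - v 3 * w 0) * hu - (u 0 * w 3 - u 3 * w 0) * hv
      + (u 0 * v 3 - u 3 * v 0) * hw
  have h13 : crossProduct₄ u v w 1 * z 3 = crossProduct₄ u v w 3 * z 1 := by
    simp only [crossProduct₄, Matrix.cons_val]
    linear_combination (v 2 * w 0 - v 0 * w 2) * hu - (u 2 * w 0 - u 0 * w 2) * hv
      + (u 2 * v 0 - u 0 * v 2) * hw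
  have h23 : crossProduct₄ u v w 2 * z 3 = crossProduct₄ u v w 3 * z 2 := by
    simp only [crossProduct₄, Matrix.cons_val]
    linear_combination (v 0 * w 1 - v 1 * w 0) * hu - (u 0 * w 1 - u 1 * w 0) * hv
      + (u 0 * v 1 - u 1 * v 0) * hw
  intro i j
  fin_cases i <;> fin_cases j <;>
    first | rfl | assumption | (symm; assumption)

theorem crossProduct₄_eq_det (z : Fin 4 → A) :
    (Matrix.of ![z, u, v, w]).det = ∑ i, z i * crossProduct₄ u v w i := by
  simp only [Matrix.det_succ_row_zero, Fin.sum_univ_succ, crossProduct₄, Matrix.cons_val]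
  simp [Fin.succAbove, Fin.lt_def]
  ring

end crossProduct₄

/-- Independent vectors extend to a basis, and the determinant of the basis is the pairing of the
added vector with the minors. -/
theorem not_linearIndependent_of_crossProduct₄_eq_zero {K : Type*} [Field K] {u v w : Fin 4 → K}
    (h : crossProduct₄ u v w = 0) : ¬ LinearIndependent K ![u, v, w] := by
  intro hli
  have hspan : Submodule.span K (Set.range ![u, v, w]) ≠ ⊤ := by
    intro htop
    have h1 := finrank_span_eq_card hli
    rw [htop, finrank_top] at h1
    simp at h1
  obtain ⟨z, hz⟩ : ∃ z, z ∉ Submodule.span K (Set.range ![u, v, w]) := by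
    by_contra! hall
    exact hspan (Submodule.eq_top_iff'.2 hall)
  have h4 : LinearIndependent K ![z, u, v, w] :=
    linearIndependent_finCons.2 ⟨hli, hz⟩
  have hdet : (Matrix.of ![z, u, v, w]).det ≠ 0 := by
    have := (Matrix.linearIndependent_rows_iff_isUnit (A := Matrix.of ![z, u, v, w])).1 h4
    exact ((Matrix.isUnit_iff_isUnit_det _).1 this).ne_zero
  apply hdet
  rw [crossProduct₄_eq_det, h]
  simp

theorem dirDeriv_aeval {K A σ τ : Type*} [Fintype σ] [Fintype τ] [CommRing K] [CommRing A]
    [Algebra K A] (Q : σ → MvPolynomial τ K) (f : MvPolynomial σ K) (y t : τ → A) :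
    dirDeriv (aeval Q f) y t
      = dirDeriv f (fun i => aeval y (Q i)) (fun i => dirDeriv (Q i) y t) := by
  simp only [dirDeriv, derivation_aeval, map_sum, smul_eq_mul, map_mul, Finset.sum_mul,
    Finset.mul_sum]
  rw [Finset.sum_comm]
  refine Finset.sum_congr rfl fun i _ => Finset.sum_congr rfl fun j _ => ?_
  rw [mul_assoc]
  congr 1
  exact comp_aeval_apply (φ := aeval y) Q _

theorem MvPolynomial.aeval_aeval {K A σ τ : Type*} [CommRing K] [CommRing A]
    [Algebra K A] (Q : σ → MvPolynomial τ K) (f : MvPolynomial σ K) (y : τ → A) :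
    aeval y (aeval Q f) = aeval (fun i => aeval y (Q i)) f :=
  comp_aeval_apply (φ := aeval y) Q f

/-- `X 0` and `X 1` have no common prime factor. Applied to a local expression of `p` composed with
`Q`, this gives the factor by which it differs from the identity. -/
theorem exists_eq_mul_X {K : Type*} [Field K] {n : ℕ} {f : Fin (n + 2) → MvPolynomial (Fin (n + 2)) K}
    (h : Parallel f X) : ∃ μ, ∀ i, f i = μ * X i := by
  refine exists_eq_mul_of_forall_mul_eq_mul h ⟨0, X_ne_zero _⟩ fun ϖ hϖ hall => ?_
  have h0 : Associated ϖ (X 0) := hϖ.irreducible.associated_of_dvd (X_prime).irreducible (hall 0)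
  have h1 : (X 0 : MvPolynomial (Fin (n + 2)) K) ∣ X 1 := h0.symm.dvd.trans (hall 1)
  rw [X_dvd_X] at h1
  simp at h1

/-- Replacing a column by means of a linear relation; it will be applied to Euler's relation among
the partial derivatives of `Q`. -/
theorem mul_crossProduct₄_eq {A : Type*} [CommRing A] {u v w x : Fin 4 → A} {a b c e : A}
    (h : ∀ i, a * v i + b * w i + c * x i = e * u i) (i : Fin 4) :
    b * crossProduct₄ u w x i = a * crossProduct₄ u x v i := by
  fin_cases i <;> simp only [crossProduct₄, Matrix.cons_val, Fin.zero_eta, Fin.mk_one,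
    Fin.reduceFinMk]
  · linear_combination (u 3 * x 2 - u 2 * x 3) * h 1 + (u 1 * x 3 - u 3 * x 1) * h 2
      + (u 2 * x 1 - u 1 * x 2) * h 3
  · linear_combination -(u 3 * x 2 - u 2 * x 3) * h 0 - (u 0 * x 3 - u 3 * x 0) * h 2
      - (u 2 * x 0 - u 0 * x 2) * h 3
  · linear_combination (u 3 * x 1 - u 1 * x 3) * h 0 + (u 0 * x 3 - u 3 * x 0) * h 1
      + (u 1 * x 0 - u 0 * x 1) * h 3
  · linear_combination -(u 2 * x 1 - u 1 * x 2) * h 0 - (u 0 * x 2 - u 2 * x 0) * h 1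
      - (u 1 * x 0 - u 0 * x 1) * h 2

/-- Up to the scalar `x`, the column `D` is `a • P'` modulo the first column. This is the shape of
the derivative of an arc `X ^ r * P`. -/
theorem mul_crossProduct₄_smul {A : Type*} [CommRing A] {P P' D E : Fin 4 → A} {a b x : A}
    (h : ∀ i, x * D i = a * (b * P i + x * P' i)) (i : Fin 4) :
    x * crossProduct₄ (a • P) D E i = a * a * x * crossProduct₄ P P' E i := by
  fin_cases i <;> simp only [crossProduct₄, Matrix.cons_val, Fin.zero_eta, Fin.mk_one,
    Fin.reduceFinMk, Pi.smul_apply, smul_eq_mul]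
  · linear_combination a * ((P 3 * E 2 - P 2 * E 3) * h 1 + (P 1 * E 3 - P 3 * E 1) * h 2
      + (P 2 * E 1 - P 1 * E 2) * h 3)
  · linear_combination a * (-(P 3 * E 2 - P 2 * E 3) * h 0 - (P 0 * E 3 - P 3 * E 0) * h 2
      - (P 2 * E 0 - P 0 * E 2) * h 3)
  · linear_combination a * ((P 3 * E 1 - P 1 * E 3) * h 0 + (P 0 * E 3 - P 3 * E 0) * h 1
      + (P 1 * E 0 - P 0 * E 1) * h 3)
  · linear_combination a * (-(P 2 * E 1 - P 1 * E 2) * h 0 - (P 0 * E 2 - P 2 * E 0) * h 1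
      - (P 1 * E 0 - P 0 * E 1) * h 2)

/-! ### The Jacobian identity and the degree of the inverse. -/

/-- A parametrization `Q` of the smooth cubic surface `F = 0` by forms of degree `e`, together
with its inverse morphism to the plane, given by a map `π` on coordinate vectors. -/
structure InverseData {K : Type*} [Field K] (F : MvPolynomial (Fin 4) K)
    (Q : Fin 4 → MvPolynomial (Fin 3) K) (π : (Fin 4 → K) → (Fin 3 → K)) (e : ℕ) : Prop where
  cubic : F.IsHomogeneous 3
  smooth : ∀ v : Fin 4 → K, v ≠ 0 → aeval v F = 0 → ∃ i, aeval v (pderiv i F) ≠ 0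
  homogeneous : ∀ i, (Q i).IsHomogeneous e
  coprime : ∀ ϖ, Prime ϖ → ¬ ∀ i, ϖ ∣ Q i
  aeval_eq_zero : aeval Q F = 0
  ne_zero : ∀ v : Fin 4 → K, v ≠ 0 → aeval v F = 0 → π v ≠ 0
  exists_local : ∀ v : Fin 4 → K, v ≠ 0 → aeval v F = 0 →
    ∃ (d : ℕ) (f : Fin 3 → MvPolynomial (Fin 4) K), (∀ j, (f j).IsHomogeneous d) ∧
      (fun j => aeval v (f j)) ≠ 0 ∧ Parallel (fun j => aeval Q (f j)) X ∧
      ∀ v' : Fin 4 → K, v' ≠ 0 → aeval v' F = 0 → Parallel (fun j => aeval v' (f j)) (π v')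

namespace InverseData

variable {K : Type*} [Field K] [IsAlgClosed K] {F : MvPolynomial (Fin 4) K}
  {Q : Fin 4 → MvPolynomial (Fin 3) K} {π : (Fin 4 → K) → (Fin 3 → K)} {e : ℕ}

omit [IsAlgClosed K] in
theorem exists_ne_zero (h : InverseData F Q π e) : ∃ i, Q i ≠ 0 := by
  by_contra! hall
  exact h.coprime (X 0) X_prime fun i => by rw [hall i]; exact dvd_zero _

omit [IsAlgClosed K] in
theorem aeval_aeval_eq_zero {A : Type*} [CommRing A] [Algebra K A] (h : InverseData F Q π e)
    (y : Fin 3 → A) : aeval (fun i => aeval y (Q i)) F = 0 := by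
  rw [← aeval_aeval, h.aeval_eq_zero, map_zero]

theorem not_forall_aeval_eq_zero (h : InverseData F Q π e) {ϖ : MvPolynomial (Fin 3) K}
    (hϖ : Prime ϖ) : ∃ y : Fin 3 → K, aeval y ϖ = 0 ∧ (fun i => aeval y (Q i)) ≠ 0 := by
  by_contra! hall
  exact h.coprime ϖ hϖ fun i => dvd_of_forall_aeval_eq_zero hϖ fun y hy => congrFun (hall y hy) i

theorem exists_ne_zero_aeval_ne_zero (h : InverseData F Q π e) :
    ∃ y : Fin 3 → K, y ≠ 0 ∧ (fun i => aeval y (Q i)) ≠ 0 := by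
  obtain ⟨i, hi⟩ := h.exists_ne_zero
  by_contra! hall
  apply hi
  have : Infinite K := IsAlgClosed.instInfinite
  refine eq_zero_of_forall_aeval_eq_zero_of_ne (X_ne_zero 0 : (X 0 : MvPolynomial (Fin 3) K) ≠ 0)
    fun v hv => congrFun (hall v ?_) i
  rintro rfl
  simp at hv

omit [IsAlgClosed K] in
/-- The differential of the parametrization is injective modulo the radial direction. -/
theorem parallel_of_dirDeriv_eq_smul (h : InverseData F Q π e) {y t : Fin 3 → K}
    (hQ : (fun i => aeval y (Q i)) ≠ 0) {c : K} (ht : ∀ i, dirDeriv (Q i) y t = c * aeval y (Q i)) :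
    Parallel t y := by
  obtain ⟨d, f, hf, hf0, hfQ, -⟩ := h.exists_local _ hQ (h.aeval_aeval_eq_zero y)
  obtain ⟨p, hp⟩ := exists_eq_mul_X hfQ
  have hp' : ∀ j, aeval (fun i => aeval y (Q i)) (f j) = aeval y p * y j := fun j => by
    rw [← aeval_aeval, hp j, map_mul, aeval_X]
  have hpy : aeval y p ≠ 0 := by
    intro h0
    apply hf0
    funext j
    simp only [hp', h0, zero_mul, Pi.zero_apply]
  -- Differentiate `f ∘ Q = p • X` in the direction `t`. On the left the direction is radial, so
  -- Euler's relation evaluates it.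
  have key : ∀ j, c * (d * (aeval y p * y j)) = aeval y p * t j + y j * dirDeriv p y t := by
    intro j
    have h1 : dirDeriv (aeval Q (f j)) y t = dirDeriv (p * X j) y t := by rw [hp j]
    rw [dirDeriv_aeval, dirDeriv_poly_mul, dirDeriv_X, aeval_X] at h1
    have h2 : (fun i => dirDeriv (Q i) y t) = c • (fun i => aeval y (Q i)) := funext ht
    rw [h2, dirDeriv_smul, dirDeriv_self (hf j), hp'] at h1
    exact h1
  intro i j
  apply mul_left_cancel₀ hpy
  linear_combination y i * key j - y j * key i

/-- The minors of the Jacobian matrix of the parametrization. -/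
theorem exists_crossProduct₄_eq (h : InverseData F Q π e) :
    ∃ μ : MvPolynomial (Fin 3) K, ∀ c i,
      crossProduct₄ Q (fun i => pderiv (c + 1) (Q i)) (fun i => pderiv (c + 2) (Q i)) i
        = μ * X c * aeval Q (pderiv i F) := by
  -- The gradient along `Q` is orthogonal to the partial derivatives of `Q` by the chain rule and to
  -- `Q` itself by Euler's relation; hence it is proportional to the minors.
  have hFQ : ∀ a, ∑ i, aeval Q (pderiv i F) * pderiv a (Q i) = 0 := by
    intro a
    have := derivation_aeval (pderiv a) F Q
    rw [h.aeval_eq_zero, map_zero] at this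
    simpa using this.symm
  have hF0 : ∑ i, aeval Q (pderiv i F) * Q i = 0 := by
    have := dirDeriv_self h.cubic Q
    rwa [h.aeval_eq_zero, mul_zero] at this
  have hgrad : ∀ y : Fin 3 → K, (∀ i, aeval y (aeval Q (pderiv i F)) = 0) →
      (fun i => aeval y (Q i)) = 0 := by
    intro y hy
    by_contra hne
    obtain ⟨i, hi⟩ := h.smooth _ hne (h.aeval_aeval_eq_zero y)
    apply hi
    rw [← aeval_aeval, hy]
  have hex : ∃ i, aeval Q (pderiv i F) ≠ 0 := by
    by_contra! hall
    obtain ⟨y, -, hy⟩ := h.exists_ne_zero_aeval_ne_zero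
    exact hy (hgrad y fun i => by rw [hall, map_zero])
  -- A common prime factor of the gradient would vanish at some `y` with `Q(y) ≠ 0`, a singular
  -- point of the surface.
  have hprime : ∀ ϖ, Prime ϖ → ¬ ∀ i, ϖ ∣ aeval Q (pderiv i F) := by
    intro ϖ hϖ hall
    obtain ⟨y, hy, hne⟩ := h.not_forall_aeval_eq_zero hϖ
    refine hne (hgrad y fun i => ?_)
    obtain ⟨q, hq⟩ := hall i
    rw [hq, map_mul, hy, zero_mul]
  have hμ := fun c => exists_eq_mul_of_forall_mul_eq_mul
    (crossProduct₄_parallel Q (fun i => pderiv (c + 1) (Q i)) (fun i => pderiv (c + 2) (Q i))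
      hF0 (hFQ (c + 1)) (hFQ (c + 2))) hex hprime
  choose μ hμ using hμ
  obtain ⟨j, hj⟩ := hex
  have heuler : ∀ i, X 0 * pderiv 0 (Q i) + X 1 * pderiv 1 (Q i) + X 2 * pderiv 2 (Q i)
      = (e : MvPolynomial (Fin 3) K) * Q i := by
    intro i
    have := (h.homogeneous i).sum_X_mul_pderiv
    rwa [Fin.sum_univ_three, nsmul_eq_mul] at this
  -- Euler's relation compares the minors for the three choices of a pair of variables, and so
  -- produces the factor `X c`.
  have hpar : Parallel μ X := by
    have h0 := hμ 0 j
    have h1 := hμ 1 j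
    have h2 := hμ 2 j
    simp only [zero_add, Fin.reduceAdd] at h0 h1 h2
    have heuler' := fun i => (add_rotate _ _ _).symm.trans (heuler i)
    have heuler'' := fun i => (add_rotate _ _ _).symm.trans (heuler' i)
    have e01 : μ 0 * X 1 = μ 1 * X 0 := by
      apply mul_right_cancel₀ hj
      linear_combination mul_crossProduct₄_eq heuler j - X 1 * h0 + X 0 * h1
    have e12 : μ 1 * X 2 = μ 2 * X 1 := by
      apply mul_right_cancel₀ hj
      linear_combination mul_crossProduct₄_eq heuler' j - X 2 * h1 + X 1 * h2
    have e02 : μ 0 * X 2 = μ 2 * X 0 := by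
      apply mul_right_cancel₀ hj
      linear_combination - mul_crossProduct₄_eq heuler'' j - X 2 * h0 + X 0 * h2
    intro a b
    fin_cases a <;> fin_cases b <;> first | rfl | assumption | (symm; assumption)
  obtain ⟨ν, hν⟩ := exists_eq_mul_X hpar
  exact ⟨ν, fun c i => by rw [hμ, hν]⟩

-- A relation between the three columns gives a direction `t` whose derivative is radial, so `t` is
-- proportional to `y`. As `t` has coordinate zero at an index `c` with `y c ≠ 0`, the relation is
-- trivial.
omit [IsAlgClosed K] in
theorem crossProduct₄_ne_zero (h : InverseData F Q π e) {y : Fin 3 → K} (hy : y ≠ 0)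
    (hQ : (fun i => aeval y (Q i)) ≠ 0) : ∃ c, crossProduct₄ (fun i => aeval y (Q i))
      (fun i => aeval y (pderiv (c + 1) (Q i))) (fun i => aeval y (pderiv (c + 2) (Q i))) ≠ 0 := by
  obtain ⟨c, hc⟩ := Function.ne_iff.1 hy
  refine ⟨c, fun h0 => not_linearIndependent_of_crossProduct₄_eq_zero h0 ?_⟩
  rw [Fintype.linearIndependent_iff]
  intro g hg
  simp only [Fin.sum_univ_three, Matrix.cons_val] at hg
  have hne1 : c + 1 ≠ c := (by decide : ∀ c : Fin 3, c + 1 ≠ c) c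
  have hne2 : c + 2 ≠ c := (by decide : ∀ c : Fin 3, c + 2 ≠ c) c
  have hne12 : c + 1 ≠ c + 2 := (by decide : ∀ c : Fin 3, c + 1 ≠ c + 2) c
  rw [Pi.zero_apply] at hc
  let t : Fin 3 → K := Pi.single (c + 1) (g 1) + Pi.single (c + 2) (g 2)
  have ht : ∀ i, dirDeriv (Q i) y t = -g 0 * aeval y (Q i) := by
    intro i
    have h1 := congrFun hg i
    simp only [Pi.add_apply, Pi.smul_apply, smul_eq_mul, Pi.zero_apply] at h1
    have h2 : dirDeriv (Q i) y t = aeval y (pderiv (c + 1) (Q i)) * g 1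
        + aeval y (pderiv (c + 2) (Q i)) * g 2 := by
      rw [dirDeriv_add]
      simp [dirDeriv, Pi.single_apply]
    rw [h2]
    linear_combination h1
  have hpar := h.parallel_of_dirDeriv_eq_smul hQ ht
  have hg1 : g 1 = 0 := by
    have := hpar (c + 1) c
    simpa [t, Pi.single_apply, hne1, hne2, hne12, hne1.symm, hne2.symm, hne12.symm, hc] using this
  have hg2 : g 2 = 0 := by
    have := hpar (c + 2) c
    simpa [t, Pi.single_apply, hne1, hne2, hne12, hne1.symm, hne2.symm, hne12.symm, hc] using this
  have hg0 : g 0 = 0 := by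
    obtain ⟨i, hi⟩ := Function.ne_iff.1 hQ
    have h1 := ht i
    simp only [t, hg1, hg2, Pi.single_zero, add_zero] at h1
    refine (mul_eq_zero.1 ?_).resolve_right hi
    rw [← neg_eq_zero, ← neg_mul, ← h1]
    simp [dirDeriv]
  intro i
  fin_cases i <;> assumption

theorem aeval_crossProduct₄ {A B : Type*} [CommRing A] [CommRing B] (φ : A →+* B)
    (u v w : Fin 4 → A) (i : Fin 4) : φ (crossProduct₄ u v w i)
      = crossProduct₄ (fun i => φ (u i)) (fun i => φ (v i)) (fun i => φ (w i)) i := by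
  fin_cases i <;> simp [crossProduct₄]

omit [IsAlgClosed K] in
theorem isHomogeneous_crossProduct₄ {a b c : ℕ} {u v w : Fin 4 → MvPolynomial (Fin 3) K}
    (hu : ∀ i, (u i).IsHomogeneous a) (hv : ∀ i, (v i).IsHomogeneous b)
    (hw : ∀ i, (w i).IsHomogeneous c) (i : Fin 4) :
    (crossProduct₄ u v w i).IsHomogeneous (a + (b + c)) := by
  have key : ∀ p q r, (u p * (v q * w r - v r * w q)).IsHomogeneous (a + (b + c)) := fun p q r =>
    (hu p).mul (((hv q).mul (hw r)).sub ((hv r).mul (hw q)))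
  fin_cases i
  · exact ((key _ _ _).sub (key _ _ _)).add (key _ _ _)
  · exact (((key _ _ _).sub (key _ _ _)).add (key _ _ _)).neg
  · exact ((key _ _ _).sub (key _ _ _)).add (key _ _ _)
  · exact (((key _ _ _).sub (key _ _ _)).add (key _ _ _)).neg

/-- The inverse of a birational morphism to the plane is given by cubic forms. -/
theorem degree_eq_three (h : InverseData F Q π e) :
    e = 3 ∧ ∃ m : K, m ≠ 0 ∧ ∀ c i,
      crossProduct₄ Q (fun i => pderiv (c + 1) (Q i)) (fun i => pderiv (c + 2) (Q i)) i
        = C m * X c * aeval Q (pderiv i F) := by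
  obtain ⟨μ, hμ⟩ := h.exists_crossProduct₄_eq
  have hμy : ∀ y : Fin 3 → K, y ≠ 0 → (fun i => aeval y (Q i)) ≠ 0 → aeval y μ ≠ 0 := by
    intro y hy hQ h0
    obtain ⟨c, hc⟩ := h.crossProduct₄_ne_zero hy hQ
    apply hc
    funext i
    have := congrArg (aeval y : MvPolynomial (Fin 3) K →ₐ[K] K) (hμ c i)
    rw [map_mul, map_mul, h0, zero_mul, zero_mul, ← AlgHom.coe_toRingHom,
      aeval_crossProduct₄] at this
    exact this
  obtain ⟨y, hy, hQ⟩ := h.exists_ne_zero_aeval_ne_zero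
  obtain ⟨c, hc⟩ := h.crossProduct₄_ne_zero hy hQ
  obtain ⟨i, hi⟩ := Function.ne_iff.1 hc
  have he : e ≠ 0 := by
    rintro rfl
    have hd : ∀ a i, pderiv a (Q i) = 0 := by
      intro a i
      have := h.homogeneous i
      rw [← totalDegree_zero_iff_isHomogeneous, totalDegree_eq_zero_iff_eq_C] at this
      rw [this, pderiv_C]
    apply hi
    simp only [hd, map_zero]
    fin_cases i <;> simp [crossProduct₄]
  have hμ0 : μ ≠ 0 := fun h0 => hμy y hy hQ (by rw [h0, map_zero])
  -- A prime factor of `μ` would have a zero outside the base locus, where some minor is nonzero.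
  have hunit : IsUnit μ := by
    by_contra hu
    obtain ⟨ϖ, hϖ, q, rfl⟩ := WfDvdMonoid.exists_irreducible_factor hu hμ0
    obtain ⟨z, hz, hzQ⟩ := h.not_forall_aeval_eq_zero hϖ.prime
    refine hμy z ?_ hzQ (by rw [map_mul, hz, zero_mul])
    rintro rfl
    apply hzQ
    funext i
    have := aeval_smul_of_isHomogeneous (h.homogeneous i) (0 : K) (0 : Fin 3 → K)
    rw [zero_smul, zero_pow he, zero_mul] at this
    exact this
  obtain ⟨m, hm, rfl⟩ := isUnit_iff_eq_C_of_isReduced.1 hunit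
  refine ⟨?_, m, hm.ne_zero, hμ⟩
  -- The degrees give `e + 2 * (e - 1) = 1 + 2 * e`; the truncated subtraction is harmless because
  -- `e ≠ 0`.
  have hL : (crossProduct₄ Q (fun i => pderiv (c + 1) (Q i)) (fun i => pderiv (c + 2) (Q i))
      i).IsHomogeneous (e + ((e - 1) + (e - 1))) :=
    isHomogeneous_crossProduct₄ h.homogeneous (fun i => (h.homogeneous i).pderiv)
      (fun i => (h.homogeneous i).pderiv) i
  have hR : (C m * X c * aeval Q (pderiv i F)).IsHomogeneous (0 + 1 + e * (3 - 1)) :=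
    ((isHomogeneous_C _ _).mul (isHomogeneous_X _ _)).mul
      (h.cubic.pderiv.aeval _ fun i => h.homogeneous i)
  rw [← hμ] at hR
  have := hL.inj_right hR fun h0 => hi (by
    have := congrArg (aeval y : MvPolynomial (Fin 3) K →ₐ[K] K) h0
    rw [← AlgHom.coe_toRingHom, aeval_crossProduct₄] at this
    simpa using this)
  omega

end InverseData

/-! ### Determinants in the plane and parametrized lines. -/

/-- The determinant of three vectors in a three-dimensional space. -/
def det₃ {A : Type*} [CommRing A] (u v w : Fin 3 → A) : A :=
  u 0 * (v 1 * w 2 - v 2 * w 1) + u 1 * (v 2 * w 0 - v 0 * w 2) + u 2 * (v 0 * w 1 - v 1 * w 0)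

theorem exists_det₃_ne_zero {K : Type*} [Field K] {s t : Fin 3 → K} (h : ¬ Parallel s t) :
    ∃ w, det₃ s t w ≠ 0 := by
  by_contra! hall
  have h0 := hall ![1, 0, 0]
  have h1 := hall ![0, 1, 0]
  have h2 := hall ![0, 0, 1]
  simp only [det₃, Matrix.cons_val] at h0 h1 h2
  have e01 : s 0 * t 1 = s 1 * t 0 := by linear_combination h2
  have e02 : s 0 * t 2 = s 2 * t 0 := by linear_combination -h1
  have e12 : s 1 * t 2 = s 2 * t 1 := by linear_combination h0
  apply h
  intro a b
  fin_cases a <;> fin_cases b <;> first | rfl | assumption | (symm; assumption)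

theorem exists_not_parallel {K : Type*} [Field K] {s : Fin 3 → K} (hs : s ≠ 0) :
    ∃ t, ¬ Parallel s t := by
  obtain ⟨c, hc⟩ := Function.ne_iff.1 hs
  rw [Pi.zero_apply] at hc
  refine ⟨Pi.single (c + 1) 1, fun h => hc ?_⟩
  have hne1 : c ≠ c + 1 := (by decide : ∀ c : Fin 3, c ≠ c + 1) c
  simpa [Pi.single_apply, hne1] using h c (c + 1)

theorem smul_eq_of_det₃ {A : Type*} [CommRing A] (s t w x : Fin 3 → A) :
    det₃ s t w • x = det₃ x t w • s + det₃ s x w • t + det₃ s t x • w := by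
  funext i
  fin_cases i <;> simp [det₃] <;> ring

theorem det₃_ne_zero_of_not_mem {K : Type*} [Field K] {s t x : Fin 3 → K} (h : ¬ Parallel s t)
    (hx : ∀ a b : K, x ≠ a • s + b • t) : det₃ s t x ≠ 0 := by
  intro h0
  obtain ⟨w, hw⟩ := exists_det₃_ne_zero h
  have := smul_eq_of_det₃ s t w x
  rw [h0, zero_smul, add_zero] at this
  refine hx ((det₃ s t w)⁻¹ * det₃ x t w) ((det₃ s t w)⁻¹ * det₃ s x w) ?_
  rw [mul_smul, mul_smul, ← smul_add, ← this, inv_smul_smul₀ hw]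

/-- The coordinates of a family of polynomials at a point. -/
noncomputable abbrev evalVec {K A : Type*} [CommRing K] [CommRing A] [Algebra K A] {σ ι : Type*}
    (Q : ι → MvPolynomial σ K) (y : σ → A) : ι → A := fun i => aeval y (Q i)

/-- The derivative of a family of polynomials at a point in a given direction. -/
noncomputable abbrev dirVec {K A : Type*} [CommRing K] [CommRing A] [Algebra K A] {σ ι : Type*}
    [Fintype σ] (Q : ι → MvPolynomial σ K) (y t : σ → A) : ι → A := fun i => dirDeriv (Q i) y t

/-- The affine parametrization `ε ↦ s + ε t` of a line. -/
noncomputable def lineParam {K ι : Type*} [CommRing K] (s t : ι → K) : ι → Polynomial K :=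
  fun j => Polynomial.C (s j) + Polynomial.X * Polynomial.C (t j)

section lineParam

variable {K σ : Type*} [CommRing K] [Fintype σ]

theorem eval_lineParam {ι : Type*} (s t : ι → K) (a : K) :
    (fun j => (lineParam s t j).eval a) = s + a • t := by
  funext j
  simp [lineParam]
  exact mul_comm _ _

omit [Fintype σ] in
theorem aeval_C_comp (G : MvPolynomial σ K) (s : σ → K) :
    aeval (fun j => Polynomial.C (s j)) G = Polynomial.C (aeval s G) :=
  (comp_aeval_apply (φ := Polynomial.CAlgHom) s G).symm

theorem dirDeriv_C_comp (G : MvPolynomial σ K) (s t : σ → K) :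
    dirDeriv G (fun j => Polynomial.C (s j)) (fun j => Polynomial.C (t j))
      = Polynomial.C (dirDeriv G s t) :=
  (map_dirDeriv (Polynomial.CAlgHom : K →ₐ[K] Polynomial K) G s t).symm

omit [Fintype σ] in
theorem eval_aeval (G : MvPolynomial σ K) (y : σ → Polynomial K) (a : K) :
    (aeval y G).eval a = aeval (fun j => (y j).eval a) G := by
  rw [← Polynomial.coe_aeval_eq_eval]
  exact comp_aeval_apply (φ := Polynomial.aeval a) y G

theorem eval_dirDeriv (G : MvPolynomial σ K) (y t : σ → Polynomial K) (a : K) :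
    (dirDeriv G y t).eval a = dirDeriv G (fun j => (y j).eval a) (fun j => (t j).eval a) := by
  have := map_dirDeriv (Polynomial.aeval a : Polynomial K →ₐ[K] K) G y t
  simpa only [Polynomial.coe_aeval_eq_eval] using this

theorem derivative_aeval (G : MvPolynomial σ K) (y : σ → Polynomial K) :
    Polynomial.derivative (aeval y G) = dirDeriv G y (fun j => Polynomial.derivative (y j)) := by
  have := derivation_aeval (Polynomial.derivative' : Derivation K (Polynomial K) (Polynomial K)) G y
  simpa only [Polynomial.derivative'_apply, smul_eq_mul, dirDeriv] using this

theorem derivative_lineParam {ι : Type*} (s t : ι → K) :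
    (fun j => Polynomial.derivative (lineParam s t j)) = fun j => Polynomial.C (t j) := by
  funext j
  simp [lineParam]

theorem aeval_lineParam {G : MvPolynomial σ K} (hG : G.IsHomogeneous 3) (s t : σ → K) :
    aeval (lineParam s t) G = Polynomial.C (aeval s G)
      + Polynomial.X * Polynomial.C (dirDeriv G s t)
      + Polynomial.X ^ 2 * Polynomial.C (dirDeriv G t s)
      + Polynomial.X ^ 3 * Polynomial.C (aeval t G) := by
  have h := aeval_smul_add_smul hG (1 : Polynomial K) Polynomial.X
    (fun j => Polynomial.C (s j)) (fun j => Polynomial.C (t j))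
  rw [dirDeriv_C_comp, dirDeriv_C_comp, aeval_C_comp, aeval_C_comp] at h
  have hl : lineParam s t = (1 : Polynomial K) • (fun j => Polynomial.C (s j))
      + (Polynomial.X : Polynomial K) • (fun j => Polynomial.C (t j)) := by
    funext j
    simp [lineParam]
  rw [hl, h]
  ring

end lineParam

/-! ### Arcs through base points and the rank of the differential. -/

namespace InverseData

variable {K : Type*} [Field K] {F : MvPolynomial (Fin 4) K}
  {Q : Fin 4 → MvPolynomial (Fin 3) K} {π : (Fin 4 → K) → (Fin 3 → K)}

/-- The minors are alternating and bilinear in the two directions, so the identity for coordinate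
directions gives the one for all directions. A general algebra `A` is allowed because arcs are
points over a polynomial ring. -/
theorem exists_crossProduct₄_dirVec_eq [IsAlgClosed K] (h : InverseData F Q π 3) :
    ∃ m : K, m ≠ 0 ∧ ∀ {A : Type _} [CommRing A] [Algebra K A] (y u w : Fin 3 → A) (i : Fin 4),
      crossProduct₄ (evalVec Q y) (dirVec Q y u) (dirVec Q y w) i
        = algebraMap K A m * det₃ y u w * aeval (evalVec Q y) (pderiv i F) := by
  obtain ⟨-, m, hm, hmQ⟩ := h.degree_eq_three
  refine ⟨m, hm, fun {A} _ _ y u w i => ?_⟩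
  have key : ∀ c, crossProduct₄ (evalVec Q y) (fun i => aeval y (pderiv (c + 1) (Q i)))
      (fun i => aeval y (pderiv (c + 2) (Q i))) i
        = algebraMap K A m * y c * aeval (evalVec Q y) (pderiv i F) := by
    intro c
    have := congrArg (aeval y : MvPolynomial (Fin 3) K →ₐ[K] A) (hmQ c i)
    rw [← AlgHom.coe_toRingHom, aeval_crossProduct₄] at this
    rw [← aeval_aeval]
    simpa using this
  have k0 := key 0
  have k1 := key 1
  have k2 := key 2
  simp only [zero_add, Fin.reduceAdd] at k0 k1 k2
  have hexp : crossProduct₄ (evalVec Q y) (dirVec Q y u) (dirVec Q y w) i =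
      (u 1 * w 2 - u 2 * w 1) * crossProduct₄ (evalVec Q y) (fun i => aeval y (pderiv 1 (Q i)))
        (fun i => aeval y (pderiv 2 (Q i))) i
      + (u 2 * w 0 - u 0 * w 2) * crossProduct₄ (evalVec Q y) (fun i => aeval y (pderiv 2 (Q i)))
        (fun i => aeval y (pderiv 0 (Q i))) i
      + (u 0 * w 1 - u 1 * w 0) * crossProduct₄ (evalVec Q y) (fun i => aeval y (pderiv 0 (Q i)))
        (fun i => aeval y (pderiv 1 (Q i))) i := by
    fin_cases i <;> simp only [crossProduct₄, dirDeriv, Fin.sum_univ_three, Matrix.cons_val,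
      Fin.zero_eta, Fin.mk_one, Fin.reduceFinMk] <;> ring
  rw [hexp, k0, k1, k2, det₃]
  ring

variable [IsAlgClosed K]

omit [IsAlgClosed K] in
theorem aeval_factor_eq_zero (h : InverseData F Q π 3) {y : Fin 3 → Polynomial K} {l : Polynomial K}
    {R : Fin 4 → Polynomial K} (hR : ∀ i, aeval y (Q i) = l * R i) (hl : l ≠ 0) :
    aeval R F = 0 := by
  have h1 := h.aeval_aeval_eq_zero y
  have h2 : (fun i => aeval y (Q i)) = l • R := funext hR
  rw [h2, aeval_smul_of_isHomogeneous h.cubic] at h1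
  exact (mul_eq_zero.1 h1).resolve_left (pow_ne_zero _ hl)

/-- Along an arc through a base point, the limit point and the limit direction of the
parametrization. -/
theorem crossProduct₄_arc (h : InverseData F Q π 3) : ∃ m : K, m ≠ 0 ∧
    ∀ (s t : Fin 3 → K) (r : ℕ) (P : Fin 4 → Polynomial K),
    (∀ i, aeval (lineParam s t) (Q i) = Polynomial.X ^ r * P i) → ∀ w i,
    crossProduct₄ (fun i => (P i).eval 0) (fun i => (Polynomial.derivative (P i)).eval 0)
      (dirVec Q s w) i = m * det₃ s t w * aeval (fun i => (P i).eval 0) (pderiv i F) := by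
  obtain ⟨m, hm, hmQ⟩ := h.exists_crossProduct₄_dirVec_eq
  refine ⟨m, hm, fun s t r P hP w i => ?_⟩
  have h1 := hmQ (lineParam s t) (fun j => Polynomial.C (t j)) (fun j => Polynomial.C (w j)) i
  have h2 : evalVec Q (lineParam s t) = (Polynomial.X ^ r : Polynomial K) • P := funext hP
  -- The derivative of `X ^ r * P` is, modulo `P`, `X ^ r` times the derivative of `P`. The extra
  -- factor `X` avoids the exponent `r - 1`.
  have h3 : ∀ i, Polynomial.X * dirVec Q (lineParam s t) (fun j => Polynomial.C (t j)) i
      = Polynomial.X ^ r * ((r : Polynomial K) * P i + Polynomial.X * Polynomial.derivative (P i)) := by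
    intro i
    have := derivative_aeval (Q i) (lineParam s t)
    rw [derivative_lineParam, hP, Polynomial.derivative_mul, Polynomial.derivative_X_pow] at this
    change Polynomial.X * dirDeriv (Q i) _ _ = _
    rw [← this]
    rcases r with _ | r
    · simp
    · simp
      ring
  have h4 : det₃ (lineParam s t) (fun j => Polynomial.C (t j)) (fun j => Polynomial.C (w j))
      = Polynomial.C (det₃ s t w) := by
    simp only [det₃, lineParam, map_add, map_mul, map_sub]
    ring
  rw [h2, h4, aeval_smul_of_isHomogeneous h.cubic.pderiv] at h1
  -- The power `2 * r` comes from two columns on one side and from the quadratic gradient on the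
  -- other. After cancellation both sides can be evaluated at `0`.
  have h5 : Polynomial.X ^ (2 * r + 1) * crossProduct₄ P (fun i => Polynomial.derivative (P i))
      (dirVec Q (lineParam s t) (fun j => Polynomial.C (w j))) i
      = Polynomial.X ^ (2 * r + 1) * (algebraMap K (Polynomial K) m * Polynomial.C (det₃ s t w)
        * aeval P (pderiv i F)) := by
    have h6 : Polynomial.X * crossProduct₄ ((Polynomial.X ^ r : Polynomial K) • P)
        (dirVec Q (lineParam s t) (fun j => Polynomial.C (t j)))
        (dirVec Q (lineParam s t) (fun j => Polynomial.C (w j))) i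
        = Polynomial.X ^ (2 * r + 1) * crossProduct₄ P (fun i => Polynomial.derivative (P i))
      (dirVec Q (lineParam s t) (fun j => Polynomial.C (w j))) i := by
      rw [mul_crossProduct₄_smul h3]
      ring
    rw [← h6, h1]
    ring
  have h7 := mul_left_cancel₀ (pow_ne_zero _ Polynomial.X_ne_zero) h5
  have h8 := congrArg (Polynomial.evalRingHom (0 : K)) h7
  rw [aeval_crossProduct₄] at h8
  simp only [Polynomial.coe_evalRingHom, Polynomial.eval_mul, Polynomial.eval_C, eval_aeval,
    eval_dirDeriv, eval_lineParam, zero_smul, add_zero, Polynomial.algebraMap_eq] at h8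
  exact h8

end InverseData

namespace InverseData

variable {K : Type*} [Field K] {F : MvPolynomial (Fin 4) K}
  {Q : Fin 4 → MvPolynomial (Fin 3) K} {π : (Fin 4 → K) → (Fin 3 → K)}

theorem eval_factor_eq_zero (h : InverseData F Q π 3) {y : Fin 3 → Polynomial K} {l : Polynomial K}
    {R : Fin 4 → Polynomial K} (hR : ∀ i, aeval y (Q i) = l * R i) (hl : l ≠ 0) (a : K) :
    aeval (fun i => (R i).eval a) F = 0 := by
  rw [← eval_aeval, h.aeval_factor_eq_zero hR hl, Polynomial.eval_zero]

/-- A local expression of the inverse along an arc. -/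
theorem parallel_local_arc {d : ℕ} {f : Fin 3 → MvPolynomial (Fin 4) K}
    (hf : ∀ j, (f j).IsHomogeneous d) (hfQ : Parallel (fun j => aeval Q (f j)) X)
    {y : Fin 3 → Polynomial K} {l : Polynomial K} {R : Fin 4 → Polynomial K}
    (hR : ∀ i, aeval y (Q i) = l * R i) (hl : l ≠ 0) :
    Parallel (fun j => aeval R (f j)) y := by
  have h2 : (fun i => aeval y (Q i)) = l • R := funext hR
  have h3 : Parallel (fun j => aeval (fun i => aeval y (Q i)) (f j)) y := fun i j => by
    have := congrArg (aeval y : _ →ₐ[K] Polynomial K) (hfQ i j)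
    simpa only [map_mul, aeval_X, aeval_aeval] using this
  simp only [h2, aeval_smul_of_isHomogeneous (hf _)] at h3
  exact Parallel.of_smul_left (pow_ne_zero d hl) h3

/-- The inverse morphism along an arc. -/
theorem parallel_arc (h : InverseData F Q π 3) {y : Fin 3 → Polynomial K} {l : Polynomial K}
    {R : Fin 4 → Polynomial K} (hR : ∀ i, aeval y (Q i) = l * R i) (hl : l ≠ 0) {a : K}
    (ha : (fun i => (R i).eval a) ≠ 0) :
    Parallel (π fun i => (R i).eval a) (fun j => (y j).eval a) := by
  have hF := h.eval_factor_eq_zero hR hl a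
  obtain ⟨d, f, hf, hf0, hfQ, hfπ⟩ := h.exists_local _ ha hF
  have h1 := parallel_local_arc hf hfQ hR hl
  refine Parallel.trans hf0 (hfπ _ ha hF).symm fun i j => ?_
  have := congrArg (Polynomial.eval a) (h1 i j)
  simpa only [Polynomial.eval_mul, eval_aeval] using this

theorem parallel_apply_evalVec (h : InverseData F Q π 3) {y : Fin 3 → K}
    (hy : evalVec Q y ≠ 0) : Parallel (π (evalVec Q y)) y := by
  have hR : ∀ i, aeval (fun j => Polynomial.C (y j)) (Q i)
      = (1 : Polynomial K) * Polynomial.C (evalVec Q y i) := fun i => by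
    rw [aeval_C_comp, one_mul]
  have := h.parallel_arc hR one_ne_zero (a := 0)
    (by simpa only [Polynomial.eval_C] using hy)
  simpa only [Polynomial.eval_C] using this

theorem evalVec_mem (h : InverseData F Q π 3) (y : Fin 3 → K) : aeval (evalVec Q y) F = 0 :=
  h.aeval_aeval_eq_zero y

theorem aeval_lineParam_of_base (h : InverseData F Q π 3) {s : Fin 3 → K} (hs : evalVec Q s = 0)
    (t : Fin 3 → K) (i : Fin 4) : aeval (lineParam s t) (Q i) = Polynomial.X *
      (Polynomial.C (dirVec Q s t i) + Polynomial.X * Polynomial.C (dirVec Q t s i)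
        + Polynomial.X ^ 2 * Polynomial.C (evalVec Q t i)) := by
  rw [aeval_lineParam (h.homogeneous i), show aeval s (Q i) = 0 from congrFun hs i]
  simp only [map_zero]
  ring

theorem dirVec_mem (h : InverseData F Q π 3) {s : Fin 3 → K} (hs : evalVec Q s = 0)
    (t : Fin 3 → K) : aeval (dirVec Q s t) F = 0 := by
  have := h.eval_factor_eq_zero (h.aeval_lineParam_of_base hs t) Polynomial.X_ne_zero 0
  simpa using this

theorem parallel_apply_dirVec (h : InverseData F Q π 3) {s : Fin 3 → K} (hs : evalVec Q s = 0)
    {t : Fin 3 → K} (ht : dirVec Q s t ≠ 0) : Parallel (π (dirVec Q s t)) s := by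
  have := h.parallel_arc (h.aeval_lineParam_of_base hs t) Polynomial.X_ne_zero (a := 0)
    (by simpa using ht)
  simpa [lineParam] using this

theorem parallel_local_dirVec (h : InverseData F Q π 3) {d : ℕ}
    {f : Fin 3 → MvPolynomial (Fin 4) K}
    (hf : ∀ j, (f j).IsHomogeneous d) (hfQ : Parallel (fun j => aeval Q (f j)) X)
    {s : Fin 3 → K} (hs : evalVec Q s = 0) (t : Fin 3 → K) :
    Parallel (fun j => aeval (dirVec Q s t) (f j)) s := by
  have := parallel_local_arc hf hfQ (h.aeval_lineParam_of_base hs t) Polynomial.X_ne_zero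
  intro i j
  have h1 := congrArg (Polynomial.eval 0) (this i j)
  simp only [Polynomial.eval_mul, eval_aeval] at h1
  simpa [lineParam] using h1

theorem dirVec_self (h : InverseData F Q π 3) {s : Fin 3 → K} (hs : evalVec Q s = 0) :
    dirVec Q s s = 0 := by
  funext i
  rw [dirVec, dirDeriv_self (h.homogeneous i), show aeval s (Q i) = 0 from congrFun hs i, mul_zero]
  rfl

theorem dirVec_add (s t t' : Fin 3 → K) : dirVec Q s (t + t') = dirVec Q s t + dirVec Q s t' :=
  funext fun i => dirDeriv_add (Q i) s t t'

theorem dirVec_smul (s t : Fin 3 → K) (c : K) : dirVec Q s (c • t) = c • dirVec Q s t :=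
  funext fun i => dirDeriv_smul (Q i) s t c

variable [IsAlgClosed K]

/-- A nonzero limit would be a point of the surface. The arc identity has the zero column `dirVec Q
s w`, so the gradient at that point would vanish, against smoothness. -/
theorem eval_zero_eq_zero_of_arc (h : InverseData F Q π 3) {s t : Fin 3 → K}
    (hst : ¬ Parallel s t) (hd : ∀ w, det₃ s t w ≠ 0 → dirVec Q s w = 0)
    {r : ℕ} {P : Fin 4 → Polynomial K}
    (hP : ∀ i, aeval (lineParam s t) (Q i) = Polynomial.X ^ r * P i) :
    (fun i => (P i).eval 0) = 0 := by
  obtain ⟨m, hm, hmP⟩ := h.crossProduct₄_arc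
  obtain ⟨w, hw⟩ := exists_det₃_ne_zero hst
  by_contra h0
  obtain ⟨i, hi⟩ := h.smooth _ h0
    (h.eval_factor_eq_zero hP (pow_ne_zero r Polynomial.X_ne_zero) 0)
  have h1 := hmP s t r P hP w i
  rw [hd w hw] at h1
  have h2 : crossProduct₄ (fun i => (P i).eval 0) (fun i => (Polynomial.derivative (P i)).eval 0)
      0 i = 0 := by
    fin_cases i <;> simp [crossProduct₄]
  rw [h2] at h1
  exact mul_ne_zero (mul_ne_zero hm hw) hi h1.symm

/-- If the differential vanished at `s`, the arc lemma would kill first the quadratic and then the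
cubic term of `Q` along each line through `s`, and `Q` would vanish everywhere. -/
theorem exists_dirVec_ne_zero (h : InverseData F Q π 3) {s : Fin 3 → K} (hs0 : s ≠ 0)
    (hs : evalVec Q s = 0) : ∃ t, dirVec Q s t ≠ 0 := by
  by_contra! hall
  have hB : ∀ t, ¬ Parallel s t → dirVec Q t s = 0 := by
    intro t ht
    have := h.eval_zero_eq_zero_of_arc (r := 2) (P := fun i => Polynomial.C (dirVec Q t s i)
        + Polynomial.X * Polynomial.C (evalVec Q t i)) ht (fun w _ => hall w) (fun i => by
      rw [h.aeval_lineParam_of_base hs, hall]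
      simp only [Pi.zero_apply, map_zero]
      ring)
    simpa using this
  have hC : ∀ t, ¬ Parallel s t → evalVec Q t = 0 := by
    intro t ht
    have := h.eval_zero_eq_zero_of_arc (r := 3) (P := fun i => Polynomial.C (evalVec Q t i))
        ht (fun w _ => hall w) (fun i => by
      rw [h.aeval_lineParam_of_base hs, hall, hB t ht]
      simp only [Pi.zero_apply, map_zero]
      ring)
    simpa only [Polynomial.eval_C] using this
  obtain ⟨y, hy, hQ⟩ := h.exists_ne_zero_aeval_ne_zero
  by_cases hp : Parallel s y
  · obtain ⟨c, rfl⟩ := hp.symm.exists_smul hs0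
    apply hQ
    funext i
    simp only [aeval_smul_of_isHomogeneous (h.homogeneous i), congrFun hs i]
    exact mul_zero _
  · exact hQ (hC y hp)

/-- At a base point the differential of the parametrization has rank two. -/
theorem parallel_of_dirVec_eq_zero (h : InverseData F Q π 3) {s t : Fin 3 → K} (hs0 : s ≠ 0)
    (hs : evalVec Q s = 0) (ht : dirVec Q s t = 0) : Parallel s t := by
  obtain ⟨t₀, ht₀⟩ := h.exists_dirVec_ne_zero hs0 hs
  by_contra hst
  have hnp : ¬ Parallel s t₀ := by
    intro hp
    obtain ⟨c, rfl⟩ := hp.symm.exists_smul hs0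
    exact ht₀ (by rw [dirVec_smul, h.dirVec_self hs, smul_zero])
  have hdet : det₃ s t t₀ ≠ 0 := by
    refine det₃_ne_zero_of_not_mem hst fun a b hab => ht₀ ?_
    rw [hab, dirVec_add, dirVec_smul, dirVec_smul, h.dirVec_self hs, ht, smul_zero, smul_zero,
      add_zero]
  obtain ⟨m, hm, hmP⟩ := h.crossProduct₄_arc
  obtain ⟨i, hi⟩ := h.smooth _ ht₀ (h.dirVec_mem hs t₀)
  -- The arc in the direction `t₀` tends to the smooth point `dirVec Q s t₀`, while the column for
  -- the direction `t` is zero.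
  have h1 := hmP s t₀ 1 _ (fun i => by rw [pow_one]; exact h.aeval_lineParam_of_base hs t₀ i) t i
  rw [ht] at h1
  have h2 : ∀ u v : Fin 4 → K, crossProduct₄ u v 0 i = 0 := by
    intro u v
    fin_cases i <;> simp [crossProduct₄]
  rw [h2] at h1
  have h3 : det₃ s t₀ t = - det₃ s t t₀ := by
    simp only [det₃]
    ring
  rw [h3] at h1
  refine mul_ne_zero (mul_ne_zero hm (neg_ne_zero.2 hdet)) ?_ h1.symm
  simpa using hi

end InverseData

/-! ### The fibres above base points. -/

theorem exists_functionals {K : Type*} [Field K] {n : ℕ} {v e₁ e₂ : Fin n → K}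
    (h : LinearIndependent K ![v, e₁, e₂]) :
    ∃ ψ ψ₁ ψ₂ : Fin n → K, ψ ⬝ᵥ v = 1 ∧ ψ ⬝ᵥ e₁ = 0 ∧ ψ ⬝ᵥ e₂ = 0 ∧ ψ₁ ⬝ᵥ e₁ = 1 ∧ ψ₁ ⬝ᵥ e₂ = 0 ∧
      ψ₂ ⬝ᵥ e₁ = 0 ∧ ψ₂ ⬝ᵥ e₂ = 1 := by
  obtain ⟨g, hg⟩ := LinearMap.exists_leftInverse_of_injective
    (Fintype.linearCombination K ![v, e₁, e₂])
    (LinearMap.ker_eq_bot.2 (linearIndependent_iff_injective_fintypeLinearCombination.1 h))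
  have hg' : ∀ (c : Fin 3), g (![v, e₁, e₂] c) = Pi.single c 1 := by
    intro c
    have := LinearMap.congr_fun hg (Pi.single c 1)
    simpa [Fintype.linearCombination_apply_single] using this
  have hdot : ∀ (c : Fin 3) (x : Fin n → K), (fun i => g (Pi.single i 1) c) ⬝ᵥ x = g x c := by
    intro c x
    conv_rhs => rw [pi_eq_sum_univ' x]
    simp [dotProduct, mul_comm]
  have h0 := hg' 0
  have h1 := hg' 1
  have h2 := hg' 2
  simp only [Matrix.cons_val] at h0 h1 h2
  refine ⟨_, _, _, (hdot 0 v).trans ?_, (hdot 0 _).trans ?_, (hdot 0 _).trans ?_,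
    (hdot 1 _).trans ?_, (hdot 1 _).trans ?_, (hdot 2 _).trans ?_, (hdot 2 _).trans ?_⟩ <;>
  simp [h0, h1, h2]

namespace InverseData

variable {K : Type*} [Field K] {F : MvPolynomial (Fin 4) K}
  {Q : Fin 4 → MvPolynomial (Fin 3) K} {π : (Fin 4 → K) → (Fin 3 → K)}

/-- Substituting `Q` turns `f` into `p • X` and hence `Q ∘ f` into `p ^ 3 • Q`, so the minors become
zero. -/
theorem dvd_local (h : InverseData F Q π 3) (hdom : ∀ G, aeval Q G = 0 → F ∣ G)
    {f : Fin 3 → MvPolynomial (Fin 4) K}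
    (hfQ : Parallel (fun j => aeval Q (f j)) X) (i j : Fin 4) :
    F ∣ aeval f (Q i) * X j - aeval f (Q j) * X i := by
  apply hdom
  obtain ⟨p, hp⟩ := exists_eq_mul_X hfQ
  have h1 : (fun j => aeval Q (f j)) = p • X := funext hp
  simp only [map_sub, map_mul, aeval_aeval, aeval_X, h1,
    aeval_smul_of_isHomogeneous (h.homogeneous _), aeval_X_left_apply]
  ring

/-- A local expression differs from `π v` by a scalar, which enters `Q` as its cube; then
`dvd_local` is evaluated at `v`. At base points the conclusion is empty. -/
theorem parallel_evalVec_apply (h : InverseData F Q π 3) (hdom : ∀ G, aeval Q G = 0 → F ∣ G)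
    {v : Fin 4 → K} (hv : v ≠ 0) (hF : aeval v F = 0) : Parallel (evalVec Q (π v)) v := by
  obtain ⟨d, f, hf, hf0, hfQ, hfπ⟩ := h.exists_local v hv hF
  obtain ⟨c, hc⟩ := (hfπ v hv hF).symm.exists_smul hf0
  have h1 : evalVec Q (π v) = c ^ 3 • evalVec Q (fun j => aeval v (f j)) := by
    funext i
    rw [hc]
    exact aeval_smul_of_isHomogeneous (h.homogeneous i) _ _
  rw [h1]
  refine Parallel.smul_left _ fun i j => ?_
  obtain ⟨q, hq⟩ := h.dvd_local hdom hfQ i j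
  have := congrArg (aeval v : _ →ₐ[K] K) hq
  rw [map_mul, hF, zero_mul, map_sub, map_mul, map_mul, aeval_aeval, aeval_aeval, aeval_X, aeval_X,
    sub_eq_zero] at this
  exact this

/-- The expansion of a cubic form that vanishes at `s`. -/
theorem exists_expansion {A : Type*} [CommRing A] [Algebra K A] {G : MvPolynomial (Fin 3) K}
    (hG : G.IsHomogeneous 3) {s t w : Fin 3 → A} (hs : aeval s G = 0) (α β γ : A) :
    ∃ u₁ u₂ w₁ w₂ : A, aeval (α • s + (β • t + γ • w)) G =
      β * (α ^ 2 * dirDeriv G s t + β * u₁ + γ * u₂)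
        + γ * (α ^ 2 * dirDeriv G s w + β * w₁ + γ * w₂) := by
  obtain ⟨m, hm⟩ := exists_dirDeriv_smul_add_smul hG t w s
  have h1 := aeval_smul_add_smul hG α 1 s (β • t + γ • w)
  rw [one_smul, hm, aeval_smul_add_smul hG β γ t w, dirDeriv_add, dirDeriv_smul, dirDeriv_smul,
    hs] at h1
  refine ⟨α * dirDeriv G t s + β * aeval t G, α * m + β * dirDeriv G t w, 0,
    α * dirDeriv G w s + β * dirDeriv G w t + γ * aeval w G, h1.trans ?_⟩
  ring

variable [IsAlgClosed K]

/-- The kernel of the differential at `s` is spanned by `s`, so the images of `t` and `w` are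
independent, and a relation involving `v` would place it on the exceptional line. -/
theorem linearIndependent_of_ne_dirVec (h : InverseData F Q π 3) {s t w : Fin 3 → K} (hs0 : s ≠ 0)
    (hs : evalVec Q s = 0) (hw : det₃ s t w ≠ 0) {v : Fin 4 → K}
    (hnot : ∀ t, v ≠ dirVec Q s t) : LinearIndependent K ![v, dirVec Q s t, dirVec Q s w] := by
  have hsub : ∀ b c : K, b • dirVec Q s t + c • dirVec Q s w = 0 → b = 0 ∧ c = 0 := by
    intro b c hbc
    rw [← dirVec_smul, ← dirVec_smul, ← dirVec_add] at hbc
    have hpar := h.parallel_of_dirVec_eq_zero hs0 hs hbc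
    obtain ⟨a, ha⟩ := hpar.symm.exists_smul hs0
    have h1 : det₃ s (b • t + c • w) w = b * det₃ s t w := by
      simp only [det₃, Pi.add_apply, Pi.smul_apply, smul_eq_mul]
      ring
    have h2 : det₃ s t (b • t + c • w) = c * det₃ s t w := by
      simp only [det₃, Pi.add_apply, Pi.smul_apply, smul_eq_mul]
      ring
    have h3 : ∀ x, det₃ s (a • s) x = 0 := fun x => by
      simp only [det₃, Pi.smul_apply, smul_eq_mul]
      ring
    have h4 : ∀ x, det₃ s x (a • s) = 0 := fun x => by
      simp only [det₃, Pi.smul_apply, smul_eq_mul]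
      ring
    rw [ha, h3] at h1
    rw [ha, h4] at h2
    exact ⟨(mul_eq_zero.1 h1.symm).resolve_right hw, (mul_eq_zero.1 h2.symm).resolve_right hw⟩
  rw [Fintype.linearIndependent_iff]
  intro g hg
  simp only [Fin.sum_univ_three, Matrix.cons_val] at hg
  have hg0 : g 0 = 0 := by
    by_contra h0
    refine hnot ((-(g 0)⁻¹ * g 1) • t + (-(g 0)⁻¹ * g 2) • w) ?_
    rw [dirVec_add, dirVec_smul, dirVec_smul, mul_smul, mul_smul, ← smul_add]
    rw [add_assoc] at hg
    rw [eq_neg_of_add_eq_zero_right hg, neg_smul, smul_neg, neg_neg, inv_smul_smul₀ h0]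
  rw [hg0, zero_smul, zero_add] at hg
  obtain ⟨h1, h2⟩ := hsub _ _ hg
  intro i
  fin_cases i <;> assumption

/-- The fibre of the inverse morphism above a base point is contained in a line. -/
theorem exists_eq_dirVec (h : InverseData F Q π 3) (hdom : ∀ G, aeval Q G = 0 → F ∣ G)
    {v : Fin 4 → K} (hv : v ≠ 0) (hF : aeval v F = 0) (hs : evalVec Q (π v) = 0) :
    ∃ t, v = dirVec Q (π v) t := by
  have hs0 := h.ne_zero v hv hF
  obtain ⟨t, hst⟩ := exists_not_parallel hs0
  obtain ⟨w, hw⟩ := exists_det₃_ne_zero hst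
  obtain ⟨d, f, hf, hf0, hfQ, hfπ⟩ := h.exists_local v hv hF
  replace hfπ := hfπ v hv hF
  generalize π v = s at *
  by_contra! hnot
  have hli := h.linearIndependent_of_ne_dirVec hs0 hs hw hnot
  obtain ⟨ψ, ψ₁, ψ₂, hψ, hψ1, hψ2, h11, h12, h21, h22⟩ := exists_functionals hli
  -- coordinates of the local expression in the basis `s, t, w`
  let δ : MvPolynomial (Fin 4) K := C (det₃ s t w)⁻¹
  let s' : Fin 3 → MvPolynomial (Fin 4) K := fun j => C (s j)
  let t' : Fin 3 → MvPolynomial (Fin 4) K := fun j => C (t j)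
  let w' : Fin 3 → MvPolynomial (Fin 4) K := fun j => C (w j)
  obtain ⟨α, hα⟩ : ∃ α, α = δ * det₃ f t' w' := ⟨_, rfl⟩
  obtain ⟨β, hβ⟩ : ∃ β, β = δ * det₃ s' f w' := ⟨_, rfl⟩
  obtain ⟨γ, hγ⟩ : ∃ γ, γ = δ * det₃ s' t' f := ⟨_, rfl⟩
  have hfexp : f = α • s' + (β • t' + γ • w') := by
    have h1 := smul_eq_of_det₃ s' t' w' f
    have h2 : det₃ s' t' w' = C (det₃ s t w) := by simp [det₃, s', t', w']
    have h3 : δ * det₃ s' t' w' = 1 := by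
      rw [h2, ← map_mul, inv_mul_cancel₀ hw, map_one]
    have h4 := congrArg (δ • ·) h1
    simp only [smul_smul, smul_add, h3, one_smul] at h4
    rw [hα, hβ, hγ, ← add_assoc]
    exact h4
  obtain ⟨c, hc⟩ := hfπ.exists_smul hs0
  have hvf : ∀ j, aeval v (f j) = c * s j := fun j => congrFun hc j
  -- At `v` the local expression is a multiple of `s`, so its two other coordinates vanish and the
  -- first one does not.
  have hβv : aeval v β = 0 := by
    rw [hβ]
    simp only [det₃, map_mul, map_add, map_sub, hvf, s', w', aeval_C, Algebra.algebraMap_self,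
      RingHom.id_apply]
    ring
  have hγv : aeval v γ = 0 := by
    rw [hγ]
    simp only [det₃, map_mul, map_add, map_sub, hvf, s', t', aeval_C, Algebra.algebraMap_self,
      RingHom.id_apply]
    ring
  have hαv : aeval v α ≠ 0 := by
    intro h0
    apply hf0
    funext j
    rw [hfexp]
    simp only [Pi.add_apply, Pi.smul_apply, smul_eq_mul, map_add, map_mul, hβv, hγv, h0, zero_mul,
      add_zero, Pi.zero_apply]
  -- Since `s` is a base point, `Q ∘ f` lies in the ideal of `β` and `γ`, with coefficients that at
  -- `v` are `α ^ 2` times the images of `t` and `w`.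
  have hexp := fun i => exists_expansion (h.homogeneous i) (s := s') (t := t') (w := w')
    (by rw [show aeval s' (Q i) = C (aeval s (Q i)) from
          (comp_aeval_apply (φ := Algebra.ofId K (MvPolynomial (Fin 4) K)) s (Q i)).symm,
          show aeval s (Q i) = 0 from congrFun hs i, map_zero]) α β γ
  rw [← hfexp] at hexp
  choose u₁ u₂ w₁ w₂ hexp using hexp
  have hC : ∀ (i : Fin 4) (x : Fin 3 → K), dirDeriv (Q i) s' (fun j => C (x j))
      = (C (dirVec Q s x i) : MvPolynomial (Fin 4) K) := fun i x =>
    (map_dirDeriv (Algebra.ofId K (MvPolynomial (Fin 4) K)) (Q i) s x).symm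
  let dot : (Fin 4 → K) → (Fin 4 → MvPolynomial (Fin 4) K) → MvPolynomial (Fin 4) K :=
    fun φ P => ∑ i, C (φ i) * P i
  have hdotC : ∀ φ x, dot φ (fun i => C (x i)) = C (φ ⬝ᵥ x) := by
    intro φ x
    simp [dot, dotProduct]
  let U := fun φ => α ^ 2 * C (φ ⬝ᵥ dirVec Q s t) + β * dot φ u₁ + γ * dot φ u₂
  let W := fun φ => α ^ 2 * C (φ ⬝ᵥ dirVec Q s w) + β * dot φ w₁ + γ * dot φ w₂
  have hdotQ : ∀ φ, dot φ (evalVec Q f) = β * U φ + γ * W φ := by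
    intro φ
    simp only [U, W, ← hdotC, dot, evalVec, hexp, t', w', hC, Finset.mul_sum,
      ← Finset.sum_add_distrib]
    exact Finset.sum_congr rfl fun i _ => by ring
  have hdiv : ∀ φ, F ∣ dot ψ X * dot φ (evalVec Q f) - dot φ X * dot ψ (evalVec Q f) := by
    intro φ
    have : dot ψ X * dot φ (evalVec Q f) - dot φ X * dot ψ (evalVec Q f)
        = ∑ i, ∑ j, C (φ i) * C (ψ j) * (aeval f (Q i) * X j - aeval f (Q j) * X i) := by
      simp only [dot, Fin.sum_univ_four]
      ring
    rw [this]
    exact Finset.dvd_sum fun i _ => Finset.dvd_sum fun j _ =>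
      dvd_mul_of_dvd_right (h.dvd_local hdom hfQ i j) _
  let M₁ := fun φ => dot ψ X * U φ - dot φ X * U ψ
  let M₂ := fun φ => dot ψ X * W φ - dot φ X * W ψ
  -- On the surface `Q ∘ f` is proportional to the point itself, which makes `β` and `γ` solve a
  -- homogeneous linear equation for each functional `φ`.
  have hM : ∀ φ, aeval Q β * aeval Q (M₁ φ) + aeval Q γ * aeval Q (M₂ φ) = 0 := by
    intro φ
    obtain ⟨q, hq⟩ := hdiv φ
    rw [← map_mul, ← map_mul, ← map_add]
    have : β * M₁ φ + γ * M₂ φ = F * q := by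
      rw [← hq, hdotQ, hdotQ]
      simp only [M₁, M₂]
      ring
    rw [this, map_mul, h.aeval_eq_zero, zero_mul]
  have hdotv : ∀ φ, aeval v (dot φ X) = φ ⬝ᵥ v := by
    intro φ
    simp [dot, dotProduct]
  have hUv : ∀ φ, aeval v (U φ) = aeval v α ^ 2 * (φ ⬝ᵥ dirVec Q s t) := by
    intro φ
    simp only [U, map_add, map_mul, map_pow, hβv, hγv, aeval_C, Algebra.algebraMap_self,
      RingHom.id_apply]
    ring
  have hWv : ∀ φ, aeval v (W φ) = aeval v α ^ 2 * (φ ⬝ᵥ dirVec Q s w) := by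
    intro φ
    simp only [W, map_add, map_mul, map_pow, hβv, hγv, aeval_C, Algebra.algebraMap_self,
      RingHom.id_apply]
    ring
  -- For functionals dual to `v` and the two directions, the determinant at `v` is `α(v) ^ 4`. So
  -- `β` and `γ` vanish on the surface, and `f` would be a multiple of the constant `s` there, which
  -- is incompatible with `f ∘ Q` being proportional to `X`.
  have hdet : aeval Q (M₁ ψ₁ * M₂ ψ₂ - M₂ ψ₁ * M₁ ψ₂) ≠ 0 := by
    intro h0
    obtain ⟨q, hq⟩ := hdom _ h0
    have h1 := congrArg (aeval v : _ →ₐ[K] K) hq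
    simp only [M₁, M₂, map_mul, map_sub, hdotv, hUv, hWv, hF, hψ, hψ1, hψ2, h11, h12, h21,
      h22] at h1
    have h2 : aeval v α ^ 4 = 0 := by linear_combination h1
    exact hαv (pow_eq_zero_iff (by norm_num) |>.1 h2)
  have hβ0 : aeval Q β = 0 := by
    refine (mul_eq_zero.1 ?_).resolve_right hdet
    simp only [map_sub, map_mul]
    linear_combination aeval Q (M₂ ψ₂) * hM ψ₁ - aeval Q (M₂ ψ₁) * hM ψ₂
  have hγ0 : aeval Q γ = 0 := by
    refine (mul_eq_zero.1 ?_).resolve_right hdet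
    simp only [map_sub, map_mul]
    linear_combination aeval Q (M₁ ψ₁) * hM ψ₂ - aeval Q (M₁ ψ₂) * hM ψ₁
  have hα0 : aeval Q α = 0 := by
    have hQf : ∀ j, aeval Q (f j) = aeval Q α * C (s j) := by
      intro j
      rw [hfexp]
      simp only [Pi.add_apply, Pi.smul_apply, smul_eq_mul, map_add, map_mul, hβ0, hγ0, zero_mul,
        add_zero, s', aeval_C, algebraMap_eq]
    by_contra hα0
    have hsX : Parallel (fun j => (C (s j) : MvPolynomial (Fin 3) K)) X := by
      refine Parallel.of_smul_left hα0 fun i j => ?_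
      have := hfQ i j
      simp only [hQf] at this
      exact this
    refine hst fun i j => ?_
    have := congrArg (aeval t : _ →ₐ[K] K) (hsX i j)
    simpa using this
  obtain ⟨q, hq⟩ := hdom _ hα0
  exact hαv (by rw [hq, map_mul, hF, zero_mul])

end InverseData

/-! ### Plane models, strict transforms of lines, reducedness of sections. -/

/-- The inverse of a birational morphism from a smooth cubic surface to the plane, given by cubic
forms `Q` that parametrize a dense subset of the surface. -/
structure PlaneModel {K : Type*} [Field K] (F : MvPolynomial (Fin 4) K)
    (Q : Fin 4 → MvPolynomial (Fin 3) K) (π : (Fin 4 → K) → (Fin 3 → K)) : Prop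
    extends InverseData F Q π 3 where
  dominant : ∀ G, aeval Q G = 0 → F ∣ G

section linearAlgebra

variable {K : Type*} [Field K]

theorem mem_span_of_dotProduct_eq_zero {H a b c x : Fin 4 → K} (hH : H ≠ 0)
    (hli : LinearIndependent K ![a, b, c]) (ha : H ⬝ᵥ a = 0) (hb : H ⬝ᵥ b = 0) (hc : H ⬝ᵥ c = 0)
    (hx : H ⬝ᵥ x = 0) : ∃ α β γ : K, x = α • a + β • b + γ • c := by
  have hpar := crossProduct₄_parallel a b c ha hb hc
  obtain ⟨k, hk⟩ := hpar.exists_smul hH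
  have hdet : (Matrix.of ![x, a, b, c]).det = 0 := by
    rw [crossProduct₄_eq_det, hk]
    have : ∑ i, x i * (k • H) i = k * (H ⬝ᵥ x) := by
      simp only [dotProduct, Finset.mul_sum, Pi.smul_apply, smul_eq_mul]
      exact Finset.sum_congr rfl fun i _ => by ring
    rw [this, hx, mul_zero]
  have hmem : x ∈ Submodule.span K (Set.range ![a, b, c]) := by
    by_contra hmem
    have h4 : LinearIndependent K ![x, a, b, c] := linearIndependent_finCons.2 ⟨hli, hmem⟩
    have := (Matrix.linearIndependent_rows_iff_isUnit (A := Matrix.of ![x, a, b, c])).1 h4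
    exact ((Matrix.isUnit_iff_isUnit_det _).1 this).ne_zero hdet
  rw [Submodule.mem_span_range_iff_exists_fun] at hmem
  obtain ⟨g, hg⟩ := hmem
  refine ⟨g 0, g 1, g 2, ?_⟩
  rw [← hg, Fin.sum_univ_three]
  rfl

theorem crossProduct₄_ne_zero_of_linearIndependent {a b c : Fin 4 → K}
    (hli : LinearIndependent K ![a, b, c]) : crossProduct₄ a b c ≠ 0 := fun h =>
  not_linearIndependent_of_crossProduct₄_eq_zero h hli

theorem parallel_of_dotProduct_eq_zero {H H' a b c : Fin 4 → K}
    (hli : LinearIndependent K ![a, b, c]) (ha : H ⬝ᵥ a = 0) (hb : H ⬝ᵥ b = 0) (hc : H ⬝ᵥ c = 0)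
    (ha' : H' ⬝ᵥ a = 0) (hb' : H' ⬝ᵥ b = 0) (hc' : H' ⬝ᵥ c = 0) : Parallel H H' :=
  (crossProduct₄_parallel a b c ha hb hc).symm.trans
    (crossProduct₄_ne_zero_of_linearIndependent hli) (crossProduct₄_parallel a b c ha' hb' hc')

theorem exists_eq_smul_add_smul_of_not_parallel {s t x : Fin 3 → K} (h : ¬ Parallel s t)
    (hdet : det₃ s t x = 0) : ∃ a b : K, x = a • s + b • t := by
  by_contra! hx
  exact det₃_ne_zero_of_not_mem h hx hdet

end linearAlgebra

/-- Removing the common factor of a family of univariate polynomials. -/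
theorem Polynomial.exists_eq_mul_forall_ne_zero {k ι : Type*} (K : Type*) [Field k] [Field K]
    [Algebra k K] [Algebra.IsAlgebraic k K] [Fintype ι]
    (A : ι → Polynomial k) (hA : A ≠ 0) : ∃ (l : Polynomial k) (R : ι → Polynomial k),
    (∀ i, A i = l * R i) ∧ l ≠ 0 ∧ ∀ a : K, (fun i => Polynomial.aeval a (R i)) ≠ 0 := by
  classical
  let _ : NormalizedGCDMonoid (Polynomial k) := Classical.choice inferInstance
  obtain ⟨i₀, hi₀⟩ := Function.ne_iff.1 hA
  obtain ⟨R, hR, hg⟩ := Finset.extract_gcd A (s := Finset.univ) ⟨i₀, Finset.mem_univ _⟩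
  refine ⟨_, R, fun i => hR i (Finset.mem_univ _), fun h0 => hi₀ ?_, fun a ha => ?_⟩
  · rw [hR i₀ (Finset.mem_univ _), h0, zero_mul, Pi.zero_apply]
  -- A common zero in the extension is already visible over `k`, through its minimal polynomial.
  · have hdvd : minpoly k a ∣ Finset.univ.gcd R :=
      Finset.dvd_gcd fun i _ => minpoly.dvd k a (congrFun ha i)
    rw [hg] at hdvd
    exact minpoly.not_isUnit k a (isUnit_of_dvd_one hdvd)

/-- The leading coefficient of a quadratic form, the gradient of a cubic form, in polynomials. -/
theorem coeff_aeval_pderiv {K σ : Type*} [CommRing K] {G : MvPolynomial σ K}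
    (hG : G.IsHomogeneous 3) {R : σ → Polynomial K} {n : ℕ} (hR : ∀ i, (R i).natDegree ≤ n)
    (k : σ) : (aeval R (pderiv k G)).coeff (n + n) = aeval (fun i => (R i).coeff n) (pderiv k G) := by
  classical
  refine induction_cubic (motive := fun G => (aeval R (pderiv k G)).coeff (n + n)
    = aeval (fun i => (R i).coeff n) (pderiv k G)) hG (by simp) (fun p q hp hq => ?_)
    (fun c i j l => ?_)
  · simp only [map_add, Polynomial.coeff_add, hp, hq]
  · have key : ∀ i j, (R i * R j).coeff (n + n) = (R i).coeff n * (R j).coeff n := fun i j =>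
      Polynomial.coeff_mul_add_eq_of_natDegree_le (hR i) (hR j)
    have hx : pderiv k (C c * (X i * X j * X l)) = C (if i = k then c else 0) * (X j * X l)
        + C (if j = k then c else 0) * (X i * X l)
        + C (if l = k then c else 0) * (X i * X j) := by
      simp only [Derivation.leibniz, pderiv_C, pderiv_X, smul_eq_mul, Pi.single_apply]
      split_ifs <;> simp <;> ring
    rw [hx]
    simp only [map_add, map_mul, aeval_C, aeval_X, Polynomial.algebraMap_eq, Polynomial.coeff_add,
      Polynomial.coeff_C_mul, key, Algebra.algebraMap_self, RingHom.id_apply]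

/-- The restriction of a family of cubic forms to the line through `u` and `w`, up to a common
factor. -/
theorem exists_line_of_isHomogeneous {k : Type*} (K : Type*) [Field k] [Field K]
    [Algebra k K] [Algebra.IsAlgebraic k K] {Q : Fin 4 → MvPolynomial (Fin 3) k}
    (hQ : ∀ i, (Q i).IsHomogeneous 3) (u : Fin 3 → k) {w : Fin 3 → k}
    (hw : evalVec Q w ≠ 0) : ∃ (n : ℕ) (c : k) (l : Polynomial k) (R : Fin 4 → Polynomial k),
    (∀ i, aeval (lineParam u w) (Q i) = l * R i) ∧ l ≠ 0 ∧ l.natDegree + n = 3 ∧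
    (∀ a : K, (fun i => Polynomial.aeval a (R i)) ≠ 0) ∧ (∀ i, (R i).natDegree ≤ n) ∧ c ≠ 0 ∧
    ∀ i, evalVec Q w i = c * (R i).coeff n := by
  have hdeg : ∀ i, (aeval (lineParam u w) (Q i)).natDegree ≤ 3 := by
    intro i
    rw [aeval_lineParam (hQ i)]
    compute_degree
  have hco : ∀ i, (aeval (lineParam u w) (Q i)).coeff 3 = evalVec Q w i := by
    intro i
    rw [aeval_lineParam (hQ i)]
    simp [evalVec]
  obtain ⟨i₀, hi₀⟩ := Function.ne_iff.1 hw
  have hA : (fun i => aeval (lineParam u w) (Q i)) ≠ 0 := by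
    intro h0
    exact hi₀ (by rw [← hco, congrFun h0 i₀]; rfl)
  obtain ⟨l, R, hR, hl, hne⟩ := Polynomial.exists_eq_mul_forall_ne_zero K _ hA
  have hle : l.natDegree ≤ 3 := by
    have h0 : l * R i₀ ≠ 0 := by
      rw [← hR]
      intro h0
      exact hi₀ (by rw [← hco, h0]; rfl)
    have := hdeg i₀
    rw [hR, Polynomial.natDegree_mul hl (right_ne_zero_of_mul h0)] at this
    omega
  have hRdeg : ∀ i, (R i).natDegree ≤ 3 - l.natDegree := by
    intro i
    by_cases h0 : R i = 0
    · rw [h0]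
      simp
    · have := hdeg i
      rw [hR, Polynomial.natDegree_mul hl h0] at this
      omega
  -- The point `w` is the one at infinity of the parametrization, so `Q(w)` is the coefficient of
  -- degree three: the leading coefficient of `l` times the `n`-th coefficient of `R`.
  refine ⟨3 - l.natDegree, l.leadingCoeff, l, R, hR, hl, by omega, hne, hRdeg,
    Polynomial.leadingCoeff_ne_zero.2 hl, fun i => ?_⟩
  rw [← hco, hR, Polynomial.leadingCoeff, ← Polynomial.coeff_mul_add_eq_of_natDegree_le le_rfl
    (hRdeg i)]
  congr 1
  omega

namespace InverseData

variable {K : Type*} [Field K] {F : MvPolynomial (Fin 4) K}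
  {Q : Fin 4 → MvPolynomial (Fin 3) K} {π : (Fin 4 → K) → (Fin 3 → K)}

/-- The exceptional lines above different base points are disjoint. -/
theorem parallel_of_dirVec_eq_dirVec (h : InverseData F Q π 3) {s s' t t' : Fin 3 → K}
    (hs : evalVec Q s = 0) (hs' : evalVec Q s' = 0) (heq : dirVec Q s t = dirVec Q s' t')
    (hne : dirVec Q s t ≠ 0) : Parallel s s' := by
  have h1 := h.parallel_apply_dirVec hs hne
  have h2 := h.parallel_apply_dirVec hs' (heq ▸ hne)
  rw [← heq] at h2
  exact h1.symm.trans (h.ne_zero _ hne (h.dirVec_mem hs t)) h2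

theorem evalVec_eq_zero_of_parallel (h : InverseData F Q π 3) {s y : Fin 3 → K} (hs0 : s ≠ 0)
    (hs : evalVec Q s = 0) (hp : Parallel y s) : evalVec Q y = 0 := by
  obtain ⟨c, rfl⟩ := hp.exists_smul hs0
  funext i
  rw [evalVec, aeval_smul_of_isHomogeneous (h.homogeneous i), show aeval s (Q i) = 0 from
    congrFun hs i, mul_zero]
  rfl

/-- The morphism sends the point above `y` to `y` and the exceptional line to `s`; equality would
make `y` a base point. -/
theorem evalVec_ne_dirVec (h : InverseData F Q π 3) {s y : Fin 3 → K} (hs0 : s ≠ 0)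
    (hs : evalVec Q s = 0) (hy : evalVec Q y ≠ 0) (t : Fin 3 → K) : evalVec Q y ≠ dirVec Q s t := by
  intro heq
  have h1 := h.parallel_apply_evalVec hy
  have h2 := h.parallel_apply_dirVec hs (heq ▸ hy)
  rw [← heq] at h2
  exact hy (h.evalVec_eq_zero_of_parallel hs0 hs
    (h1.symm.trans (h.ne_zero _ hy (h.evalVec_mem y)) h2))

/-- The strict transform of the line through `u` and `w`. -/
theorem exists_line (h : InverseData F Q π 3) (u : Fin 3 → K) {w : Fin 3 → K}
    (hw : evalVec Q w ≠ 0) : ∃ (n : ℕ) (c : K) (l : Polynomial K) (R : Fin 4 → Polynomial K),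
    (∀ i, aeval (lineParam u w) (Q i) = l * R i) ∧ l ≠ 0 ∧ l.natDegree + n = 3 ∧
    (∀ a : K, (fun i => (R i).eval a) ≠ 0) ∧ (∀ i, (R i).natDegree ≤ n) ∧ c ≠ 0 ∧
    ∀ i, evalVec Q w i = c * (R i).coeff n := by
  simpa only [Polynomial.coe_aeval_eq_eval] using exists_line_of_isHomogeneous K h.homogeneous u hw

/-- A strict transform reduced to one point would be mapped by `π` to `u` and to `u + w` at once. -/
theorem parallel_of_line_degree_eq_zero (h : InverseData F Q π 3) {u w : Fin 3 → K}
    {l : Polynomial K} {R : Fin 4 → Polynomial K}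
    (hR : ∀ i, aeval (lineParam u w) (Q i) = l * R i) (hl : l ≠ 0)
    (hne : ∀ a : K, (fun i => (R i).eval a) ≠ 0) (hdeg : ∀ i, (R i).natDegree ≤ 0) :
    Parallel u w := by
  have hconst : ∀ a : K, (fun i => (R i).eval a) = fun i => (R i).eval 0 := by
    intro a
    funext i
    rw [Polynomial.eq_C_of_natDegree_le_zero (hdeg i), Polynomial.eval_C, Polynomial.eval_C]
  have h0 := h.parallel_arc hR hl (hne 0)
  have h1 := h.parallel_arc hR hl (hne 1)
  rw [hconst 1] at h1
  rw [eval_lineParam] at h0 h1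
  have := h0.symm.trans (h.ne_zero _ (hne 0) (h.eval_factor_eq_zero hR hl 0)) h1
  intro i j
  have hij := this i j
  simp at hij
  linear_combination hij

variable [IsAlgClosed K]

theorem exists_basis (h : InverseData F Q π 3) {s : Fin 3 → K} (hs0 : s ≠ 0)
    (hs : evalVec Q s = 0) : ∃ t w : Fin 3 → K, det₃ s t w ≠ 0 ∧
      (∀ b c : K, b • dirVec Q s t + c • dirVec Q s w = dirVec Q s (b • t + c • w)) ∧
      ∀ v, (∀ x, v ≠ dirVec Q s x) → LinearIndependent K ![v, dirVec Q s t, dirVec Q s w] := by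
  obtain ⟨t, hst⟩ := exists_not_parallel hs0
  obtain ⟨w, hw⟩ := exists_det₃_ne_zero hst
  exact ⟨t, w, hw, fun b c => by rw [dirVec_add, dirVec_smul, dirVec_smul],
    fun v hv => h.linearIndependent_of_ne_dirVec hs0 hs hw hv⟩

/-- A plane is determined by an exceptional line and one further point. -/
theorem parallel_of_contains_line (h : InverseData F Q π 3) {s : Fin 3 → K} (hs0 : s ≠ 0)
    (hs : evalVec Q s = 0) {v H H' : Fin 4 → K} (hv : ∀ t, v ≠ dirVec Q s t)
    (hHs : ∀ t, H ⬝ᵥ dirVec Q s t = 0) (hHv : H ⬝ᵥ v = 0)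
    (hHs' : ∀ t, H' ⬝ᵥ dirVec Q s t = 0) (hHv' : H' ⬝ᵥ v = 0) : Parallel H H' := by
  obtain ⟨t, w, -, -, hli⟩ := h.exists_basis hs0 hs
  exact parallel_of_dotProduct_eq_zero (hli v hv) hHv (hHs _) (hHs _) hHv' (hHs' _) (hHs' _)

/-- Two exceptional lines in a plane coincide. -/
theorem parallel_of_contains_lines (h : InverseData F Q π 3) {s s' : Fin 3 → K} (hs0 : s ≠ 0)
    (hs : evalVec Q s = 0) (hs0' : s' ≠ 0) (hs' : evalVec Q s' = 0) {H : Fin 4 → K} (hH : H ≠ 0)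
    (hHs : ∀ t, H ⬝ᵥ dirVec Q s t = 0) (hHs' : ∀ t, H ⬝ᵥ dirVec Q s' t = 0) : Parallel s s' := by
  obtain ⟨t, w, hdet, hlin, hli⟩ := h.exists_basis hs0 hs
  obtain ⟨t', ht'⟩ := h.exists_dirVec_ne_zero hs0' hs'
  by_cases hmem : ∃ x, dirVec Q s' t' = dirVec Q s x
  · obtain ⟨x, hx⟩ := hmem
    exact h.parallel_of_dirVec_eq_dirVec hs hs' hx.symm (hx ▸ ht')
  push Not at hmem
  have hst' : ¬ Parallel s' t' := fun hp => ht' (by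
    obtain ⟨c, rfl⟩ := hp.symm.exists_smul hs0'
    rw [dirVec_smul, h.dirVec_self hs', smul_zero])
  obtain ⟨w', hw'⟩ := exists_det₃_ne_zero hst'
  -- Two lines in a plane meet: a suitable combination of two points of the second line lies on the
  -- first.
  obtain ⟨α, β, γ, hx⟩ := mem_span_of_dotProduct_eq_zero hH (hli _ hmem) (hHs' _) (hHs _) (hHs _)
    (hHs' w')
  rw [add_assoc, hlin] at hx
  have hne : dirVec Q s' (w' - α • t') ≠ 0 := by
    intro h0
    obtain ⟨a, ha⟩ := (h.parallel_of_dirVec_eq_zero hs0' hs' h0).symm.exists_smul hs0'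
    apply hw'
    rw [sub_eq_iff_eq_add.1 ha]
    simp only [det₃, Pi.add_apply, Pi.smul_apply, smul_eq_mul]
    ring
  have heq : dirVec Q s' (w' - α • t') = dirVec Q s (β • t + γ • w) := by
    rw [sub_eq_add_neg, ← neg_smul, dirVec_add, dirVec_smul, hx, neg_smul]
    abel
  exact (h.parallel_of_dirVec_eq_dirVec hs' hs heq hne).symm

end InverseData

theorem eval_sum_C_mul {K ι : Type*} [CommRing K] [Fintype ι] (ψ : ι → K) (R : ι → Polynomial K)
    (a : K) : (∑ i, Polynomial.C (ψ i) * R i).eval a = ψ ⬝ᵥ fun i => (R i).eval a := by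
  simp [Polynomial.eval_finsetSum, dotProduct]

theorem derivative_sum_C_mul {K ι : Type*} [CommRing K] [Fintype ι] (ψ : ι → K)
    (R : ι → Polynomial K) : Polynomial.derivative (∑ i, Polynomial.C (ψ i) * R i)
      = ∑ i, Polynomial.C (ψ i) * Polynomial.derivative (R i) := by
  simp

theorem MvPolynomial.IsHomogeneous.prime_of_one {K σ : Type*} [Field K]
    {a : MvPolynomial σ K} (ha : a.IsHomogeneous 1) (h0 : a ≠ 0) : Prime a := by
  refine (irreducible_of_totalDegree_eq_one (ha.totalDegree h0) fun x hx => ?_).prime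
  obtain ⟨d, hd⟩ := ne_zero_iff.1 h0
  exact isUnit_iff_ne_zero.2 fun hx0 => hd (zero_dvd_iff.1 (hx0 ▸ hx d))

theorem MvPolynomial.IsHomogeneous.exists_eq_sum {K σ : Type*} [Fintype σ] [CommRing K]
    {a : MvPolynomial σ K} (ha : a.IsHomogeneous 1) : ∃ A : σ → K, a = ∑ i, C (A i) * X i := by
  have h1 := ha.sum_X_mul_pderiv
  rw [one_smul] at h1
  have h2 : ∀ i, ∃ c, pderiv i a = C c := fun i =>
    ⟨_, totalDegree_eq_zero_iff_eq_C.1 ((totalDegree_zero_iff_isHomogeneous _).2 ha.pderiv)⟩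
  choose A hA using h2
  exact ⟨A, by rw [← h1]; exact Finset.sum_congr rfl fun i _ => by rw [hA, mul_comm]⟩

theorem aeval_sum_C_mul_X {K A σ : Type*} [Fintype σ] [CommRing K] [CommRing A] [Algebra K A]
    (a : σ → K) (y : σ → A) : aeval y (∑ i, C (a i) * X i) = (algebraMap K A ∘ a) ⬝ᵥ y := by
  simp [dotProduct]

theorem exists_dotProduct_eq_zero_not_parallel {K : Type*} [Field K] (A : Fin 3 → K)
    {w : Fin 3 → K} (hw : w ≠ 0) : ∃ u, A ⬝ᵥ u = 0 ∧ ¬ Parallel u w := by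
  obtain ⟨t, hwt⟩ := exists_not_parallel hw
  by_cases ht : A ⬝ᵥ t = 0
  · exact ⟨t, ht, fun h => hwt h.symm⟩
  obtain ⟨x, hx⟩ := exists_det₃_ne_zero hwt
  refine ⟨(A ⬝ᵥ x) • t - (A ⬝ᵥ t) • x, ?_, fun h => ?_⟩
  · rw [dotProduct_sub, dotProduct_smul, dotProduct_smul, smul_eq_mul, smul_eq_mul, mul_comm,
      sub_self]
  · obtain ⟨c, hc⟩ := h.exists_smul hw
    refine mul_ne_zero ht hx ?_
    have h1 : det₃ w t (c • w) = -(A ⬝ᵥ t * det₃ w t x) := by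
      rw [← hc]
      simp only [det₃, Pi.sub_apply, Pi.smul_apply, smul_eq_mul]
      ring
    have h2 : det₃ w t (c • w) = 0 := by
      simp only [det₃, Pi.smul_apply, smul_eq_mul]
      ring
    rw [h2] at h1
    exact neg_eq_zero.1 h1.symm

namespace InverseData

variable {K : Type*} [Field K] {F : MvPolynomial (Fin 4) K}
  {Q : Fin 4 → MvPolynomial (Fin 3) K} {π : (Fin 4 → K) → (Fin 3 → K)} [IsAlgClosed K]

omit [IsAlgClosed K] in
/-- The strict transform of a line crosses the exceptional lines transversally. -/
theorem not_derivative_mem_line [Infinite K] (h : InverseData F Q π 3) {u w s t t' : Fin 3 → K}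
    (huw : ¬ Parallel u w) (hs0 : s ≠ 0) (hs : evalVec Q s = 0) {l : Polynomial K}
    {R : Fin 4 → Polynomial K} (hR : ∀ i, aeval (lineParam u w) (Q i) = l * R i) (hl : l ≠ 0)
    {a : K} (hRa : (fun i => (R i).eval a) ≠ 0) (ha : Parallel (u + a • w) s)
    (ht : (fun i => (R i).eval a) = dirVec Q s t)
    (ht' : (fun i => (Polynomial.derivative (R i)).eval a) = dirVec Q s t') : False := by
  obtain ⟨d, f, hf, hf0, hfQ, -⟩ := h.exists_local _ hRa (h.eval_factor_eq_zero hR hl a)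
  have hua : u + a • w ≠ 0 := by
    intro h0
    apply huw
    rw [eq_neg_of_add_eq_zero_left h0]
    intro i j
    simp
    ring
  -- the local expression is constant along the exceptional line
  have hconst : Parallel (fun j => dirDeriv (f j) (dirVec Q s t) (dirVec Q s t')) s := by
    intro i j
    have hpoly : aeval (lineParam (dirVec Q s t) (dirVec Q s t')) (f i) * Polynomial.C (s j)
        = aeval (lineParam (dirVec Q s t) (dirVec Q s t')) (f j) * Polynomial.C (s i) := by
      refine Polynomial.funext fun b => ?_
      simp only [Polynomial.eval_mul, Polynomial.eval_C, eval_aeval, eval_lineParam]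
      rw [← dirVec_smul, ← dirVec_add]
      exact h.parallel_local_dirVec hf hfQ hs _ i j
    have := congrArg (fun p => (Polynomial.derivative p).eval 0) hpoly
    simp only [Polynomial.derivative_mul, Polynomial.derivative_C, mul_zero, add_zero,
      Polynomial.eval_mul, Polynomial.eval_C, derivative_aeval, derivative_lineParam, eval_dirDeriv,
      eval_lineParam, zero_smul] at this
    exact this
  have hpar := parallel_local_arc hf hfQ hR hl
  have hval : Parallel (fun j => aeval (fun i => (R i).eval a) (f j)) (u + a • w) := by
    intro i j
    have := congrArg (Polynomial.eval a) (hpar i j)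
    simp only [Polynomial.eval_mul, eval_aeval] at this
    simpa [← congrFun (eval_lineParam u w a)] using this
  -- In the differentiated relation the variation of `f` is proportional to `s`, hence to `u + a •
  -- w`, and drops out. So `f` would be proportional to `w` as well as to `u + a • w`.
  have hder : Parallel (fun j => aeval (fun i => (R i).eval a) (f j)) w := by
    intro i j
    have h1 := congrArg (fun p => (Polynomial.derivative p).eval a) (hpar i j)
    simp only [Polynomial.derivative_mul, Polynomial.eval_add, Polynomial.eval_mul,
      derivative_aeval, eval_dirDeriv, eval_aeval, congrFun (derivative_lineParam u w),
      Polynomial.eval_C, congrFun (eval_lineParam u w a)] at h1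
    have h2 := (hconst.trans hs0 ha.symm) i j
    rw [ht, ht'] at h1
    rw [ht]
    linear_combination h1 - h2
  exact huw fun i j => by
    have := (hval.symm.trans hf0 hder) i j
    simp only [Pi.add_apply, Pi.smul_apply, smul_eq_mul] at this
    linear_combination this

/-- If a plane contains the strict transform of a line and an exceptional line, then the strict
transform is itself a line and meets the exceptional line. -/
theorem line_degree_eq_one (h : InverseData F Q π 3) {u w s : Fin 3 → K} {H : Fin 4 → K}
    (huw : ¬ Parallel u w) (hs0 : s ≠ 0) (hs : evalVec Q s = 0) (hw : evalVec Q w ≠ 0)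
    (hH : H ≠ 0) (hHs : ∀ t, H ⬝ᵥ dirVec Q s t = 0) {n : ℕ} {c : K} {l : Polynomial K}
    {R : Fin 4 → Polynomial K} (hR : ∀ i, aeval (lineParam u w) (Q i) = l * R i) (hl : l ≠ 0)
    (hne : ∀ a : K, (fun i => (R i).eval a) ≠ 0) (hdeg : ∀ i, (R i).natDegree ≤ n) (hc : c ≠ 0)
    (hlead : ∀ i, evalVec Q w i = c * (R i).coeff n)
    (hHR : ∀ a : K, H ⬝ᵥ (fun i => (R i).eval a) = 0) :
    n = 1 ∧ ∃ a : K, Parallel (u + a • w) s := by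
  have hinf : Infinite K := IsAlgClosed.instInfinite
  have hHR' : ∑ i, Polynomial.C (H i) * R i = 0 :=
    Polynomial.funext fun a => by rw [eval_sum_C_mul, hHR, Polynomial.eval_zero]
  have hHder : ∀ a : K, H ⬝ᵥ (fun i => (Polynomial.derivative (R i)).eval a) = 0 := fun a => by
    rw [← eval_sum_C_mul, ← derivative_sum_C_mul, hHR']
    simp
  have hQw : evalVec Q w = c • fun i => (R i).coeff n := funext hlead
  have hHw : H ⬝ᵥ evalVec Q w = 0 := by
    have h1 : H ⬝ᵥ (fun i => (R i).coeff n) = (∑ i, Polynomial.C (H i) * R i).coeff n := by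
      simp [dotProduct]
    rw [hQw, dotProduct_smul, h1, hHR', Polynomial.coeff_zero, smul_zero]
  obtain ⟨t₁, t₂, -, hlin, hli⟩ := h.exists_basis hs0 hs
  replace hli := hli _ (h.evalVec_ne_dirVec hs0 hs hw)
  -- Within the plane `H`, the functional `ψ` cuts out the exceptional line, and `ψ(Q(w)) = 1`. The
  -- roots of `ψ` along `R` are the points where the strict transform meets that line, and the
  -- normalization makes this polynomial have degree exactly `n`.
  obtain ⟨ψ, -, -, hψ, hψ1, hψ2, -⟩ := exists_functionals hli
  have hker : ∀ x, H ⬝ᵥ x = 0 → ψ ⬝ᵥ x = 0 → ∃ t, x = dirVec Q s t := by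
    intro x hHx hψx
    obtain ⟨α, β, γ, rfl⟩ := mem_span_of_dotProduct_eq_zero hH hli hHw (hHs _) (hHs _) hHx
    simp only [dotProduct_add, dotProduct_smul, hψ, hψ1, hψ2, smul_eq_mul, mul_zero, add_zero,
      mul_one] at hψx
    exact ⟨β • t₁ + γ • t₂, by rw [hψx, zero_smul, zero_add, hlin]⟩
  obtain ⟨p, hp⟩ : ∃ p, p = ∑ i, Polynomial.C (ψ i) * R i := ⟨_, rfl⟩
  have hpa : ∀ a, p.eval a = ψ ⬝ᵥ fun i => (R i).eval a := fun a => by rw [hp, eval_sum_C_mul]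
  have hpn : p.coeff n = c⁻¹ := by
    refine eq_inv_of_mul_eq_one_right ?_
    rw [← hψ, hQw, dotProduct_smul, smul_eq_mul]
    simp [hp, dotProduct]
  have hp0 : p ≠ 0 := fun h0 => inv_ne_zero hc (by rw [← hpn, h0, Polynomial.coeff_zero])
  have hple : p.natDegree ≤ n := by
    rw [hp]
    exact Polynomial.natDegree_sum_le_of_forall_le _ _ fun i _ =>
      (Polynomial.natDegree_C_mul_le _ _).trans (hdeg i)
  have hpdeg : p.natDegree = n := le_antisymm hple
    (Polynomial.le_natDegree_of_ne_zero (by rw [hpn]; exact inv_ne_zero hc))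
  have hroot : ∀ a, p.eval a = 0 → (∃ t, (fun i => (R i).eval a) = dirVec Q s t) ∧
      Parallel (u + a • w) s := by
    intro a ha
    obtain ⟨t, ht⟩ := hker _ (hHR a) (by rw [← hpa, ha])
    refine ⟨⟨t, ht⟩, ?_⟩
    have h1 := h.parallel_arc hR hl (hne a)
    rw [eval_lineParam] at h1
    have h2 := h.parallel_apply_dirVec hs (ht ▸ hne a)
    rw [← ht] at h2
    exact h1.symm.trans (h.ne_zero _ (hne a) (h.eval_factor_eq_zero hR hl a)) h2
  have hn : n ≠ 0 := by
    rintro rfl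
    exact huw (h.parallel_of_line_degree_eq_zero hR hl hne hdeg)
  obtain ⟨a, ha⟩ := IsAlgClosed.exists_root p
    (by rw [Polynomial.degree_eq_natDegree hp0, hpdeg]; exact_mod_cast hn)
  obtain ⟨⟨t, ht⟩, has⟩ := hroot a ha
  refine ⟨?_, a, has⟩
  obtain ⟨q, hq⟩ := Polynomial.dvd_iff_isRoot.2 ha
  -- The root is simple by transversality, and another root would be a second point of the line of
  -- the plane lying over `s`. So the degree is one.
  have hqa : q.eval a ≠ 0 := by
    intro hqa
    have hd : (Polynomial.derivative p).eval a = 0 := by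
      rw [hq, Polynomial.derivative_mul]
      simp [hqa]
    rw [hp, derivative_sum_C_mul, eval_sum_C_mul] at hd
    obtain ⟨t', ht'⟩ := hker _ (hHder a) hd
    exact h.not_derivative_mem_line huw hs0 hs hR hl (hne a) has ht ht'
  have hqroot : ∀ b, q.eval b ≠ 0 := by
    intro b hb
    obtain ⟨-, hbs⟩ := hroot b (by rw [hq, Polynomial.eval_mul, hb, mul_zero])
    have hab := has.trans hs0 hbs.symm
    have hne' : a ≠ b := fun hab => hqa (hab ▸ hb)
    refine huw fun i j => mul_left_cancel₀ (sub_ne_zero.2 hne'.symm) ?_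
    have := hab i j
    simp only [Pi.add_apply, Pi.smul_apply, smul_eq_mul] at this
    linear_combination this
  have hqdeg : q.degree = 0 := by
    by_contra hd
    obtain ⟨b, hb⟩ := IsAlgClosed.exists_root q hd
    exact hqroot b hb
  have hq0 : q ≠ 0 := fun h0 => hp0 (by rw [hq, h0, mul_zero])
  rw [← hpdeg, hq, Polynomial.natDegree_mul (Polynomial.X_sub_C_ne_zero a) hq0,
    Polynomial.natDegree_X_sub_C, Polynomial.natDegree_eq_zero_iff_degree_le_zero.2 hqdeg.le]

/-- The gradient of the surface at a point of the parametrization, from the tangent directions. -/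
theorem parallel_gradient (h : InverseData F Q π 3) {y : Fin 3 → K} (hQ : evalVec Q y ≠ 0)
    {H : Fin 4 → K} (hHy : H ⬝ᵥ evalVec Q y = 0) (hHt : ∀ t, H ⬝ᵥ dirVec Q y t = 0) :
    Parallel (fun i => aeval (evalVec Q y) (pderiv i F)) H := by
  have hy : y ≠ 0 := by
    rintro rfl
    apply hQ
    funext i
    have := aeval_smul_of_isHomogeneous (h.homogeneous i) (0 : K) (0 : Fin 3 → K)
    rw [zero_smul, zero_pow (by norm_num), zero_mul] at this
    exact this
  obtain ⟨t, hyt⟩ := exists_not_parallel hy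
  obtain ⟨w, hw⟩ := exists_det₃_ne_zero hyt
  obtain ⟨m, hm, hmQ⟩ := h.exists_crossProduct₄_dirVec_eq
  have h1 := crossProduct₄_parallel (evalVec Q y) (dirVec Q y t) (dirVec Q y w) hHy (hHt t) (hHt w)
  have h2 : crossProduct₄ (evalVec Q y) (dirVec Q y t) (dirVec Q y w)
      = (m * det₃ y t w) • fun i => aeval (evalVec Q y) (pderiv i F) := funext fun i => hmQ y t w i
  rw [h2] at h1
  exact h1.of_smul_left (mul_ne_zero hm hw)

/-- The image of a plane section has no multiple components. -/
theorem not_sq_dvd (h : InverseData F Q π 3) {H : Fin 4 → K} (hH : H ≠ 0)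
    {a : MvPolynomial (Fin 3) K} (ha : a.IsHomogeneous 1) (ha0 : a ≠ 0) :
    ¬ a * a ∣ ∑ i, C (H i) * Q i := by
  intro hdvd
  have hinf : Infinite K := IsAlgClosed.instInfinite
  obtain ⟨q, hq⟩ := hdvd
  obtain ⟨w, haw, hw⟩ := h.not_forall_aeval_eq_zero (ha.prime_of_one ha0)
  have hw0 : w ≠ 0 := by
    rintro rfl
    apply hw
    funext i
    have := aeval_smul_of_isHomogeneous (h.homogeneous i) (0 : K) (0 : Fin 3 → K)
    rw [zero_smul, zero_pow (by norm_num), zero_mul] at this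
    exact this
  obtain ⟨A, rfl⟩ := ha.exists_eq_sum
  simp only [aeval_sum_C_mul_X] at haw
  obtain ⟨u, hau, huw⟩ := exists_dotProduct_eq_zero_not_parallel A hw0
  have hay : ∀ b : K, aeval (u + b • w) (∑ i, C (A i) * X i) = 0 := by
    intro b
    rw [aeval_sum_C_mul_X, dotProduct_add, dotProduct_smul, haw, smul_zero, add_zero]
    exact hau
  have hHy : ∀ b : K, H ⬝ᵥ evalVec Q (u + b • w) = 0 := by
    intro b
    have := congrArg (aeval (u + b • w) : _ →ₐ[K] K) hq
    simp only [map_sum, map_mul, hay, zero_mul, aeval_C, Algebra.algebraMap_self,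
      RingHom.id_apply] at this
    exact this
  have hHt : ∀ (b : K) (t : Fin 3 → K), H ⬝ᵥ dirVec Q (u + b • w) t = 0 := by
    intro b t
    have := congrArg (fun p => dirDeriv p (u + b • w) t) hq
    simp only [dirDeriv_sum, dirDeriv_poly_mul, dirDeriv_C, map_mul, hay, aeval_C,
      Algebra.algebraMap_self, RingHom.id_apply, mul_zero, zero_mul, add_zero] at this
    exact this
  obtain ⟨n, c, l, R, hR, hl, -, hne, hdeg, hc, hlead⟩ := h.exists_line u hw
  have hn : n ≠ 0 := by
    rintro rfl
    exact huw (h.parallel_of_line_degree_eq_zero hR hl hne hdeg)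
  -- A double component makes `H` the tangent plane along the whole strict transform, so the
  -- gradient has the constant direction `H` there.
  have hgrad : ∀ i j, aeval R (pderiv i F) * Polynomial.C (H j)
      = aeval R (pderiv j F) * Polynomial.C (H i) := by
    intro i j
    refine mul_left_cancel₀ (pow_ne_zero 2 hl) (Polynomial.funext fun b => ?_)
    have h2 : ∀ i, (l ^ 2 * (aeval R (pderiv i F))).eval b
        = aeval (evalVec Q (u + b • w)) (pderiv i F) := by
      intro i
      have h3 := aeval_smul_of_isHomogeneous (h.cubic.pderiv (i := i)) l R
      rw [← h3, show l • R = fun i => aeval (lineParam u w) (Q i) from (funext hR).symm,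
        eval_aeval]
      congr 2
      funext j
      rw [eval_aeval, eval_lineParam]
    rw [← mul_assoc, ← mul_assoc, Polynomial.eval_mul, h2, Polynomial.eval_mul, h2,
      Polynomial.eval_C, Polynomial.eval_C]
    by_cases hQ : evalVec Q (u + b • w) = 0
    · rw [hQ]
      have h0 : ∀ i, aeval (0 : Fin 4 → K) (pderiv i F) = 0 := fun i => by
        have := aeval_smul_of_isHomogeneous (h.cubic.pderiv (i := i)) (0 : K) (0 : Fin 4 → K)
        rwa [zero_smul, zero_pow (by norm_num), zero_mul] at this
      rw [h0, h0, zero_mul, zero_mul]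
    · exact h.parallel_gradient hQ (hHy b) (hHt b) i j
  obtain ⟨k, hk⟩ := Function.ne_iff.1 hH
  rw [Pi.zero_apply] at hk
  have hQw : evalVec Q w = c • fun i => (R i).coeff n := funext hlead
  have hr0 : (fun i => (R i).coeff n) ≠ 0 := fun h0 => hw (by
    change evalVec Q w = 0
    rw [hQw, h0, smul_zero])
  have hFr : aeval (fun i => (R i).coeff n) F = 0 := by
    have := h.evalVec_mem w
    rw [hQw, aeval_smul_of_isHomogeneous h.cubic] at this
    exact (mul_eq_zero.1 this).resolve_left (pow_ne_zero _ hc)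
  obtain ⟨i, hi⟩ := h.smooth _ hr0 hFr
  -- The coefficient of degree `2 * n` is a partial derivative at the smooth point `Q(w)`. As `H k ≠
  -- 0`, the `k`-th partial derivative vanishes only where all of them do.
  have hφ : (aeval R (pderiv k F)).coeff (n + n) ≠ 0 := by
    intro h0
    have := congrArg (fun p => Polynomial.coeff p (n + n)) (hgrad i k)
    simp only [Polynomial.coeff_mul_C, h0, zero_mul, coeff_aeval_pderiv h.cubic hdeg] at this
    exact (mul_ne_zero hi hk) this
  have hφdeg : n + n ≤ (aeval R (pderiv k F)).natDegree :=
    Polynomial.le_natDegree_of_ne_zero hφ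
  -- Since `n ≠ 0` there is a root, and it is a singular point of the surface.
  obtain ⟨b, hb⟩ := IsAlgClosed.exists_root (aeval R (pderiv k F)) (fun h0 => by
    rw [Polynomial.natDegree_eq_zero_iff_degree_le_zero.2 h0.le] at hφdeg
    omega)
  obtain ⟨j, hj⟩ := h.smooth _ (hne b) (h.eval_factor_eq_zero hR hl b)
  have := congrArg (Polynomial.eval b) (hgrad j k)
  rw [Polynomial.eval_mul, Polynomial.eval_mul, hb, zero_mul, Polynomial.eval_C, eval_aeval] at this
  exact (mul_ne_zero hj hk) this

end InverseData

/-! ### Plane models with coefficients in the ground field. -/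

section basics

variable {k K A : Type*} [CommRing k] [CommRing K] [Algebra k K] [CommRing A] [Algebra K A]
  [Algebra k A] [IsScalarTower k K A]

theorem evalVec_map {σ ι : Type*} (Q : ι → MvPolynomial σ k) (y : σ → A) :
    evalVec (fun i => map (algebraMap k K) (Q i)) y = evalVec Q y :=
  funext fun i => aeval_map_algebraMap K y (Q i)

theorem dirDeriv_map {σ : Type*} [Fintype σ] (G : MvPolynomial σ k) (y t : σ → A) :
    dirDeriv (map (algebraMap k K) G) y t = dirDeriv G y t := by
  simp only [dirDeriv, pderiv_map, aeval_map_algebraMap]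

theorem dirVec_map {σ ι : Type*} [Fintype σ] (Q : ι → MvPolynomial σ k) (y t : σ → A) :
    dirVec (fun i => map (algebraMap k K) (Q i)) y t = dirVec Q y t :=
  funext fun i => dirDeriv_map (Q i) y t

theorem dirVec_add_right {σ ι : Type*} [Fintype σ] (Q : ι → MvPolynomial σ k) (y t t' : σ → A) :
    dirVec Q y (t + t') = dirVec Q y t + dirVec Q y t' :=
  funext fun i => dirDeriv_add (Q i) y t t'

theorem dirVec_smul_right {σ ι : Type*} [Fintype σ] (Q : ι → MvPolynomial σ k) (y t : σ → A)
    (c : A) : dirVec Q y (c • t) = c • dirVec Q y t :=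
  funext fun i => dirDeriv_smul (Q i) y t c

end basics

/-- The extension of scalars of a coordinate vector. -/
def extVec {k : Type*} (K : Type*) [CommRing k] [CommRing K] [Algebra k K] {ι : Type*}
    (a : ι → k) : ι → K := fun i => algebraMap k K (a i)

section extVec

variable {k K ι : Type*} [Field k] [Field K] [Algebra k K]

theorem extVec_smul (c : k) (a : ι → k) : extVec K (c • a) = algebraMap k K c • extVec K a := by
  funext i
  simp [extVec]

theorem extVec_add (a b : ι → k) : extVec K (a + b) = extVec K a + extVec K b := by
  funext i
  simp [extVec]

theorem extVec_injective : Function.Injective (extVec K : (ι → k) → ι → K) := fun _ _ h =>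
  funext fun i => (algebraMap k K).injective (congrFun h i)

theorem extVec_eq_zero {a : ι → k} : extVec K a = 0 ↔ a = 0 :=
  ⟨fun h => extVec_injective (K := K) (h.trans (funext fun _ => (map_zero _).symm)), fun h =>
    h ▸ funext fun _ => map_zero _⟩

theorem parallel_extVec {a b : ι → k} : Parallel (extVec K a) (extVec K b) ↔ Parallel a b := by
  refine forall_congr' fun i => forall_congr' fun j => ?_
  simp only [extVec, ← map_mul]
  exact (algebraMap k K).injective.eq_iff

theorem extVec_dotProduct [Fintype ι] (a b : ι → k) :
    extVec K a ⬝ᵥ extVec K b = algebraMap k K (a ⬝ᵥ b) := by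
  simp [dotProduct, extVec]

theorem evalVec_extVec {σ : Type*} (Q : ι → MvPolynomial σ k) (y : σ → k) :
    evalVec Q (extVec K y) = extVec K (evalVec Q y) :=
  funext fun i => (comp_aeval_apply (φ := Algebra.ofId k K) y (Q i)).symm

theorem dirVec_extVec {σ : Type*} [Fintype σ] (Q : ι → MvPolynomial σ k) (y t : σ → k) :
    dirVec Q (extVec K y) (extVec K t) = extVec K (dirVec Q y t) :=
  funext fun i => (map_dirDeriv (Algebra.ofId k K) (Q i) y t).symm

end extVec

/-- The pullback to the plane of the plane section with coefficients `H`. -/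
noncomputable def sectionForm {k : Type*} [CommRing k] (Q : Fin 4 → MvPolynomial (Fin 3) k)
    (H : Fin 4 → k) : MvPolynomial (Fin 3) k :=
  ∑ i, C (H i) * Q i

section sectionForm

variable {k A : Type*} [CommRing k] [CommRing A] [Algebra k A]
  {Q : Fin 4 → MvPolynomial (Fin 3) k}

theorem aeval_sectionForm (H : Fin 4 → k) (y : Fin 3 → A) :
    aeval y (sectionForm Q H) = extVec A H ⬝ᵥ evalVec Q y := by
  simp [sectionForm, dotProduct, extVec]

theorem dirDeriv_sectionForm (H : Fin 4 → k) (y t : Fin 3 → A) :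
    dirDeriv (sectionForm Q H) y t = extVec A H ⬝ᵥ dirVec Q y t := by
  simp [sectionForm, dirDeriv_sum, dirDeriv_poly_mul, dirDeriv_C, dotProduct, extVec]

theorem isHomogeneous_sectionForm {d : ℕ} (hQ : ∀ i, (Q i).IsHomogeneous d) (H : Fin 4 → k) :
    (sectionForm Q H).IsHomogeneous d :=
  IsHomogeneous.sum _ _ _ fun i _ => by simpa using (isHomogeneous_C _ (H i)).mul (hQ i)

end sectionForm

/-- A base point of the linear system spanned by the forms `Q`. -/
def IsBasePoint {k K : Type*} [Field k] [Field K] [Algebra k K]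
    (Q : Fin 4 → MvPolynomial (Fin 3) k) (s : Fin 3 → K) : Prop :=
  s ≠ 0 ∧ evalVec Q s = 0

/-- The plane with coefficients `H` contains the exceptional line above `s`. -/
def ContainsLine {k K : Type*} [Field k] [Field K] [Algebra k K]
    (Q : Fin 4 → MvPolynomial (Fin 3) k) (H : Fin 4 → k) (s : Fin 3 → K) : Prop :=
  ∀ t, extVec K H ⬝ᵥ dirVec Q s t = 0

/-- A plane model with its parametrization defined over the subfield `k`. -/
structure RationalPlaneModel {k K : Type*} [Field k] [Field K] [Algebra k K]
    (F : MvPolynomial (Fin 4) k) (Q : Fin 4 → MvPolynomial (Fin 3) k)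
    (π : (Fin 4 → K) → (Fin 3 → K)) : Prop where
  homogeneous : ∀ i, (Q i).IsHomogeneous 3
  model : PlaneModel (map (algebraMap k K) F) (fun i => map (algebraMap k K) (Q i)) π

namespace RationalPlaneModel

variable {k K : Type*} [Field k] [Field K] [Algebra k K] {F : MvPolynomial (Fin 4) k}
  {Q : Fin 4 → MvPolynomial (Fin 3) k} {π : (Fin 4 → K) → (Fin 3 → K)}

theorem parallel_of_dirVec_eq_dirVec (h : RationalPlaneModel F Q π) {s s' t t' : Fin 3 → K}
    (hs : IsBasePoint Q s) (hs' : IsBasePoint Q s') (heq : dirVec Q s t = dirVec Q s' t')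
    (hne : dirVec Q s t ≠ 0) : Parallel s s' :=
  h.model.toInverseData.parallel_of_dirVec_eq_dirVec (t := t) (t' := t')
    (by rw [evalVec_map]; exact hs.2) (by rw [evalVec_map]; exact hs'.2)
    (by rw [dirVec_map, dirVec_map]; exact heq) (by rw [dirVec_map]; exact hne)

theorem isBasePoint_of_parallel (h : RationalPlaneModel F Q π) {s y : Fin 3 → K}
    (hs : IsBasePoint Q s) (hy : y ≠ 0) (hp : Parallel y s) : IsBasePoint Q y := by
  have := h.model.toInverseData.evalVec_eq_zero_of_parallel hs.1 (by rw [evalVec_map]; exact hs.2) hp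
  rw [evalVec_map] at this
  exact ⟨hy, this⟩

theorem dirVec_smul_left (h : RationalPlaneModel F Q π) (c : K) (s t : Fin 3 → K) :
    dirVec Q (c • s) t = c ^ 2 • dirVec Q s t := by
  funext i
  simp only [dirVec, dirDeriv, aeval_smul_of_isHomogeneous ((h.homogeneous i).pderiv),
    Pi.smul_apply, smul_eq_mul, Finset.mul_sum, mul_assoc]

theorem containsLine_of_parallel (h : RationalPlaneModel F Q π) {s y : Fin 3 → K} (hs : s ≠ 0)
    {H : Fin 4 → k} (hH : ContainsLine Q H s) (hp : Parallel y s) : ContainsLine Q H y := by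
  obtain ⟨c, rfl⟩ := hp.exists_smul hs
  intro t
  rw [h.dirVec_smul_left, dotProduct_smul, hH t, smul_zero]

variable [IsAlgClosed K]

theorem parallel_of_dirVec_eq_zero (h : RationalPlaneModel F Q π) {s t : Fin 3 → K}
    (hs : IsBasePoint Q s) (ht : dirVec Q s t = 0) : Parallel s t :=
  h.model.toInverseData.parallel_of_dirVec_eq_zero hs.1 (by rw [evalVec_map]; exact hs.2)
    (by rw [dirVec_map]; exact ht)

theorem parallel_of_containsLine (h : RationalPlaneModel F Q π) {s s' : Fin 3 → K}
    (hs : IsBasePoint Q s) (hs' : IsBasePoint Q s') {H : Fin 4 → k} (hH : H ≠ 0)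
    (hHs : ContainsLine Q H s) (hHs' : ContainsLine Q H s') : Parallel s s' :=
  h.model.toInverseData.parallel_of_contains_lines hs.1 (by rw [evalVec_map]; exact hs.2)
    hs'.1 (by rw [evalVec_map]; exact hs'.2) (H := extVec K H)
    (fun h0 => hH (extVec_eq_zero.1 h0))
    (fun t => by rw [dirVec_map]; exact hHs t) (fun t => by rw [dirVec_map]; exact hHs' t)

/-- A plane through an exceptional line is determined by a further point of the surface. -/
theorem parallel_planes_of_containsLine (h : RationalPlaneModel F Q π) {s y : Fin 3 → K}
    (hs : IsBasePoint Q s) (hy : evalVec Q y ≠ 0) {H H' : Fin 4 → k}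
    (hHs : ContainsLine Q H s) (hHs' : ContainsLine Q H' s)
    (hHy : aeval y (sectionForm Q H) = 0) (hHy' : aeval y (sectionForm Q H') = 0) :
    Parallel H H' := by
  rw [aeval_sectionForm] at hHy hHy'
  rw [← parallel_extVec (K := K)]
  refine h.model.toInverseData.parallel_of_contains_line hs.1 (by rw [evalVec_map]; exact hs.2)
    (v := evalVec Q y) (fun t => ?_) (fun t => by rw [dirVec_map]; exact hHs t) hHy
    (fun t => by rw [dirVec_map]; exact hHs' t) hHy'
  have := h.model.toInverseData.evalVec_ne_dirVec hs.1 (by rw [evalVec_map]; exact hs.2)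
    (y := y) (by rw [evalVec_map]; exact hy) t
  rwa [evalVec_map] at this

/-- No three base points are collinear. -/
theorem not_collinear (h : RationalPlaneModel F Q π) {s s' : Fin 3 → K} (hs : IsBasePoint Q s)
    (hs' : IsBasePoint Q s') (hne : ¬ Parallel s s') {α β : K} (hα : α ≠ 0) (hβ : β ≠ 0) :
    ¬ IsBasePoint Q (α • s + β • s') := by
  rintro ⟨-, h0⟩
  -- With zeros at `s` and `s'`, only the mixed terms of `Q` survive on their line. A third zero
  -- makes them proportional, which is a common point of two disjoint exceptional lines.
  have key : α • dirVec Q s s' + β • dirVec Q s' s = 0 := by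
    funext i
    have h1 := congrFun h0 i
    simp only [aeval_smul_add_smul (h.homogeneous i), show aeval s (Q i) = 0 from congrFun hs.2 i,
      show aeval s' (Q i) = 0 from congrFun hs'.2 i, Pi.zero_apply] at h1
    refine mul_left_cancel₀ (mul_ne_zero hα hβ) ?_
    simp only [Pi.add_apply, Pi.smul_apply, smul_eq_mul, Pi.zero_apply]
    linear_combination h1
  refine hne (h.parallel_of_dirVec_eq_dirVec hs hs' (t := α • s') (t' := -β • s) ?_ ?_)
  · rw [dirVec_smul_right, dirVec_smul_right, neg_smul]
    exact eq_neg_of_add_eq_zero_left key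
  · rw [dirVec_smul_right]
    exact smul_ne_zero hα fun h0 => hne (h.parallel_of_dirVec_eq_zero hs h0)

omit [IsAlgClosed K] in
/-- A plane through an exceptional line and through a point on a line joining two base points is
tangent to the line. -/
theorem dirDeriv_eq_zero_of_containsLine (h : RationalPlaneModel F Q π) {s x : Fin 3 → K}
    {H : Fin 4 → k} (hs : IsBasePoint Q s) (hHs : aeval x (sectionForm Q H) = 0)
    (hsx : dirDeriv (sectionForm Q H) s x = 0)
    {α β : K} (hα : α ≠ 0) (hβ : β ≠ 0) (hs' : IsBasePoint Q (α • s + β • x)) :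
    dirDeriv (sectionForm Q H) x s = 0 := by
  have h1 : aeval (α • s + β • x) (sectionForm Q H) = 0 := by
    rw [aeval_sectionForm, hs'.2, dotProduct_zero]
  rw [aeval_smul_add_smul (isHomogeneous_sectionForm h.homogeneous H), hHs, hsx,
    aeval_sectionForm, hs.2, dotProduct_zero] at h1
  refine mul_left_cancel₀ (mul_ne_zero hα (pow_ne_zero 2 hβ)) ?_
  linear_combination h1

end RationalPlaneModel

/-! ### Lines of the plane and their contact with plane sections. -/

section planeGeometry

variable {k : Type*} [Field k]

/-- The vector of `2 × 2` minors. -/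
def crossProduct₃ {A : Type*} [CommRing A] (a b : Fin 3 → A) : Fin 3 → A :=
  ![a 1 * b 2 - a 2 * b 1, a 2 * b 0 - a 0 * b 2, a 0 * b 1 - a 1 * b 0]

theorem crossProduct₃_ne_zero {a b : Fin 3 → k} (h : ¬ Parallel a b) : crossProduct₃ a b ≠ 0 := by
  intro h0
  obtain ⟨w, hw⟩ := exists_det₃_ne_zero h
  have h1 := congrFun h0 0
  have h2 := congrFun h0 1
  have h3 := congrFun h0 2
  simp only [crossProduct₃, Matrix.cons_val, Pi.zero_apply] at h1 h2 h3
  apply hw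
  simp only [det₃]
  linear_combination w 0 * h1 + w 1 * h2 + w 2 * h3

theorem parallel_crossProduct₃ {A : Type*} [CommRing A] {a b c : Fin 3 → A}
    (ha : c ⬝ᵥ a = 0) (hb : c ⬝ᵥ b = 0) : Parallel c (crossProduct₃ a b) := by
  simp only [dotProduct, Fin.sum_univ_three] at ha hb
  intro i j
  fin_cases i <;> fin_cases j <;>
    simp only [crossProduct₃, Matrix.cons_val, Fin.zero_eta, Fin.mk_one, Fin.reduceFinMk]
  · linear_combination a 2 * hb - b 2 * ha
  · linear_combination b 1 * ha - a 1 * hb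
  · linear_combination b 2 * ha - a 2 * hb
  · linear_combination a 0 * hb - b 0 * ha
  · linear_combination a 1 * hb - b 1 * ha
  · linear_combination b 0 * ha - a 0 * hb

theorem parallel_of_dotProduct_eq_zero₃ {a b c d : Fin 3 → k} (h : ¬ Parallel a b)
    (hca : c ⬝ᵥ a = 0) (hcb : c ⬝ᵥ b = 0) (hda : d ⬝ᵥ a = 0) (hdb : d ⬝ᵥ b = 0) :
    Parallel c d :=
  (parallel_crossProduct₃ hca hcb).trans (crossProduct₃_ne_zero h)
    (parallel_crossProduct₃ hda hdb).symm

theorem det₃_eq_zero_of_dotProduct {A : Type*} [CommRing A] [IsDomain A] {Λ a b c : Fin 3 → A}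
    (hΛ : Λ ≠ 0) (ha : Λ ⬝ᵥ a = 0) (hb : Λ ⬝ᵥ b = 0) (hc : Λ ⬝ᵥ c = 0) : det₃ a b c = 0 := by
  by_contra h
  simp only [dotProduct, Fin.sum_univ_three] at ha hb hc
  refine hΛ (funext fun i => (mul_eq_zero.1 ?_).resolve_right h)
  fin_cases i <;> simp only [det₃, Fin.zero_eta, Fin.mk_one, Fin.reduceFinMk]
  · linear_combination (b 1 * c 2 - b 2 * c 1) * ha + (c 1 * a 2 - c 2 * a 1) * hb
      + (a 1 * b 2 - a 2 * b 1) * hc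
  · linear_combination (b 2 * c 0 - b 0 * c 2) * ha + (c 2 * a 0 - c 0 * a 2) * hb
      + (a 2 * b 0 - a 0 * b 2) * hc
  · linear_combination (b 0 * c 1 - b 1 * c 0) * ha + (c 0 * a 1 - c 1 * a 0) * hb
      + (a 0 * b 1 - a 1 * b 0) * hc

theorem exists_eq_smul_add_smul_of_dotProduct {Λ a b x : Fin 3 → k} (hΛ : Λ ≠ 0)
    (hab : ¬ Parallel a b) (ha : Λ ⬝ᵥ a = 0) (hb : Λ ⬝ᵥ b = 0) (hx : Λ ⬝ᵥ x = 0) :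
    ∃ α β : k, x = α • a + β • b :=
  exists_eq_smul_add_smul_of_not_parallel hab (det₃_eq_zero_of_dotProduct hΛ ha hb hx)

end planeGeometry

/-- The linear form with coefficients `A`. -/
noncomputable def linForm {k σ : Type*} [CommRing k] [Fintype σ] (A : σ → k) : MvPolynomial σ k :=
  ∑ i, C (A i) * X i

section linForm

variable {k σ : Type*} [Field k] [Fintype σ]

theorem aeval_linForm {B : Type*} [CommRing B] [Algebra k B] (A : σ → k) (y : σ → B) :
    aeval y (linForm A) = extVec B A ⬝ᵥ y :=
  aeval_sum_C_mul_X A y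

theorem dirDeriv_linForm {B : Type*} [CommRing B] [Algebra k B] (A : σ → k) (y t : σ → B) :
    dirDeriv (linForm A) y t = extVec B A ⬝ᵥ t := by
  classical
  simp [linForm, dirDeriv_sum, dirDeriv_poly_mul, dirDeriv_C, dirDeriv_X, dotProduct, extVec]

theorem isHomogeneous_linForm (A : σ → k) : (linForm A).IsHomogeneous 1 :=
  IsHomogeneous.sum _ _ _ fun i _ => by
    simpa using (isHomogeneous_C _ (A i)).mul (isHomogeneous_X k i)

theorem extVec_self {R ι : Type*} [CommRing R] (A : ι → R) : extVec R A = A := rfl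

theorem linForm_eq_zero {A : σ → k} : linForm A = 0 ↔ A = 0 := by
  classical
  refine ⟨fun h => funext fun i => ?_, fun h => by simp [linForm, h]⟩
  have := aeval_linForm A (Pi.single i (1 : k))
  rw [h, map_zero, extVec_self, dotProduct_single, mul_one] at this
  exact this.symm

theorem parallel_of_linForm_dvd {A B : σ → k} (h : linForm A ∣ linForm B) : Parallel A B := by
  classical
  intro i j
  by_cases hij : i = j
  · rw [hij, mul_comm]
  obtain ⟨q, hq⟩ := h
  have := congrArg (aeval (Pi.single i (A j) - Pi.single j (A i) : σ → k)) hq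
  rw [map_mul, aeval_linForm, aeval_linForm, extVec_self, extVec_self] at this
  simp only [dotProduct_sub, dotProduct_single] at this
  rw [mul_comm (A i) (A j), sub_self, zero_mul] at this
  linear_combination -this

end linForm

theorem aeval_extVec {k A σ : Type*} [CommRing k] [CommRing A] [Algebra k A] (G : MvPolynomial σ k)
    (a : σ → k) : aeval (extVec A a) G = algebraMap k A (aeval a G) :=
  (comp_aeval_apply (φ := Algebra.ofId k A) a G).symm

theorem dirDeriv_extVec {k A σ : Type*} [Fintype σ] [CommRing k] [CommRing A] [Algebra k A]
    (G : MvPolynomial σ k) (a b : σ → k) :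
    dirDeriv G (extVec A a) (extVec A b) = algebraMap k A (dirDeriv G a b) :=
  (map_dirDeriv (Algebra.ofId k A) G a b).symm

/-- Cramer's rule writes a unit multiple of `x` as a combination of `a` and `b`. The ring `B` is
arbitrary so that `x` may be the generic point of the line. -/
theorem aeval_eq_zero_of_aeval_lineParam {k B : Type*} [Field k] [CommRing B] [Algebra k B]
    {G : MvPolynomial (Fin 3) k} (hG : G.IsHomogeneous 3) {Λ a b : Fin 3 → k} (hΛ : Λ ≠ 0)
    (hab : ¬ Parallel a b) (ha : Λ ⬝ᵥ a = 0) (hb : Λ ⬝ᵥ b = 0) (h : aeval (lineParam a b) G = 0)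
    {x : Fin 3 → B} (hx : extVec B Λ ⬝ᵥ x = 0) : aeval x G = 0 := by
  rw [aeval_lineParam hG] at h
  have hc := fun n => congrArg (Polynomial.coeff · n) h
  have h0 := hc 0
  have h1 := hc 1
  have h2 := hc 2
  have h3 := hc 3
  simp [Polynomial.coeff_X, Polynomial.coeff_C, Polynomial.coeff_X_pow] at h0 h1 h2 h3
  obtain ⟨w, hw⟩ := exists_det₃_ne_zero hab
  obtain ⟨m, hm⟩ := (parallel_crossProduct₃ ha hb).symm.exists_smul hΛ
  have hdet : det₃ (extVec B a) (extVec B b) x = 0 := by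
    have h1 : det₃ (extVec B a) (extVec B b) x = extVec B (crossProduct₃ a b) ⬝ᵥ x := by
      simp only [det₃, extVec, crossProduct₃, dotProduct, Fin.sum_univ_three, Matrix.cons_val,
        map_sub, map_mul]
      ring
    have h2 : extVec B (m • Λ) = algebraMap k B m • extVec B Λ := by
      funext i
      simp [extVec]
    rw [h1, hm, h2, smul_dotProduct, hx, smul_zero]
  have hsm := smul_eq_of_det₃ (extVec B a) (extVec B b) (extVec B w) x
  rw [hdet, zero_smul, add_zero] at hsm
  have hD : det₃ (extVec B a) (extVec B b) (extVec B w) = algebraMap k B (det₃ a b w) := by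
    simp only [det₃, extVec, map_add, map_sub, map_mul]
  have key : algebraMap k B (det₃ a b w) ^ 3 * aeval x G = 0 := by
    rw [← aeval_smul_of_isHomogeneous hG, ← hD, hsm, aeval_smul_add_smul hG, aeval_extVec,
      aeval_extVec, dirDeriv_extVec, dirDeriv_extVec]
    simp [aeval_eq_eval, h0, h1, h2, h3]
  rwa [(((IsUnit.mk0 _ hw).map _).pow 3).mul_right_eq_zero] at key

/-- A cubic form vanishing on a line of the plane is divisible by the equation of the line. -/
theorem linForm_dvd_of_aeval_lineParam {k : Type*} [Field k] {G : MvPolynomial (Fin 3) k}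
    (hG : G.IsHomogeneous 3) {Λ a b : Fin 3 → k} (hΛ : Λ ≠ 0) (hab : ¬ Parallel a b)
    (ha : Λ ⬝ᵥ a = 0) (hb : Λ ⬝ᵥ b = 0) (h : aeval (lineParam a b) G = 0) : linForm Λ ∣ G := by
  -- The residue classes of the variables modulo the linear form are the coordinates of a point of
  -- the line, at which a polynomial takes its own residue class as value.
  have hx : ∀ P, aeval (fun i => Ideal.Quotient.mkₐ k (Ideal.span {linForm Λ}) (X i)) P
      = Ideal.Quotient.mkₐ k (Ideal.span {linForm Λ}) P := fun P =>
    (DFunLike.congr_fun (aeval_unique (Ideal.Quotient.mkₐ k (Ideal.span {linForm Λ}))) P).symm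
  have h0 := aeval_eq_zero_of_aeval_lineParam hG hΛ hab ha hb h
    (x := fun i => Ideal.Quotient.mkₐ k (Ideal.span {linForm Λ}) (X i)) (by
      rw [← aeval_linForm, hx]
      exact Ideal.Quotient.eq_zero_iff_mem.2 (Ideal.mem_span_singleton_self _))
  rw [hx] at h0
  exact Ideal.mem_span_singleton.1 (Ideal.Quotient.eq_zero_iff_mem.1 h0)

/-- The plane section `H` cuts the line `Λ` in `u + w + z` (or contains it, if `τ = 0`). -/
def Contact {k : Type*} [Field k] (Q : Fin 4 → MvPolynomial (Fin 3) k) (Λ : Fin 3 → k)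
    (H : Fin 4 → k) (τ : k) (u w z : Fin 3 → k) : Prop :=
  ∃ A B D : Fin 3 → k, ¬ Parallel Λ A ∧ ¬ Parallel Λ B ∧ ¬ Parallel Λ D ∧
    A ⬝ᵥ u = 0 ∧ B ⬝ᵥ w = 0 ∧ D ⬝ᵥ z = 0 ∧
    linForm Λ ∣ sectionForm Q H - C τ * (linForm A * linForm B * linForm D)

theorem exists_not_parallel_dotProduct_eq_zero {k : Type*} [Field k] {Λ : Fin 3 → k}
    (hΛ : Λ ≠ 0) (u : Fin 3 → k) : ∃ A, ¬ Parallel Λ A ∧ A ⬝ᵥ u = 0 := by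
  obtain ⟨A, h1, h2⟩ := exists_dotProduct_eq_zero_not_parallel u hΛ
  exact ⟨A, fun h => h2 h.symm, by rwa [dotProduct_comm]⟩

theorem sectionForm_add {k : Type*} [CommRing k] (Q : Fin 4 → MvPolynomial (Fin 3) k)
    (H H' : Fin 4 → k) : sectionForm Q (H + H') = sectionForm Q H + sectionForm Q H' := by
  simp [sectionForm, add_mul, Finset.sum_add_distrib]

theorem sectionForm_smul {k : Type*} [CommRing k] (Q : Fin 4 → MvPolynomial (Fin 3) k)
    (c : k) (H : Fin 4 → k) : sectionForm Q (c • H) = C c * sectionForm Q H := by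
  simp [sectionForm, Finset.mul_sum, mul_assoc]

theorem natDegree_aeval_lineParam_le {k σ : Type*} [Fintype σ] [CommRing k] {G : MvPolynomial σ k}
    (hG : G.IsHomogeneous 3) (a b : σ → k) : (aeval (lineParam a b) G).natDegree ≤ 3 := by
  rw [aeval_lineParam hG]
  compute_degree

/-- Three given points of a line lie on a plane section which contains the line or meets it in
these points. -/
theorem exists_contact {k : Type*} [Field k] {Q : Fin 4 → MvPolynomial (Fin 3) k}
    (hQ : ∀ i, (Q i).IsHomogeneous 3) {Λ u : Fin 3 → k} (hΛ : Λ ≠ 0) (hu : u ≠ 0)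
    (hΛu : Λ ⬝ᵥ u = 0) (w z : Fin 3 → k) :
    ∃ (H : Fin 4 → k) (τ : k), H ≠ 0 ∧ Contact Q Λ H τ u w z := by
  obtain ⟨b, hΛb, hbu⟩ := exists_dotProduct_eq_zero_not_parallel Λ hu
  obtain ⟨A, hΛA, hA⟩ := exists_not_parallel_dotProduct_eq_zero hΛ u
  obtain ⟨B, hΛB, hB⟩ := exists_not_parallel_dotProduct_eq_zero hΛ w
  obtain ⟨D, hΛD, hD⟩ := exists_not_parallel_dotProduct_eq_zero hΛ z
  set M := linForm A * linForm B * linForm D with hM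
  have hMh : M.IsHomogeneous 3 :=
    ((isHomogeneous_linForm A).mul (isHomogeneous_linForm B)).mul (isHomogeneous_linForm D)
  -- Five parameters against the four coefficients of a cubic on the line: the kernel is nonzero.
  let Φ : ((Fin 4 → k) × k) →ₗ[k] (Fin 4 → k) :=
    { toFun := fun p j => (aeval (lineParam b u) (sectionForm Q p.1 - C p.2 * M)).coeff j
      map_add' := fun p q => by
        funext j
        rw [Pi.add_apply, ← Polynomial.coeff_add, ← map_add, Prod.fst_add, Prod.snd_add,
          sectionForm_add, C_add, add_mul, add_sub_add_comm]
      map_smul' := fun c p => by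
        funext j
        simp only [Prod.smul_fst, Prod.smul_snd, sectionForm_smul, smul_eq_mul, C_mul, mul_assoc,
          ← mul_sub, RingHom.id_apply, Pi.smul_apply, map_mul (aeval (lineParam b u)) (C c),
          algHom_C, Polynomial.algebraMap_eq, Polynomial.coeff_C_mul] }
  have hker : LinearMap.ker Φ ≠ ⊥ := LinearMap.ker_ne_bot_of_finrank_lt (by simp)
  obtain ⟨⟨H, τ⟩, hmem, hne⟩ := Submodule.exists_mem_ne_zero_of_ne_bot hker
  have hhom : (sectionForm Q H - C τ * M).IsHomogeneous 3 := by
    refine (isHomogeneous_sectionForm hQ H).sub ?_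
    simpa using (isHomogeneous_C _ τ).mul hMh
  have hzero : aeval (lineParam b u) (sectionForm Q H - C τ * M) = 0 := by
    refine Polynomial.ext fun n => ?_
    by_cases hn : n < 4
    · exact congrFun (LinearMap.mem_ker.1 hmem) ⟨n, hn⟩
    · exact Polynomial.coeff_eq_zero_of_natDegree_lt
        ((natDegree_aeval_lineParam_le hhom b u).trans_lt (by omega))
  refine ⟨H, τ, ?_, A, B, D, hΛA, hΛB, hΛD, hA, hB, hD,
    linForm_dvd_of_aeval_lineParam hhom hΛ hbu hΛb hΛu hzero⟩
  -- If `H = 0` then `τ ≠ 0`, and a product of three linear forms would vanish on the line although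
  -- none of them does.
  rintro rfl
  have hτ : τ ≠ 0 := fun h => hne (by rw [h]; rfl)
  have hlin : ∀ A', ¬ Parallel Λ A' → aeval (lineParam b u) (linForm A') ≠ 0 := by
    intro A' hA' h0
    have h1 : ∀ y : Fin 3 → Polynomial k, ∀ n, (extVec (Polynomial k) A' ⬝ᵥ y).coeff n
        = A' ⬝ᵥ fun i => (y i).coeff n := fun y n => by
      simp [dotProduct, extVec]
    rw [aeval_linForm] at h0
    have hb' := h1 (lineParam b u) 0
    have hu' := h1 (lineParam b u) 1
    rw [h0] at hb' hu'
    simp [lineParam, Polynomial.coeff_X] at hb' hu'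
    exact hA' (parallel_of_dotProduct_eq_zero₃ hbu hΛb hΛu hb'.symm hu'.symm)
  rw [map_sub, map_mul, hM, map_mul, map_mul] at hzero
  simp only [sectionForm, Pi.zero_apply, zero_mul, Finset.sum_const_zero, map_zero, zero_sub,
    neg_eq_zero, algHom_C, mul_eq_zero, hlin A hΛA, hlin B hΛB, hlin D hΛD, or_false,
    Polynomial.algebraMap_eq, Polynomial.C_eq_zero, hτ] at hzero

namespace Contact

variable {k : Type*} [Field k] {Q : Fin 4 → MvPolynomial (Fin 3) k} {Λ : Fin 3 → k}
    {H : Fin 4 → k} {τ : k} {u w z : Fin 3 → k}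

theorem aeval_eq_zero_iff (h : Contact Q Λ H τ u w z) (hτ : τ ≠ 0) {t : Fin 3 → k}
    (ht : Λ ⬝ᵥ t = 0) (hu : Λ ⬝ᵥ u = 0) (hw : Λ ⬝ᵥ w = 0) (hz : Λ ⬝ᵥ z = 0)
    (h0 : aeval t (sectionForm Q H) = 0) : Parallel t u ∨ Parallel t w ∨ Parallel t z := by
  obtain ⟨A, B, D, hA, hB, hD, hAu, hBw, hDz, q, hq⟩ := h
  have h1 := congrArg (aeval t) hq
  simp only [map_sub, map_mul, aeval_linForm, extVec_self, ht, h0, zero_mul, zero_sub,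
    algHom_C, Algebra.algebraMap_self, RingHom.id_apply, neg_eq_zero, mul_eq_zero, hτ, false_or]
    at h1
  have key : ∀ {E y : Fin 3 → k}, ¬ Parallel Λ E → E ⬝ᵥ t = 0 → E ⬝ᵥ y = 0 → Λ ⬝ᵥ y = 0 →
      Parallel t y := fun {E y} hE h1 h2 h3 => by
    rw [dotProduct_comm] at ht h1 h2 h3
    exact parallel_of_dotProduct_eq_zero₃ hE ht h1 h3 h2
  rcases h1 with (h1 | h1) | h1
  · exact Or.inl (key hA h1 hAu hu)
  · exact Or.inr (Or.inl (key hB h1 hBw hw))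
  · exact Or.inr (Or.inr (key hD h1 hDz hz))

theorem aeval_fst (h : Contact Q Λ H τ u w z) (hu : Λ ⬝ᵥ u = 0) :
    aeval u (sectionForm Q H) = 0 := by
  obtain ⟨A, B, D, hA, hB, hD, hAu, hBw, hDz, q, hq⟩ := h
  have h1 := congrArg (aeval u) hq
  simpa only [map_sub, map_mul, aeval_linForm, extVec_self, hu, hAu, zero_mul, mul_zero, sub_zero]
    using h1

theorem symm_left (h : Contact Q Λ H τ u w z) : Contact Q Λ H τ w u z := by
  obtain ⟨A, B, D, hA, hB, hD, hAu, hBw, hDz, hq⟩ := h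
  exact ⟨B, A, D, hB, hA, hD, hBw, hAu, hDz, by rwa [mul_comm (linForm B)]⟩

theorem rotate (h : Contact Q Λ H τ u w z) : Contact Q Λ H τ z u w := by
  obtain ⟨A, B, D, hA, hB, hD, hAu, hBw, hDz, hq⟩ := h
  exact ⟨D, A, B, hD, hA, hB, hDz, hAu, hBw, by
    rwa [mul_assoc (linForm D), mul_comm (linForm D)]⟩

theorem dirDeriv_eq_zero (h : Contact Q Λ H τ u u z) (hu : Λ ⬝ᵥ u = 0) {v : Fin 3 → k}
    (hv : Λ ⬝ᵥ v = 0) : dirDeriv (sectionForm Q H) u v = 0 := by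
  obtain ⟨A, B, D, hA, hB, hD, hAu, hBw, hDz, q, hq⟩ := h
  have h1 := congrArg (dirDeriv · u v) (sub_eq_iff_eq_add.1 hq)
  simpa only [dirDeriv_poly_add, dirDeriv_poly_mul, dirDeriv_C, dirDeriv_linForm, map_mul,
    aeval_linForm, extVec_self, hu, hv, hAu, hBw, zero_mul, mul_zero, add_zero] using h1

end Contact

theorem aeval_lineParam_extVec {k K : Type*} [Field k] [Field K] [Algebra k K] {σ : Type*}
    (G : MvPolynomial σ k) (u w : σ → k) :
    aeval (lineParam (extVec K u) (extVec K w)) (map (algebraMap k K) G)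
      = (aeval (lineParam u w) G).map (algebraMap k K) := by
  rw [aeval_map_algebraMap]
  have h := comp_aeval_apply (φ := Polynomial.mapAlg k K) (lineParam u w) G
  rw [Polynomial.mapAlg_eq_map] at h
  rw [h]
  congr 2
  funext i
  simp [lineParam, extVec, Polynomial.mapAlg_eq_map]

theorem sum_C_mul_eq_zero_of_dvd {k : Type*} [Field k] {Q : Fin 4 → MvPolynomial (Fin 3) k}
    {Λ u w : Fin 3 → k} (hu : Λ ⬝ᵥ u = 0) (hw : Λ ⬝ᵥ w = 0) {H : Fin 4 → k}
    {l : Polynomial k} {R : Fin 4 → Polynomial k}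
    (hR : ∀ i, aeval (lineParam u w) (Q i) = l * R i) (hl : l ≠ 0)
    (hdvd : linForm Λ ∣ sectionForm Q H) : ∑ i, Polynomial.C (H i) * R i = 0 := by
  obtain ⟨q, hq⟩ := hdvd
  have h1 := congrArg (aeval (lineParam u w)) hq
  have h2 : extVec (Polynomial k) Λ ⬝ᵥ lineParam u w = 0 := by
    have hu' := congrArg Polynomial.C hu
    have hw' := congrArg Polynomial.C hw
    simp only [dotProduct, Fin.sum_univ_three, map_add, map_mul, map_zero] at hu' hw'
    simp only [dotProduct, Fin.sum_univ_three, extVec, lineParam, Polynomial.algebraMap_eq]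
    linear_combination hu' + Polynomial.X * hw'
  rw [map_mul, aeval_linForm, h2, zero_mul, sectionForm, map_sum] at h1
  refine (mul_eq_zero.1 (?_ : l * _ = 0)).resolve_left hl
  rw [← h1, Finset.mul_sum]
  refine Finset.sum_congr rfl fun i _ => ?_
  rw [map_mul, hR, algHom_C, Polynomial.algebraMap_eq]
  ring

/-! ### Lines through base points lie in sections without exceptional lines. -/

namespace RationalPlaneModel

variable {k K : Type*} [Field k] [Field K] [Algebra k K] {F : MvPolynomial (Fin 4) k}
  {Q : Fin 4 → MvPolynomial (Fin 3) k} {π : (Fin 4 → K) → (Fin 3 → K)} [IsAlgClosed K]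

theorem line_degree_eq_one (h : RationalPlaneModel F Q π) {Λ u w : Fin 3 → k}
    (huw : ¬ Parallel u w) (hu : Λ ⬝ᵥ u = 0) (hw : Λ ⬝ᵥ w = 0) (hQw : evalVec Q w ≠ 0)
    {H : Fin 4 → k} (hH : H ≠ 0) {s : Fin 3 → K} (hs : IsBasePoint Q s)
    (hHs : ContainsLine Q H s) {n : ℕ} {c : k} {l : Polynomial k} {R : Fin 4 → Polynomial k}
    (hR : ∀ i, aeval (lineParam u w) (Q i) = l * R i) (hl : l ≠ 0)
    (hne : ∀ a : K, (fun i => Polynomial.aeval a (R i)) ≠ 0) (hdeg : ∀ i, (R i).natDegree ≤ n)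
    (hc : c ≠ 0) (hlead : ∀ i, evalVec Q w i = c * (R i).coeff n)
    (hdvd : linForm Λ ∣ sectionForm Q H) :
    n = 1 ∧ ∃ a : K, Parallel (extVec K u + a • extVec K w) s := by
  have hHR := sum_C_mul_eq_zero_of_dvd hu hw hR hl hdvd
  refine h.model.toInverseData.line_degree_eq_one (u := extVec K u) (w := extVec K w)
    (H := extVec K H) (c := algebraMap k K c) (l := l.map (algebraMap k K))
    (R := fun i => (R i).map (algebraMap k K)) (fun hp => huw (parallel_extVec.1 hp)) hs.1
    (by rw [evalVec_map]; exact hs.2) ?_ (fun h0 => hH (extVec_eq_zero.1 h0))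
    (fun t => by rw [dirVec_map]; exact hHs t) (fun i => ?_)
    (by rwa [Polynomial.map_ne_zero_iff (algebraMap k K).injective]) (fun a => ?_)
    (fun i => Polynomial.natDegree_map_le.trans (hdeg i))
    (by rwa [map_ne_zero]) (fun i => ?_) (fun a => ?_)
  · rw [evalVec_map, evalVec_extVec]
    exact fun h0 => hQw (extVec_eq_zero.1 h0)
  · rw [aeval_lineParam_extVec, hR, Polynomial.map_mul]
  · simpa only [Polynomial.eval_map_algebraMap] using hne a
  · rw [evalVec_map, evalVec_extVec, extVec, hlead, map_mul, Polynomial.coeff_map]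
  · have := congrArg (Polynomial.aeval a) hHR
    simpa [dotProduct, extVec, Polynomial.eval_map_algebraMap] using this

/-- The line `Λ` passes through a base point. -/
def MeetsBase {k : Type*} (K : Type*) [Field k] [Field K] [Algebra k K]
    (Q : Fin 4 → MvPolynomial (Fin 3) k) (Λ : Fin 3 → k) : Prop :=
  ∃ s : Fin 3 → K, IsBasePoint Q s ∧ extVec K Λ ⬝ᵥ s = 0

omit [IsAlgClosed K] in
theorem extVec_dotProduct_eq_zero_of_parallel {Λ u w : Fin 3 → k}
    (hu : Λ ⬝ᵥ u = 0) (hw : Λ ⬝ᵥ w = 0) {s : Fin 3 → K}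
    {a : K} (hp : Parallel (extVec K u + a • extVec K w) s) (huw : ¬ Parallel u w) :
    extVec K Λ ⬝ᵥ s = 0 := by
  have h1 : extVec K Λ ⬝ᵥ (extVec K u + a • extVec K w) = 0 := by
    rw [dotProduct_add, dotProduct_smul, extVec_dotProduct, extVec_dotProduct, hu, hw]
    simp
  have hne : extVec K u + a • extVec K w ≠ 0 := by
    intro h0
    refine huw (parallel_extVec (K := K).1 ?_)
    rw [eq_neg_of_add_eq_zero_left h0, ← neg_smul]
    exact (Parallel.refl _).smul_left _
  obtain ⟨d, rfl⟩ := hp.symm.exists_smul hne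
  rw [dotProduct_smul, h1, smul_zero]

variable [Algebra.IsAlgebraic k K]

/-- A plane section containing a line without base points contains no exceptional line. -/
theorem not_containsLine_of_dvd (h : RationalPlaneModel F Q π) {Λ : Fin 3 → k} {w : Fin 3 → k}
    (hQw : evalVec Q w ≠ 0) (hw0 : w ≠ 0) (hw : Λ ⬝ᵥ w = 0) {H : Fin 4 → k}
    (hH : H ≠ 0) (hdvd : linForm Λ ∣ sectionForm Q H) {s : Fin 3 → K} (hs : IsBasePoint Q s)
    (hHs : ContainsLine Q H s) : extVec K Λ ⬝ᵥ s = 0 := by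
  obtain ⟨u, hu, huw⟩ := exists_dotProduct_eq_zero_not_parallel Λ hw0
  obtain ⟨n, c, l, R, hR, hl, -, hne, hdeg, hc, hlead⟩ :=
    exists_line_of_isHomogeneous K h.homogeneous u hQw
  obtain ⟨-, a, ha⟩ := h.line_degree_eq_one huw hu hw hQw hH hs hHs hR hl hne hdeg hc hlead hdvd
  exact extVec_dotProduct_eq_zero_of_parallel hu hw ha huw

end RationalPlaneModel

theorem exists_ne_zero_forall_dotProduct_eq_zero {k : Type*} [Field k] {m n : ℕ} (hm : m < n)
    (M : Fin m → Fin n → k) : ∃ H : Fin n → k, H ≠ 0 ∧ ∀ j, H ⬝ᵥ M j = 0 := by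
  have hker : LinearMap.ker (Matrix.of M).mulVecLin ≠ ⊥ :=
    LinearMap.ker_ne_bot_of_finrank_lt (by simpa using hm)
  obtain ⟨H, hmem, hne⟩ := Submodule.exists_mem_ne_zero_of_ne_bot hker
  refine ⟨H, hne, fun j => ?_⟩
  rw [dotProduct_comm]
  exact congrFun (LinearMap.mem_ker.1 hmem) j

theorem sum_C_mul_eq_zero_of_coeff {k : Type*} [Field k] {n : ℕ} {H : Fin 4 → k}
    {R : Fin 4 → Polynomial k} (hdeg : ∀ i, (R i).natDegree ≤ n)
    (h : ∀ j : Fin (n + 1), H ⬝ᵥ (fun i => (R i).coeff j) = 0) :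
    ∑ i, Polynomial.C (H i) * R i = 0 := by
  refine Polynomial.ext fun j => ?_
  rw [Polynomial.finsetSum_coeff, Polynomial.coeff_zero]
  simp only [Polynomial.coeff_C_mul]
  by_cases hj : j < n + 1
  · exact h ⟨j, hj⟩
  · exact Finset.sum_eq_zero fun i _ => by
      rw [Polynomial.coeff_eq_zero_of_natDegree_lt ((hdeg i).trans_lt (by omega)), mul_zero]

namespace RationalPlaneModel

variable {k K : Type*} [Field k] [Field K] [Algebra k K] {F : MvPolynomial (Fin 4) k}
  {Q : Fin 4 → MvPolynomial (Fin 3) k} {π : (Fin 4 → K) → (Fin 3 → K)}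

theorem linForm_dvd_sectionForm (h : RationalPlaneModel F Q π) {Λ u w : Fin 3 → k} (hΛ : Λ ≠ 0)
    (huw : ¬ Parallel u w) (hu : Λ ⬝ᵥ u = 0) (hw : Λ ⬝ᵥ w = 0) {H : Fin 4 → k}
    {l : Polynomial k} {R : Fin 4 → Polynomial k}
    (hR : ∀ i, aeval (lineParam u w) (Q i) = l * R i)
    (h0 : ∑ i, Polynomial.C (H i) * R i = 0) : linForm Λ ∣ sectionForm Q H := by
  refine linForm_dvd_of_aeval_lineParam (isHomogeneous_sectionForm h.homogeneous H) hΛ huw hu hw ?_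
  rw [sectionForm, map_sum, ← mul_zero l, ← h0, Finset.mul_sum]
  refine Finset.sum_congr rfl fun i _ => ?_
  rw [map_mul, hR, algHom_C, Polynomial.algebraMap_eq]
  ring

theorem not_isBasePoint_extVec {w : Fin 3 → k} (hQw : evalVec Q w ≠ 0) :
    ¬ IsBasePoint Q (extVec K w) := fun h => by
  have := h.2
  rw [evalVec_extVec] at this
  exact hQw (extVec_eq_zero.1 this)

variable [IsAlgClosed K] [Algebra.IsAlgebraic k K]

/-- A line through a base point and through a further point is contained in a plane section without
exceptional lines. -/
theorem exists_section_of_meetsBase (h : RationalPlaneModel F Q π) {Λ w : Fin 3 → k} (hΛ : Λ ≠ 0)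
    (hQw : evalVec Q w ≠ 0) (hw0 : w ≠ 0) (hw : Λ ⬝ᵥ w = 0) (hM : MeetsBase K Q Λ) :
    ∃ H : Fin 4 → k, H ≠ 0 ∧ linForm Λ ∣ sectionForm Q H ∧
      ∀ s : Fin 3 → K, IsBasePoint Q s → ¬ ContainsLine Q H s := by
  obtain ⟨u, hu, huw⟩ := exists_dotProduct_eq_zero_not_parallel Λ hw0
  obtain ⟨n, c, l, R, hR, hl, hln, hne, hdeg, hc, hlead⟩ :=
    exists_line_of_isHomogeneous K h.homogeneous u hQw
  -- `R` has no zero, so the base points on the line are roots of the common factor `l`.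
  have hroot : ∀ (s : Fin 3 → K) (a : K), IsBasePoint Q s →
      Parallel (extVec K u + a • extVec K w) s →
      IsBasePoint Q (extVec K u + a • extVec K w) ∧ Polynomial.aeval a l = 0 := by
    intro s a hs hp
    have hne0 : extVec K u + a • extVec K w ≠ 0 := fun h0 => huw (parallel_extVec (K := K).1 (by
      rw [eq_neg_of_add_eq_zero_left h0, ← neg_smul]
      exact (Parallel.refl _).smul_left _))
    have hb := h.isBasePoint_of_parallel hs hne0 hp
    refine ⟨hb, by_contra fun hla => hne a (funext fun i => ?_)⟩
    have h1 := congrArg (Polynomial.aeval a) (hR i)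
    have h2 : Polynomial.aeval a (aeval (lineParam u w) (Q i)) = aeval (extVec K u + a • extVec K w)
        (Q i) := by
      rw [← Polynomial.eval_map_algebraMap, ← aeval_lineParam_extVec, eval_aeval, eval_lineParam,
        aeval_map_algebraMap]
    have h3 : aeval (extVec K u + a • extVec K w) (Q i) = 0 := congrFun hb.2 i
    rw [h2, h3, map_mul] at h1
    exact (mul_eq_zero.1 h1.symm).resolve_left hla
  have hn0 : n ≠ 0 := by
    rintro rfl
    refine huw (parallel_extVec (K := K).1 (h.model.toInverseData.parallel_of_line_degree_eq_zero
      (l := l.map (algebraMap k K)) (R := fun i => (R i).map (algebraMap k K)) (fun i => ?_)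
      (by rwa [Polynomial.map_ne_zero_iff (algebraMap k K).injective]) (fun a => ?_)
      (fun i => Polynomial.natDegree_map_le.trans (hdeg i))))
    · rw [aeval_lineParam_extVec, hR, Polynomial.map_mul]
    · simpa only [Polynomial.eval_map_algebraMap] using hne a
  -- For `n = 3` the factor `l` is constant, and the line would contain no base point.
  have hn3 : n ≠ 3 := by
    rintro rfl
    obtain ⟨s, hs, hΛs⟩ := hM
    obtain ⟨α, β, rfl⟩ := exists_eq_smul_add_smul_of_dotProduct
      (fun h0 => hΛ (extVec_eq_zero.1 h0)) (fun hp => huw (parallel_extVec.1 hp))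
      (by rw [extVec_dotProduct, hu, map_zero]) (by rw [extVec_dotProduct, hw, map_zero]) hΛs
    have hα : α ≠ 0 := by
      rintro rfl
      refine not_isBasePoint_extVec hQw (h.isBasePoint_of_parallel hs
        (fun h0 => hw0 (extVec_eq_zero.1 h0)) ?_)
      rw [zero_smul, zero_add]
      exact ((Parallel.refl _).smul_left _).symm
    obtain ⟨-, hla⟩ := hroot _ (β / α) hs (by
      have : α • extVec K u + β • extVec K w = α • (extVec K u + (β / α) • extVec K w) := by
        rw [smul_add, smul_smul, mul_div_cancel₀ _ hα]
      rw [this]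
      exact ((Parallel.refl _).smul_left _).symm)
    rw [Polynomial.eq_C_of_natDegree_eq_zero (p := l) (by omega), Polynomial.aeval_C,
      map_eq_zero] at hla
    exact hl (by rw [Polynomial.eq_C_of_natDegree_eq_zero (p := l) (by omega), hla, map_zero])
  have hbad : ∀ {H : Fin 4 → k} {s : Fin 3 → K}, H ≠ 0 → linForm Λ ∣ sectionForm Q H →
      IsBasePoint Q s → ContainsLine Q H s → n = 1 ∧ ∃ a : K, Polynomial.aeval a l = 0 ∧
        IsBasePoint Q (extVec K u + a • extVec K w) ∧
        ContainsLine Q H (extVec K u + a • extVec K w) := by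
    intro H s hH hd hs hHs
    obtain ⟨hn, a, ha⟩ := h.line_degree_eq_one huw hu hw hQw hH hs hHs hR hl hne hdeg hc hlead hd
    exact ⟨hn, a, (hroot s a hs ha).2, (hroot s a hs ha).1,
      h.containsLine_of_parallel hs.1 hHs ha⟩
  obtain rfl | rfl : n = 2 ∨ n = 1 := by omega
  -- Degree two: three coefficient vectors of `R` leave room for a plane, and an exceptional line in
  -- it would force degree one.
  · obtain ⟨H, hH, hH0⟩ := exists_ne_zero_forall_dotProduct_eq_zero (by norm_num)
      fun (j : Fin (2 + 1)) i => (R i).coeff j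
    have hd := h.linForm_dvd_sectionForm hΛ huw hu hw hR (sum_C_mul_eq_zero_of_coeff hdeg hH0)
    exact ⟨H, hH, hd, fun s hs hHs => absurd (hbad hH hd hs hHs).1 (by norm_num)⟩
  -- Degree one: a pencil of planes contains the strict transform. If every member contained an
  -- exceptional line, three members would give three different roots of the quadratic polynomial
  -- `l`.
  · by_contra! hcon
    have hsec : ∀ {H : Fin 4 → k}, linForm Λ ∣ sectionForm Q H →
        aeval (extVec K w) (sectionForm Q H) = 0 := by
      rintro H ⟨q, hq⟩
      rw [hq, map_mul, aeval_linForm, extVec_dotProduct, hw, map_zero, zero_mul]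
    have hall : ∀ {H : Fin 4 → k}, H ≠ 0 → linForm Λ ∣ sectionForm Q H →
        ∃ a : K, a ∈ l.aroots K ∧ IsBasePoint Q (extVec K u + a • extVec K w) ∧
        ContainsLine Q H (extVec K u + a • extVec K w) := by
      intro H hH hd
      obtain ⟨s, hs, hHs⟩ := hcon H hH hd
      obtain ⟨-, a, h1, h2⟩ := hbad hH hd hs hHs
      exact ⟨a, (Polynomial.mem_aroots.2 ⟨hl, h1⟩), h2⟩
    have huniq : ∀ {H H' : Fin 4 → k} {a : K}, linForm Λ ∣ sectionForm Q H →
        linForm Λ ∣ sectionForm Q H' → IsBasePoint Q (extVec K u + a • extVec K w) →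
        ContainsLine Q H (extVec K u + a • extVec K w) →
        ContainsLine Q H' (extVec K u + a • extVec K w) → Parallel H H' := by
      intro H H' a hd hd' hb h1 h2
      refine h.parallel_planes_of_containsLine hb (y := extVec K w) ?_ h1 h2 (hsec hd) (hsec hd')
      rw [evalVec_extVec]
      exact fun h0 => hQw (extVec_eq_zero.1 h0)
    obtain ⟨H₁, hH₁, h₁⟩ := exists_ne_zero_forall_dotProduct_eq_zero (by norm_num)
      fun (j : Fin (1 + 1)) i => (R i).coeff j
    obtain ⟨i₀, hi₀⟩ := Function.ne_iff.1 hH₁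
    -- The extra condition `H₂ i₀ = 0`, at an index where `H₁` is nonzero, makes the two planes
    -- different. With `H₁ + H₂` there are three members of the pencil over any field.
    obtain ⟨H₂, hH₂, h₂⟩ := exists_ne_zero_forall_dotProduct_eq_zero (by norm_num : 3 < 4)
      (Fin.snoc (fun (j : Fin 2) i => (R i).coeff j) (Pi.single i₀ (1 : k)))
    have hi₂ : H₂ i₀ = 0 := by
      have := h₂ (Fin.last 2)
      rwa [Fin.snoc_last, dotProduct_single, mul_one] at this
    have h₂' : ∀ j : Fin (1 + 1), H₂ ⬝ᵥ (fun i => (R i).coeff j) = 0 := fun j => by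
      have := h₂ (Fin.castSucc j)
      rwa [Fin.snoc_castSucc] at this
    have hd₁ := h.linForm_dvd_sectionForm hΛ huw hu hw hR (sum_C_mul_eq_zero_of_coeff hdeg h₁)
    have hd₂ := h.linForm_dvd_sectionForm hΛ huw hu hw hR (sum_C_mul_eq_zero_of_coeff hdeg h₂')
    have hd₃ : linForm Λ ∣ sectionForm Q (H₁ + H₂) := by
      rw [sectionForm_add]
      exact dvd_add hd₁ hd₂
    have hp₁₂ : ¬ Parallel H₁ H₂ := fun hp => hH₂ (funext fun j => by
      have := hp i₀ j
      rw [hi₂, mul_comm, mul_comm (H₁ j), zero_mul] at this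
      exact (mul_eq_zero.1 this).resolve_right hi₀)
    have hH₃ : H₁ + H₂ ≠ 0 := fun h0 => hp₁₂ (by
      rw [eq_neg_of_add_eq_zero_left h0]
      intro i j
      simp only [Pi.neg_apply]
      ring)
    obtain ⟨a₁, ha₁, hb₁, hc₁⟩ := hall hH₁ hd₁
    obtain ⟨a₂, ha₂, hb₂, hc₂⟩ := hall hH₂ hd₂
    obtain ⟨a₃, ha₃, hb₃, hc₃⟩ := hall hH₃ hd₃
    have h12 : a₁ ≠ a₂ := by
      rintro rfl
      exact hp₁₂ (huniq hd₁ hd₂ hb₁ hc₁ hc₂)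
    have h13 : a₁ ≠ a₃ := by
      rintro rfl
      exact hp₁₂ fun i j => by
        have := huniq hd₁ hd₃ hb₁ hc₁ hc₃ i j
        simp only [Pi.add_apply] at this
        linear_combination this
    have h23 : a₂ ≠ a₃ := by
      rintro rfl
      exact hp₁₂ fun i j => by
        have := huniq hd₂ hd₃ hb₂ hc₂ hc₃ i j
        simp only [Pi.add_apply] at this
        linear_combination -this
    classical
    have hcard : ({a₁, a₂, a₃} : Finset K).card ≤ 2 := by
      have hsub : ({a₁, a₂, a₃} : Finset K).val ≤ l.aroots K := by
        rw [Multiset.le_iff_subset (Finset.nodup _)]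
        intro a ha
        simp only [Finset.mem_val, Finset.mem_insert, Finset.mem_singleton] at ha
        rcases ha with rfl | rfl | rfl <;> assumption
      refine (Multiset.card_le_card hsub).trans ((Polynomial.card_roots' _).trans ?_)
      rw [Polynomial.natDegree_map]
      omega
    rw [Finset.card_eq_three.2 ⟨a₁, a₂, a₃, h12, h13, h23, rfl⟩] at hcard
    omega

end RationalPlaneModel

/-! ### Obstructed triples of points. -/

namespace RationalPlaneModel

variable {k K : Type*} [Field k] [Field K] [Algebra k K] {F : MvPolynomial (Fin 4) k}
  {Q : Fin 4 → MvPolynomial (Fin 3) k} {π : (Fin 4 → K) → (Fin 3 → K)}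

/-- A plane section through the exceptional line above `s` meets the line `Λ` exactly in
`u`, `w`, `z`. -/
def IsObstructed {k : Type*} (K : Type*) [Field k] [Field K] [Algebra k K]
    (Q : Fin 4 → MvPolynomial (Fin 3) k) (s Λ u w z : Fin 3 → k) : Prop :=
  ∃ (H : Fin 4 → k) (τ : k), H ≠ 0 ∧ τ ≠ 0 ∧ Contact Q Λ H τ u w z ∧
    ContainsLine Q H (extVec K s)

theorem eq_zero_of_parallel_sectionForm {H H' : Fin 4 → k} (hH : H ≠ 0) (hp : Parallel H' H)
    {t : Fin 3 → k} (h0 : aeval t (sectionForm Q H) = 0) : aeval t (sectionForm Q H') = 0 := by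
  obtain ⟨c, rfl⟩ := hp.exists_smul hH
  rw [sectionForm_smul, map_mul, h0, mul_zero]

theorem _root_.Contact.aeval_of_mem {Λ : Fin 3 → k} {H : Fin 4 → k} {τ : k}
    {u w z v : Fin 3 → k} (hc : Contact Q Λ H τ u w z) (hv : Λ ⬝ᵥ v = 0)
    (h : v = u ∨ v = w ∨ v = z) : aeval v (sectionForm Q H) = 0 := by
  rcases h with rfl | rfl | rfl
  exacts [hc.aeval_fst hv, hc.symm_left.aeval_fst hv, hc.rotate.aeval_fst hv]

variable [IsAlgClosed K]

/-- The plane obstructing a triple of points is determined by each of the three points. -/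
theorem IsObstructed.parallel_of_mem (h : RationalPlaneModel F Q π)
    {s Λ u w z u' w' z' v t : Fin 3 → k} (hb : IsObstructed K Q s Λ u w z)
    (hb' : IsObstructed K Q s Λ u' w' z') (hs : IsBasePoint Q (extVec K s)) (hu : Λ ⬝ᵥ u = 0)
    (hw : Λ ⬝ᵥ w = 0) (hz : Λ ⬝ᵥ z = 0) (hv : Λ ⬝ᵥ v = 0) (hQv : evalVec Q v ≠ 0)
    (h1 : v = u ∨ v = w ∨ v = z) (h2 : v = u' ∨ v = w' ∨ v = z') (ht : Λ ⬝ᵥ t = 0)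
    (h3 : t = u' ∨ t = w' ∨ t = z') : Parallel t u ∨ Parallel t w ∨ Parallel t z := by
  obtain ⟨H, τ, hH, hτ, hct, hHs⟩ := hb
  obtain ⟨H', τ', hH', hτ', hct', hHs'⟩ := hb'
  -- Both planes contain the exceptional line above `s` and the point of the surface above `v`.
  have hp : Parallel H H' := h.parallel_planes_of_containsLine hs (y := extVec K v)
    (by rw [evalVec_extVec]; exact fun h0 => hQv (extVec_eq_zero.1 h0)) hHs hHs'
    (by rw [aeval_extVec, hct.aeval_of_mem hv h1, map_zero])
    (by rw [aeval_extVec, hct'.aeval_of_mem hv h2, map_zero])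
  exact hct.aeval_eq_zero_iff hτ ht hu hw hz
    (eq_zero_of_parallel_sectionForm hH' hp (hct'.aeval_of_mem ht h3))

omit [IsAlgClosed K] in
/-- An obstructing plane with a double contact at `x` is the tangent plane, if `x` lies on a line
through `s` and a second base point. -/
theorem dirDeriv_eq_zero_of_contact (h : RationalPlaneModel F Q π) {s r x z Λ Λ₁ : Fin 3 → k}
    {H : Fin 4 → k} {τ : k} (hs : IsBasePoint Q (extVec K s)) (hr : IsBasePoint Q (extVec K r))
    (hsr : ¬ Parallel s r) (hΛ₁ : Λ₁ ≠ 0) (hs₁ : Λ₁ ⬝ᵥ s = 0) (hr₁ : Λ₁ ⬝ᵥ r = 0)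
    (hx₁ : Λ₁ ⬝ᵥ x = 0) (hx0 : x ≠ 0) (hQx : evalVec Q x ≠ 0) (hx : Λ ⬝ᵥ x = 0)
    (hΛs : Λ ⬝ᵥ s ≠ 0) (hc : Contact Q Λ H τ x x z) (hHs : ContainsLine Q H (extVec K s))
    (v : Fin 3 → k) : dirDeriv (sectionForm Q H) x v = 0 := by
  have hs0 : s ≠ 0 := fun h0 => hs.1 (extVec_eq_zero.2 h0)
  have hsx : ¬ Parallel s x := fun hp => by
    obtain ⟨c, rfl⟩ := hp.exists_smul hx0
    rw [dotProduct_smul, hx, smul_zero] at hΛs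
    exact hΛs rfl
  obtain ⟨α, β, hαβ⟩ := exists_eq_smul_add_smul_of_dotProduct hΛ₁ hsx hs₁ hx₁ hr₁
  have hα : α ≠ 0 := by
    rintro rfl
    rw [zero_smul, zero_add] at hαβ
    refine not_isBasePoint_extVec hQx (h.isBasePoint_of_parallel hr
      (fun h0 => hx0 (extVec_eq_zero.1 h0)) (parallel_extVec.2 ?_))
    rw [hαβ]
    exact ((Parallel.refl _).smul_left _).symm
  have hβ : β ≠ 0 := by
    rintro rfl
    rw [zero_smul, add_zero] at hαβ
    rw [hαβ] at hsr
    exact hsr ((Parallel.refl _).smul_left _).symm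
  have hg := hc.aeval_fst hx
  -- On the line through `s` and `r` the section has a double zero at `s` and zeros at `x` and `r`,
  -- too many for a nonzero binary cubic.
  have hds : dirDeriv (sectionForm Q H) x s = 0 := by
    apply (algebraMap k K).injective
    rw [map_zero, ← dirDeriv_extVec]
    refine h.dirDeriv_eq_zero_of_containsLine hs (by rw [aeval_extVec, hg, map_zero]) ?_
      (α := algebraMap k K α) (β := algebraMap k K β) (by rwa [map_ne_zero]) (by rwa [map_ne_zero])
      ?_
    · rw [dirDeriv_sectionForm]
      exact hHs _
    · rwa [← extVec_smul, ← extVec_smul, ← extVec_add, ← hαβ]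
  -- Every direction is a combination of `s` and a direction along `Λ`, where the double contact at
  -- `x` applies.
  have hv : Λ ⬝ᵥ ((Λ ⬝ᵥ s) • v - (Λ ⬝ᵥ v) • s) = 0 := by
    rw [dotProduct_sub, dotProduct_smul, dotProduct_smul]
    simp only [smul_eq_mul]
    ring
  have h1 := hc.dirDeriv_eq_zero hx hv
  rw [sub_eq_add_neg, ← neg_smul, dirDeriv_add, MvPolynomial.dirDeriv_smul,
    MvPolynomial.dirDeriv_smul, hds, mul_zero, add_zero] at h1
  exact (mul_eq_zero.1 h1).resolve_left hΛs

theorem parallel_gradient_sectionForm (h : RationalPlaneModel F Q π) {x : Fin 3 → k}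
    {H : Fin 4 → k} (hQx : evalVec Q x ≠ 0) (hx : aeval x (sectionForm Q H) = 0)
    (hv : ∀ v, dirDeriv (sectionForm Q H) x v = 0) :
    Parallel (fun i => aeval (evalVec Q x) (pderiv i F)) H := by
  classical
  have hQx' : evalVec (fun i => map (algebraMap k K) (Q i)) (extVec K x)
      = extVec K (evalVec Q x) := by rw [evalVec_map, evalVec_extVec]
  have h1 := h.model.toInverseData.parallel_gradient (y := extVec K x) (H := extVec K H)
    (by rw [hQx']; exact fun h0 => hQx (extVec_eq_zero.1 h0))
    (by rw [evalVec_map, ← aeval_sectionForm, aeval_extVec, hx, map_zero]) (fun t => by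
      rw [dirVec_map, ← dirDeriv_sectionForm, dirDeriv]
      refine Finset.sum_eq_zero fun i _ => ?_
      have := hv (Pi.single i 1)
      simp only [dirDeriv, Pi.single_apply, mul_ite, mul_one, mul_zero, Finset.sum_ite_eq',
        Finset.mem_univ, if_true] at this
      rw [aeval_extVec, this, map_zero, zero_mul])
  rw [hQx'] at h1
  rw [← parallel_extVec (K := K)]
  convert h1 using 2 with i
  rw [pderiv_map, aeval_map_algebraMap, aeval_extVec]
  rfl

/-- Both obstructing planes would be the tangent plane at the point above `x`. That plane would
contain the two disjoint exceptional lines. -/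
theorem not_isObstructed_both (h : RationalPlaneModel F Q π) {s r x z z' Λ Λ' Λ₁ : Fin 3 → k}
    (hs : IsBasePoint Q (extVec K s)) (hr : IsBasePoint Q (extVec K r))
    (hsr : ¬ Parallel s r) (hΛ₁ : Λ₁ ≠ 0) (hs₁ : Λ₁ ⬝ᵥ s = 0) (hr₁ : Λ₁ ⬝ᵥ r = 0)
    (hx₁ : Λ₁ ⬝ᵥ x = 0) (hx0 : x ≠ 0) (hQx : evalVec Q x ≠ 0) (hx : Λ ⬝ᵥ x = 0)
    (hΛs : Λ ⬝ᵥ s ≠ 0) (hx' : Λ' ⬝ᵥ x = 0) (hΛr : Λ' ⬝ᵥ r ≠ 0)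
    (hb : IsObstructed K Q s Λ x x z) (hb' : IsObstructed K Q r Λ' x x z') : False := by
  obtain ⟨H, τ, hH, hτ, hct, hHs⟩ := hb
  obtain ⟨H', τ', hH', hτ', hct', hHr⟩ := hb'
  have h1 := h.parallel_gradient_sectionForm hQx (hct.aeval_fst hx)
    (h.dirDeriv_eq_zero_of_contact hs hr hsr hΛ₁ hs₁ hr₁ hx₁ hx0 hQx hx hΛs hct hHs)
  have h2 := h.parallel_gradient_sectionForm hQx (hct'.aeval_fst hx')
    (h.dirDeriv_eq_zero_of_contact hr hs (fun hp => hsr hp.symm) hΛ₁ hr₁ hs₁ hx₁ hx0 hQx hx'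
      hΛr hct' hHr)
  have hgrad : (fun i => aeval (evalVec Q x) (pderiv i F)) ≠ 0 := by
    intro h0
    obtain ⟨i, hi⟩ := h.model.smooth (extVec K (evalVec Q x))
      (fun h0 => hQx (extVec_eq_zero.1 h0)) (by
        have := h.model.toInverseData.evalVec_mem (extVec K x)
        rwa [evalVec_map, evalVec_extVec] at this)
    apply hi
    rw [pderiv_map, aeval_map_algebraMap, aeval_extVec, show aeval _ _ = (0 : k) from congrFun h0 i,
      map_zero]
  obtain ⟨c, rfl⟩ := (h1.symm.trans hgrad h2).exists_smul hH'
  have hc : c ≠ 0 := fun h0 => hH (by rw [h0, zero_smul])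
  refine hsr (parallel_extVec.1 (h.parallel_of_containsLine hs hr hH' (fun t => ?_) hHr))
  have := hHs t
  rw [extVec_smul, smul_dotProduct, smul_eq_mul, mul_eq_zero] at this
  exact this.resolve_left (by rwa [map_eq_zero])

variable [Algebra.IsAlgebraic k K]

/-- The obstructing section is singular at `x` and vanishes at the base points `p` and `q`, so it
contains the line `Λ₂` through them. Since it also contains the exceptional line above `s`, the
point `s` would lie on `Λ₂`. -/
theorem not_isObstructed_of_two_lines (h : RationalPlaneModel F Q π)
    {s r p q x z Λ Λ₁ Λ₂ : Fin 3 → k}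
    (hs : IsBasePoint Q (extVec K s)) (hr : IsBasePoint Q (extVec K r))
    (hsr : ¬ Parallel s r) (hΛ₁ : Λ₁ ≠ 0) (hs₁ : Λ₁ ⬝ᵥ s = 0) (hr₁ : Λ₁ ⬝ᵥ r = 0)
    (hx₁ : Λ₁ ⬝ᵥ x = 0) (hx0 : x ≠ 0) (hQx : evalVec Q x ≠ 0) (hx : Λ ⬝ᵥ x = 0)
    (hΛs : Λ ⬝ᵥ s ≠ 0) (hp : IsBasePoint Q (extVec K p)) (hq : IsBasePoint Q (extVec K q))
    (hpq : ¬ Parallel p q) (hΛ₂ : Λ₂ ≠ 0) (hp₂ : Λ₂ ⬝ᵥ p = 0) (hq₂ : Λ₂ ⬝ᵥ q = 0)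
    (hx₂ : Λ₂ ⬝ᵥ x = 0) (hs₂ : Λ₂ ⬝ᵥ s ≠ 0) (hb : IsObstructed K Q s Λ x x z) : False := by
  obtain ⟨H, τ, hH, hτ, hct, hHs⟩ := hb
  have hd := h.dirDeriv_eq_zero_of_contact hs hr hsr hΛ₁ hs₁ hr₁ hx₁ hx0 hQx hx hΛs hct hHs
  have hg := isHomogeneous_sectionForm h.homogeneous H
  have hbase : ∀ {y : Fin 3 → k}, IsBasePoint Q (extVec K y) → evalVec Q y = 0 := fun hy => by
    have := hy.2
    rwa [evalVec_extVec, extVec_eq_zero] at this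
  have hgb : ∀ {y : Fin 3 → k}, IsBasePoint Q (extVec K y) → aeval y (sectionForm Q H) = 0 := fun hy => by
    rw [aeval_sectionForm, hbase hy, dotProduct_zero]
  obtain ⟨α, β, rfl⟩ := exists_eq_smul_add_smul_of_dotProduct hΛ₂ hpq hp₂ hq₂ hx₂
  have hpar : ∀ {y y' : Fin 3 → k} {c : k}, y = c • y' → IsBasePoint Q (extVec K y') →
      evalVec Q y = 0 := by
    rintro y y' c rfl hy
    funext i
    have h1 : aeval y' (Q i) = 0 := congrFun (hbase hy) i
    simp only [aeval_smul_of_isHomogeneous (h.homogeneous i), Pi.zero_apply, h1, mul_zero]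
  have hα : α ≠ 0 := by
    rintro rfl
    exact hQx (hpar (by rw [zero_smul, zero_add]) hq)
  have hβ : β ≠ 0 := by
    rintro rfl
    exact hQx (hpar (by rw [zero_smul, add_zero]) hp)
  have h1 := hct.aeval_fst hx
  rw [aeval_smul_add_smul hg, hgb hp, hgb hq] at h1
  have h2 := hd q
  rw [dirDeriv_smul_add_smul hg, hgb hq] at h2
  have h3 : dirDeriv (sectionForm Q H) q p = 0 := by
    refine (mul_eq_zero.1 (?_ : (α * β * β) * _ = 0)).resolve_left
      (mul_ne_zero (mul_ne_zero hα hβ) hβ)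
    linear_combination β * h2 - h1
  have h4 : dirDeriv (sectionForm Q H) p q = 0 := by
    rw [h3] at h1
    refine (mul_eq_zero.1 (?_ : (α ^ 2 * β) * _ = 0)).resolve_left
      (mul_ne_zero (pow_ne_zero 2 hα) hβ)
    linear_combination h1
  have hdvd : linForm Λ₂ ∣ sectionForm Q H := by
    refine linForm_dvd_of_aeval_lineParam hg hΛ₂ hpq hp₂ hq₂ ?_
    rw [aeval_lineParam hg, hgb hp, hgb hq, h3, h4]
    simp
  have := h.not_containsLine_of_dvd hQx hx0 hx₂ hH hdvd hs hHs
  rw [extVec_dotProduct, map_eq_zero] at this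
  exact hs₂ this

end RationalPlaneModel

-- Rationality of a base point whose exceptional line lies in a rational plane.

universe u

/-- Derivations of `E` are the linear functionals on its module of differentials, and over a field
functionals separate vectors. -/
theorem Algebra.FormallyUnramified.of_derivation_eq_zero {k E : Type*} [Field k] [Field E]
    [Algebra k E] (h : ∀ D : Derivation k E E, D = 0) : Algebra.FormallyUnramified k E := by
  refine ⟨⟨fun a b => ?_⟩⟩
  rw [← sub_eq_zero, ← Module.forall_dual_apply_eq_zero_iff E]
  intro φ
  have h1 : KaehlerDifferential.linearMapEquivDerivation k E φ = 0 := h _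
  rw [(LinearEquiv.map_eq_zero_iff _).1 h1, LinearMap.zero_apply]

namespace RationalPlaneModel

theorem dirDeriv_eq_sum_pderiv {k A σ : Type*} [Fintype σ] [DecidableEq σ] [CommRing k]
    [CommRing A] [Algebra k A] (G : MvPolynomial σ k) (v : σ → A) (j : σ) :
    dirDeriv G v (Pi.single j 1) = aeval v (pderiv j G) := by
  simp [dirDeriv, Pi.single_apply]

/-- Containing the exceptional line amounts to polynomial equations over `k` for the base point, so
it is preserved by `k`-embeddings. -/
theorem containsLine_iff {k K : Type*} [Field k] [Field K] [Algebra k K]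
    {Q : Fin 4 → MvPolynomial (Fin 3) k} {H : Fin 4 → k} {s : Fin 3 → K} :
    ContainsLine Q H s ↔ ∀ j, aeval s (pderiv j (sectionForm Q H)) = 0 := by
  simp only [ContainsLine, ← dirDeriv_sectionForm]
  refine ⟨fun h j => by rw [← dirDeriv_eq_sum_pderiv]; exact h _, fun h t => ?_⟩
  rw [dirDeriv]
  exact Finset.sum_eq_zero fun j _ => by rw [h, zero_mul]

variable {k K : Type u} [Field k] [Field K] [Algebra k K] {F : MvPolynomial (Fin 4) k}
  {Q : Fin 4 → MvPolynomial (Fin 3) k} {π : (Fin 4 → K) → (Fin 3 → K)} [IsAlgClosed K]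
  [Algebra.IsAlgebraic k K]

/-- A base point whose exceptional line lies in a plane over `k` is defined over `k`. -/
theorem exists_parallel_extVec (h : RationalPlaneModel F Q π) {s : Fin 3 → K}
    (hs : IsBasePoint Q s) {H : Fin 4 → k} (hH : H ≠ 0) (hHs : ContainsLine Q H s) :
    ∃ s' : Fin 3 → k, s' ≠ 0 ∧ Parallel (extVec K s') s := by
  obtain ⟨c, hc⟩ := Function.ne_iff.1 hs.1
  -- With one coordinate equal to `1`, the remaining coordinates generate the field of definition of
  -- the base point.
  set σ : Fin 3 → K := (s c)⁻¹ • s with hσ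
  have hσs : Parallel σ s := (Parallel.refl s).smul_left _
  have hσc : σ c = 1 := by simp [hσ, inv_mul_cancel₀ hc]
  have hσ0 : σ ≠ 0 := fun h0 => by simp [h0] at hσc
  have hσb := h.isBasePoint_of_parallel hs hσ0 hσs
  have hHσ := h.containsLine_of_parallel hs.1 hHs hσs
  let E := IntermediateField.adjoin k (Set.range σ)
  have : FiniteDimensional k E := IntermediateField.finiteDimensional_adjoin
    fun x _ => (Algebra.IsAlgebraic.isAlgebraic x).isIntegral
  let τ : Fin 3 → E := fun i => ⟨σ i, IntermediateField.subset_adjoin k _ ⟨i, rfl⟩⟩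
  have hτval : ∀ G : MvPolynomial (Fin 3) k, ((aeval τ G : E) : K) = aeval σ G := fun G =>
    comp_aeval_apply (φ := E.val) τ G
  have hgen : ∀ x : E, ∃ G : MvPolynomial (Fin 3) k, x = aeval τ G := by
    rintro ⟨x, hx⟩
    rw [← IntermediateField.mem_toSubalgebra, IntermediateField.adjoin_toSubalgebra_of_isAlgebraic
      fun x _ => Algebra.IsAlgebraic.isAlgebraic x, Algebra.adjoin_range_eq_range_aeval] at hx
    obtain ⟨G, rfl⟩ := hx
    exact ⟨G, Subtype.ext (hτval G).symm⟩
  -- A derivation applied to the equations of the base point gives a vector in the kernel of the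
  -- differential, hence a multiple of `σ`. Its coordinate at `c` is the derivative of `1`, so the
  -- derivation kills all generators and `E` is separable.
  have hunram : Algebra.FormallyUnramified k E := by
    refine .of_derivation_eq_zero fun D => ?_
    have hD : ∀ i, D (τ i) = 0 := by
      have h1 : dirVec Q σ (fun i => (D (τ i) : K)) = 0 := by
        funext i
        have h2 := derivation_aeval D (Q i) τ
        have h3 : aeval τ (Q i) = 0 := Subtype.ext ((hτval _).trans (congrFun hσb.2 i))
        rw [h3, map_zero] at h2
        have h4 := map_dirDeriv E.val (Q i) τ (fun i => D (τ i))
        simp only [smul_eq_mul] at h2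
        rw [dirDeriv, ← h2, map_zero] at h4
        exact h4.symm
      have h2 := h.parallel_of_dirVec_eq_zero hσb h1
      intro i
      have h3 : σ c * (D (τ i) : K) = σ i * (D (τ c) : K) := h2 c i
      have h4 : D (τ c) = 0 := by
        have : τ c = 1 := Subtype.ext hσc
        rw [this, Derivation.map_one_eq_zero]
      rw [h4, hσc, one_mul] at h3
      exact Subtype.ext (h3.trans (by simp))
    ext x
    obtain ⟨G, rfl⟩ := hgen x
    rw [derivation_aeval, Finset.sum_eq_zero fun i _ => by rw [hD, smul_zero]]
    rfl
  have hsep : Algebra.IsSeparable k E := (Algebra.FormallyUnramified.iff_isSeparable k E).1 hunram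
  -- The conjugate base point also has its exceptional line in the plane `H`, and two exceptional
  -- lines in one plane coincide.
  have huniq : ∀ φ : E →ₐ[k] K, φ = E.val := by
    intro φ
    have hφ : ∀ G : MvPolynomial (Fin 3) k, aeval (fun i => φ (τ i)) G = φ (aeval τ G) := fun G =>
      (comp_aeval_apply (φ := φ) τ G).symm
    have h1 : φ (τ c) = 1 := by
      have : τ c = 1 := Subtype.ext hσc
      rw [this, map_one]
    have hb : IsBasePoint Q fun i => φ (τ i) := by
      refine ⟨fun h0 => by simp [congrFun h0 c] at h1, funext fun i => ?_⟩
      have h3 : aeval τ (Q i) = 0 := Subtype.ext ((hτval _).trans (congrFun hσb.2 i))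
      exact (hφ (Q i)).trans (by rw [h3, map_zero, Pi.zero_apply])
    have hl : ContainsLine Q H fun i => φ (τ i) := by
      rw [containsLine_iff] at hHσ ⊢
      intro j
      have h3 : aeval τ (pderiv j (sectionForm Q H)) = 0 := Subtype.ext ((hτval _).trans (hHσ j))
      rw [hφ, h3, map_zero]
    have hp := h.parallel_of_containsLine hσb hb hH hHσ hl
    have hτ : ∀ i, φ (τ i) = σ i := fun i => by
      have : σ c * φ (τ i) = σ i * φ (τ c) := hp c i
      rwa [hσc, h1, one_mul, mul_one] at this
    ext x
    obtain ⟨G, rfl⟩ := hgen x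
    rw [← hφ]
    simp only [hτ]
    exact (hτval G).symm
  have hcard : Module.finrank k E = 1 := by
    rw [← Field.finSepDegree_eq_finrank_of_isSeparable, Field.finSepDegree_eq_of_isAlgClosed k E K,
      Nat.card_eq_one_iff_exists]
    exact ⟨E.val, huniq⟩
  have hbot : E = ⊥ := IntermediateField.finrank_eq_one_iff.1 hcard
  have hmem : ∀ i, ∃ a : k, algebraMap k K a = σ i := fun i =>
    IntermediateField.mem_bot.1 (hbot ▸ (τ i).2)
  choose s' hs' using hmem
  have hext : extVec K s' = σ := funext hs'
  exact ⟨s', fun h0 => hσ0 (by rw [← hext, extVec_eq_zero, h0]), by rwa [hext]⟩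

end RationalPlaneModel

/-! ### Generation in a projective plane with obstructions. -/

section combinatorics

open Configuration

variable {P L : Type*} [Membership P L] [ProjectivePlane P L]

theorem Configuration.ProjectivePlane.exists_line_through (x p : P) : ∃ m : L, x ∈ m ∧ p ∈ m := by
  by_cases h : x = p
  · subst h
    obtain ⟨q, hq⟩ : ∃ q : P, q ≠ x := by
      by_contra! hall
      obtain ⟨l, hl⟩ := Nondegenerate.exists_line (L := L) x
      obtain ⟨a, b, c, l₁, l₂, l₃, h1, h2, h3, h4, h5, h6, h7, h8⟩ :=
        ProjectivePlane.exists_config (P := P) (L := L)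
      simp only [hall a, hall b, hall c] at *
      contradiction
    exact ⟨_, (HasLines.mkLine_ax (L := L) hq).2, (HasLines.mkLine_ax (L := L) hq).2⟩
  · exact ⟨_, HasLines.mkLine_ax h⟩

theorem Configuration.ProjectivePlane.exists_point_on (m n : L) (h : m ≠ n) :
    ∃ r : P, r ∈ m ∧ r ∈ n := ⟨_, HasPoints.mkPoint_ax h⟩

/-- Generation of the complement of a set `S` in a projective plane. On a line in the set `M`, every
point of the complement is reached from any other. On a line outside of `M`, three points are
related unless they form an obstructed triple. -/
theorem Configuration.ProjectivePlane.mem_of_obstructions (S : Set P) (M : Set L)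
    (Obs : P → L → P → P → P → Prop) (G : Set P)
    (third : ∀ (l : L) (x z : P), ∃ t ∈ l, t ≠ x ∧ t ≠ z)
    (hS : ∀ l : L, ∀ p ∈ S, ∀ q ∈ S, ∀ r ∈ S, p ∈ l → q ∈ l → r ∈ l → p = q ∨ p = r ∨ q = r)
    (hM : ∀ l : L, ∀ s ∈ S, s ∈ l → l ∈ M)
    (hstep : ∀ l ∈ M, ∀ u ∈ l, u ∈ G → ∀ z ∈ l, z ∉ S → z ∈ G)
    (hstep' : ∀ l ∉ M, ∀ u ∈ l, ∀ w ∈ l, ∀ z ∈ l, u ∈ G → w ∈ G →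
      (∀ s ∈ S, ¬ Obs s l u w z) → z ∈ G)
    (hobs : ∀ s ∈ S, ∀ l ∉ M, ∀ u ∈ l, ∀ w ∈ l, ∀ z ∈ l, ∀ u' ∈ l, ∀ w' ∈ l, ∀ z' ∈ l,
      Obs s l u w z → Obs s l u' w' z' → ∀ v ∈ ({u, w, z} : Set P), v ∈ ({u', w', z'} : Set P) →
      ({u', w', z'} : Set P) ⊆ {u, w, z})
    (hboth : ∀ s ∈ S, ∀ r ∈ S, s ≠ r → ∀ x z t : P, ∀ m l : L, s ∈ m → r ∈ m → x ∈ m → l ∉ M →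
      x ∈ l → Obs s l x x z → Obs r l x x t → False)
    (htwo : ∀ s ∈ S, ∀ r ∈ S, s ≠ r → ∀ p ∈ S, ∀ q ∈ S, p ≠ q → ∀ x z : P, ∀ l m m' : L,
      s ∈ m → r ∈ m → x ∈ m → p ∈ m' → q ∈ m' → x ∈ m' → s ∉ m' → l ∉ M → x ∈ l →
      Obs s l x x z → False)
    {x z : P} (hx : x ∈ G) (hz : z ∉ S) : z ∈ G := by
  by_contra hzG
  obtain ⟨l, hxl, hzl⟩ := exists_line_through (L := L) x z
  have hxz : x ≠ z := by
    rintro rfl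
    exact hzG hx
  have hlM : l ∉ M := fun h => hzG (hstep l h x hxl hx z hzl hz)
  have hlS : ∀ s ∈ S, s ∉ l := fun s hs hsl => hlM (hM l s hs hsl)
  -- If a line joining `x` to `S` met a line joining `y` to `S` outside of `S`, then `y` would be
  -- reached from `x` through the intersection.
  have hmeet : ∀ y, y ∉ S → y ∉ G → ∀ p ∈ S, ∀ q ∈ S, ∀ m n : L, x ∈ m → p ∈ m → y ∈ n → q ∈ n →
      ∀ r, r ∈ m → r ∈ n → r ∈ S := by
    intro y hy hyG p hp q hq m n hxm hpm hyn hqn r hrm hrn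
    by_contra hr
    exact hyG (hstep n (hM n q hq hqn) r hrn (hstep m (hM m p hp hpm) x hxm hx r hrm hr) y hyn hy)
  have hunique : ∀ {a b : P} {m n : L}, a ≠ b → a ∈ m → b ∈ m → a ∈ n → b ∈ n → m = n :=
    fun hab h1 h2 h3 h4 => (Nondegenerate.eq_or_eq h1 h2 h3 h4).resolve_left hab
  obtain ⟨p₁, hp₁, hobs₁⟩ : ∃ s ∈ S, Obs s l x x z := by
    by_contra! h
    exact hzG (hstep' l hlM x hxl x hxl z hzl hx hx h)
  have hne : ∀ p ∈ S, ∀ y ∈ l, p ≠ y := fun p hp y hy h => hlS p hp (h ▸ hy)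
  -- With three points in `S`, take two lines from `x` and two from `z` to points of `S`. Their
  -- intersections lie in `S`, so `x` is on two lines that each carry two points of `S`, contrary to
  -- `htwo`.
  by_cases h3 : ∃ q ∈ S, ∃ r ∈ S, q ≠ p₁ ∧ r ≠ p₁ ∧ q ≠ r
  · obtain ⟨q₀, hq₀, r₀, hr₀, h1, h2, h3⟩ := h3
    have hoff : ∀ m : L, p₁ ∈ m → ∃ q ∈ S, q ∉ m := by
      intro m hm
      by_contra! hall
      rcases hS m p₁ hp₁ q₀ hq₀ r₀ hr₀ hm (hall _ hq₀) (hall _ hr₀) with h | h | h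
      exacts [h1 h.symm, h2 h.symm, h3 h]
    obtain ⟨m₁, hxm₁, hpm₁⟩ := exists_line_through (L := L) x p₁
    obtain ⟨n₁, hzn₁, hpn₁⟩ := exists_line_through (L := L) z p₁
    obtain ⟨q, hq, hqm₁⟩ := hoff m₁ hpm₁
    obtain ⟨q', hq', hqn₁⟩ := hoff n₁ hpn₁
    obtain ⟨m₂, hxm₂, hqm₂⟩ := exists_line_through (L := L) x q
    obtain ⟨n₂, hzn₂, hqn₂⟩ := exists_line_through (L := L) z q'
    have hmn : ∀ {m n : L}, x ∈ m → z ∈ n → ∀ s ∈ S, s ∈ n → m ≠ n := by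
      rintro m n hm hn s hs hsn rfl
      exact hlS s hs (hunique hxz hm hn hxl hzl ▸ hsn)
    obtain ⟨r, hr, hr'⟩ := exists_point_on (P := P) m₂ n₁ (hmn hxm₂ hzn₁ p₁ hp₁ hpn₁)
    obtain ⟨r₁, hr₁, hr₁'⟩ := exists_point_on (P := P) m₁ n₂ (hmn hxm₁ hzn₂ q' hq' hqn₂)
    obtain ⟨r₂, hr₂, hr₂'⟩ := exists_point_on (P := P) m₂ n₂ (hmn hxm₂ hzn₂ q' hq' hqn₂)
    have hrS := hmeet z hz hzG q hq p₁ hp₁ m₂ n₁ hxm₂ hqm₂ hzn₁ hpn₁ r hr hr'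
    have hr₁S := hmeet z hz hzG p₁ hp₁ q' hq' m₁ n₂ hxm₁ hpm₁ hzn₂ hqn₂ r₁ hr₁ hr₁'
    have hr₂S := hmeet z hz hzG q hq q' hq' m₂ n₂ hxm₂ hqm₂ hzn₂ hqn₂ r₂ hr₂ hr₂'
    have hnn : ∀ s ∈ S, s ∈ n₁ → s ∉ n₂ := by
      intro s hs h1 h2
      exact hqn₁ (hunique (hne s hs z hzl) h2 hzn₂ h1 hzn₁ ▸ hqn₂)
    refine htwo p₁ hp₁ r₁ hr₁S ?_ r hrS r₂ hr₂S ?_ x z l m₁ m₂ hpm₁ hr₁ hxm₁ hr hr₂ hxm₂ ?_ hlM hxl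
      hobs₁
    · rintro rfl
      exact hnn p₁ hp₁ hpn₁ hr₁'
    · rintro rfl
      exact hnn r hrS hr' hr₂'
    · intro h
      exact hqm₁ (hunique (hne p₁ hp₁ x hxl) h hxm₂ hpm₁ hxm₁ ▸ hqm₂)
  · push Not at h3
    obtain ⟨t, htl, htx, htz⟩ := third l x z
    have htS : t ∉ S := fun h => hlS t h htl
    have hnot : ∀ {u w y}, u ∈ l → w ∈ l → y ∈ l → Obs p₁ l u w y → t ∈ ({u, w, y} : Set P) →
        ∀ v ∈ ({x, x, z} : Set P), v ∈ ({u, w, y} : Set P) → False := by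
      intro u w y hu hw hy ho ht v hv hv'
      have := hobs p₁ hp₁ l hlM x hxl x hxl z hzl u hu w hw y hy hobs₁ ho v hv hv' ht
      simp [htx, htz] at this
    -- Otherwise `(x, x, t)` is obstructed by a second point `p₂`, and `S = {p₁, p₂}`. By `hmeet`
    -- both `z` and `t` lie on the line joining these points, which would then be `l`.
    have htG : t ∈ G := by
      by_contra htG
      obtain ⟨p₂, hp₂, hobs₂⟩ : ∃ s ∈ S, Obs s l x x t := by
        by_contra! h
        exact htG (hstep' l hlM x hxl x hxl t htl hx hx h)
      have hp₁₂ : p₁ ≠ p₂ := by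
        rintro rfl
        exact hnot hxl hxl htl hobs₂ (by simp) x (by simp) (by simp)
      obtain ⟨d, hd₁, hd₂⟩ := exists_line_through (L := L) p₁ p₂
      have hxd : x ∉ d := fun hxd =>
        hboth p₁ hp₁ p₂ hp₂ hp₁₂ x z t d l hd₁ hd₂ hxd hlM hxl hobs₁ hobs₂
      have hmem : ∀ s ∈ S, s = p₁ ∨ s = p₂ := by
        intro s hs
        by_contra! h
        exact h.2 (h3 s hs p₂ hp₂ h.1 hp₁₂.symm)
      have hd : ∀ y, y ∈ l → y ≠ x → y ∉ S → y ∉ G → y ∈ d := by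
        intro y hy hyx hyS hyG
        obtain ⟨m, hxm, hpm⟩ := exists_line_through (L := L) x p₁
        obtain ⟨n, hyn, hqn⟩ := exists_line_through (L := L) y p₂
        obtain ⟨r, hrm, hrn⟩ := exists_point_on (P := P) m n (by
          rintro rfl
          exact hlS p₁ hp₁ (hunique hyx hyn hxm hy hxl ▸ hpm))
        rcases hmem r (hmeet y hyS hyG p₁ hp₁ p₂ hp₂ m n hxm hpm hyn hqn r hrm hrn) with rfl | rfl
        · exact hunique hp₁₂ hrn hqn hd₁ hd₂ ▸ hyn
        · exact absurd (hunique hp₁₂ hpm hrm hd₁ hd₂ ▸ hxm) hxd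
      have hzd := hd z hzl hxz.symm hz hzG
      have htd := hd t htl htx htS htG
      exact hlS p₁ hp₁ (hunique htz htd hzd htl hzl ▸ hd₁)
    -- Now `(x, t, z)` and `(t, t, z)` are both obstructed, neither by `p₁`, so by the same point.
    -- As they share `z`, the point `x` would be `t` or `z`.
    obtain ⟨p₂, hp₂, hobs₂⟩ : ∃ s ∈ S, Obs s l x t z := by
      by_contra! h
      exact hzG (hstep' l hlM x hxl t htl z hzl hx htG h)
    obtain ⟨p₃, hp₃, hobs₃⟩ : ∃ s ∈ S, Obs s l t t z := by
      by_contra! h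
      exact hzG (hstep' l hlM t htl t htl z hzl htG htG h)
    have h2 : p₂ ≠ p₁ := by
      rintro rfl
      exact hnot hxl htl hzl hobs₂ (by simp) x (by simp) (by simp)
    have h3' : p₃ ≠ p₁ := by
      rintro rfl
      exact hnot htl htl hzl hobs₃ (by simp) z (by simp) (by simp)
    obtain rfl := h3 p₂ hp₂ p₃ hp₃ h2 h3'
    have := hobs p₂ hp₂ l hlM t htl t htl z hzl x hxl t htl z hzl hobs₃ hobs₂ z (by simp) (by simp)
      (show x ∈ _ by simp)
    simp [hxz, htx.symm] at this

end combinatorics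

/-! ### Incidence in coordinates and generation by plane sections. -/

section projective

variable {k : Type*} [Field k]

theorem Projectivization.eq_iff_parallel {n : ℕ} {a b : ℙ k (Fin n → k)} :
    a = b ↔ Parallel a.rep b.rep := by
  constructor
  · rintro rfl
    exact Parallel.refl _
  · intro h
    obtain ⟨c, hc⟩ := h.exists_smul b.rep_nonzero
    rw [← a.mk_rep, ← b.mk_rep, Projectivization.mk_eq_mk_iff']
    exact ⟨c, hc.symm⟩

theorem Projectivization.parallel_rep_mk {n : ℕ} {v : Fin n → k} (hv : v ≠ 0) :
    Parallel (Projectivization.mk k v hv).rep v := by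
  obtain ⟨c, hc⟩ := Projectivization.exists_smul_eq_mk_rep k v hv
  rw [← hc, Units.smul_def]
  exact (Parallel.refl v).smul_left _

theorem Configuration.ofField.mem_iff_dotProduct {a l : ℙ k (Fin 3 → k)} :
    a ∈ l ↔ l.rep ⬝ᵥ a.rep = 0 := by
  rw [Configuration.ofField.mem_iff]
  conv_lhs => rw [← a.mk_rep, ← l.mk_rep]
  rw [Projectivization.orthogonal_mk, dotProduct_comm]

theorem dotProduct_eq_zero_of_parallel {n : ℕ} {Λ v w : Fin n → k} (hv : v ≠ 0) (hp : Parallel w v)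
    (h : Λ ⬝ᵥ v = 0) : Λ ⬝ᵥ w = 0 := by
  obtain ⟨c, rfl⟩ := hp.exists_smul hv
  rw [dotProduct_smul, h, smul_zero]

/-- The points `a`, `b` and `a + b` of a line are distinct over every field, so two points never
exhaust it. -/
theorem Projectivization.exists_mem_ne_ne (l x z : ℙ k (Fin 3 → k)) :
    ∃ t, l.rep ⬝ᵥ t.rep = 0 ∧ t ≠ x ∧ t ≠ z := by
  obtain ⟨a, hla, ha0⟩ : ∃ a : Fin 3 → k, l.rep ⬝ᵥ a = 0 ∧ a ≠ 0 := by
    obtain ⟨a, h1, h2⟩ := exists_dotProduct_eq_zero_not_parallel l.rep l.rep_nonzero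
    exact ⟨a, h1, by rintro rfl; exact h2 fun i j => by simp⟩
  obtain ⟨b, hlb, hba⟩ := exists_dotProduct_eq_zero_not_parallel l.rep ha0
  have hb0 : b ≠ 0 := by rintro rfl; exact hba fun i j => by simp
  have hab0 : a + b ≠ 0 := fun h0 => hba (by
    rw [eq_neg_of_add_eq_zero_right h0]
    intro i j
    simp only [Pi.neg_apply]
    ring)
  have key : ∀ {v w : Fin 3 → k} (hv : v ≠ 0) (hw : w ≠ 0),
      Projectivization.mk k v hv = Projectivization.mk k w hw → Parallel v w := by
    intro v w hv hw h
    obtain ⟨c, rfl⟩ := (Projectivization.mk_eq_mk_iff' k v w hv hw).1 h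
    exact (Parallel.refl w).smul_left _
  have hmem : ∀ {v : Fin 3 → k} (hv : v ≠ 0), l.rep ⬝ᵥ v = 0 →
      l.rep ⬝ᵥ (Projectivization.mk k v hv).rep = 0 := fun hv h =>
    dotProduct_eq_zero_of_parallel hv (Projectivization.parallel_rep_mk hv) h
  have h12 : Projectivization.mk k a ha0 ≠ Projectivization.mk k b hb0 := fun h =>
    hba (key _ _ h).symm
  have h13 : Projectivization.mk k a ha0 ≠ Projectivization.mk k (a + b) hab0 := fun h =>
    hba fun i j => by
      have := key _ _ h i j
      simp only [Pi.add_apply] at this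
      linear_combination -this
  have h23 : Projectivization.mk k b hb0 ≠ Projectivization.mk k (a + b) hab0 := fun h =>
    hba fun i j => by
      have := key _ _ h i j
      simp only [Pi.add_apply] at this
      linear_combination this
  by_contra! hall
  have h1 := hall _ (hmem ha0 hla)
  have h2 := hall _ (hmem hb0 hlb)
  have h3 := hall _ (hmem hab0 (by rw [dotProduct_add, hla, hlb, add_zero]))
  by_cases hax : Projectivization.mk k a ha0 = x
  · have hb := h2 fun h => h12 (hax.trans h.symm)
    have hc := h3 fun h => h13 (hax.trans h.symm)
    exact h23 (hb.trans hc.symm)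
  · have ha := h1 hax
    by_cases hbx : Projectivization.mk k b hb0 = x
    · exact h13 (ha.trans (h3 fun h => h23 (hbx.trans h.symm)).symm)
    · exact h12 (ha.trans (h2 hbx).symm)

end projective

namespace RationalPlaneModel

variable {k K : Type u} [Field k] [Field K] [Algebra k K] {F : MvPolynomial (Fin 4) k}
  {Q : Fin 4 → MvPolynomial (Fin 3) k} {π : (Fin 4 → K) → (Fin 3 → K)} [IsAlgClosed K]
  [Algebra.IsAlgebraic k K]

/-- Plane sections without exceptional lines generate all rational points outside of the base
locus from one of them. -/
theorem mem_of_contact (h : RationalPlaneModel F Q π) (G : Set (ℙ k (Fin 3 → k)))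
    (hG : ∀ (H : Fin 4 → k) (Λ : Fin 3 → k) (τ : k) (u w z : ℙ k (Fin 3 → k)), H ≠ 0 → Λ ≠ 0 →
      (∀ s : Fin 3 → K, IsBasePoint Q s → ¬ ContainsLine Q H s) → Λ ⬝ᵥ u.rep = 0 →
      Λ ⬝ᵥ w.rep = 0 → Λ ⬝ᵥ z.rep = 0 → evalVec Q z.rep ≠ 0 →
      Contact Q Λ H τ u.rep w.rep z.rep → u ∈ G → w ∈ G → z ∈ G)
    {x z : ℙ k (Fin 3 → k)} (hx : x ∈ G)
    (hz : evalVec Q z.rep ≠ 0) : z ∈ G := by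
  classical
  have hbase : ∀ {y : ℙ k (Fin 3 → k)}, IsBasePoint Q (extVec K y.rep) ↔ evalVec Q y.rep = 0 :=
    fun {y} => ⟨fun hy => by
      have := hy.2
      rwa [evalVec_extVec, extVec_eq_zero] at this, fun hy =>
      ⟨fun h0 => y.rep_nonzero (extVec_eq_zero.1 h0), by rw [evalVec_extVec, hy, extVec_eq_zero]⟩⟩
  have hdot : ∀ {l y : ℙ k (Fin 3 → k)}, y ∈ l ↔ l.rep ⬝ᵥ y.rep = 0 := fun {l y} =>
    Configuration.ofField.mem_iff_dotProduct
  have hpar : ∀ {y y' : ℙ k (Fin 3 → k)}, y ≠ y' → ¬ Parallel y.rep y'.rep := fun hne hp =>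
    hne (Projectivization.eq_iff_parallel.2 hp)
  have hQ : ∀ l : ℙ k (Fin 3 → k), ¬ MeetsBase K Q l.rep → ∀ y ∈ l, evalVec Q y.rep ≠ 0 :=
    fun l hl y hy h0 => hl ⟨_, hbase.2 h0, by rw [extVec_dotProduct, hdot.1 hy, map_zero]⟩
  refine Configuration.ProjectivePlane.mem_of_obstructions (L := ℙ k (Fin 3 → k))
    (P := ℙ k (Fin 3 → k)) {s : ℙ k (Fin 3 → k) | evalVec Q s.rep = 0}
    {l : ℙ k (Fin 3 → k) | MeetsBase K Q l.rep}
    (fun s l u w z : ℙ k (Fin 3 → k) => IsObstructed K Q s.rep l.rep u.rep w.rep z.rep) G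
    (fun l x z => ?_) ?_ ?_ ?_ ?_ ?_ ?_ ?_ hx (show z ∉ {s : ℙ k (Fin 3 → k) | _} from hz)
  · obtain ⟨t, h1, h2⟩ := Projectivization.exists_mem_ne_ne l x z
    exact ⟨t, hdot.2 h1, h2⟩
  · intro l p hp q hq r hr hpl hql hrl
    by_contra! hne
    obtain ⟨α, β, hαβ⟩ := exists_eq_smul_add_smul_of_dotProduct l.rep_nonzero (hpar hne.1)
      (hdot.1 hpl) (hdot.1 hql) (hdot.1 hrl)
    have hα : α ≠ 0 := by
      rintro rfl
      rw [zero_smul, zero_add] at hαβ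
      exact hpar hne.2.2 (by rw [hαβ]; exact ((Parallel.refl _).smul_left _).symm)
    have hβ : β ≠ 0 := by
      rintro rfl
      rw [zero_smul, add_zero] at hαβ
      exact hpar hne.2.1 (by rw [hαβ]; exact ((Parallel.refl _).smul_left _).symm)
    refine h.not_collinear (hbase.2 hp) (hbase.2 hq) (fun hp => hpar hne.1 (parallel_extVec.1 hp))
      (α := algebraMap k K α) (β := algebraMap k K β) (by rwa [map_ne_zero]) (by rwa [map_ne_zero])
      ?_
    rw [← extVec_smul, ← extVec_smul, ← extVec_add, ← hαβ]
    exact hbase.2 hr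
  · intro l s hs hsl
    exact ⟨_, hbase.2 hs, by rw [extVec_dotProduct, hdot.1 hsl, map_zero]⟩
  -- The section contains the line, so the scalar of the contact is `0` and any three points of the
  -- line are related.
  · intro l hl u hul huG z hzl hz
    obtain ⟨H, hH, hd, hHs⟩ := h.exists_section_of_meetsBase l.rep_nonzero hz z.rep_nonzero
      (hdot.1 hzl) hl
    obtain ⟨A, hA, hAu⟩ := exists_not_parallel_dotProduct_eq_zero l.rep_nonzero u.rep
    obtain ⟨B, hB, hBz⟩ := exists_not_parallel_dotProduct_eq_zero l.rep_nonzero z.rep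
    exact hG H l.rep 0 u u z hH l.rep_nonzero hHs (hdot.1 hul) (hdot.1 hul) (hdot.1 hzl) hz
      ⟨A, A, B, hA, hA, hB, hAu, hAu, hBz, by simpa using hd⟩ huG huG
  · intro l hl u hul w hwl z hzl huG hwG hno
    obtain ⟨H, τ, hH, hct⟩ := exists_contact h.homogeneous l.rep_nonzero u.rep_nonzero
      (hdot.1 hul) w.rep z.rep
    refine hG H l.rep τ u w z hH l.rep_nonzero (fun s hs hHs => ?_) (hdot.1 hul) (hdot.1 hwl)
      (hdot.1 hzl) (hQ l hl z hzl) hct huG hwG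
    -- If the section contains the line, an exceptional line in its plane would put a base point on
    -- the line. Otherwise the base point of such an exceptional line is rational, and the triple is
    -- obstructed.
    by_cases hτ : τ = 0
    · obtain ⟨A, B, D, -, -, -, -, -, -, hd⟩ := hct
      rw [hτ, C_0, zero_mul, sub_zero] at hd
      exact hl ⟨s, hs, h.not_containsLine_of_dvd (hQ l hl z hzl) z.rep_nonzero (hdot.1 hzl) hH hd hs
        hHs⟩
    · obtain ⟨s', hs', hp⟩ := h.exists_parallel_extVec hs hH hHs
      have hp' : Parallel (extVec K (Projectivization.mk k s' hs').rep) s :=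
        (parallel_extVec.2 (Projectivization.parallel_rep_mk hs')).trans
          (fun h0 => hs' (extVec_eq_zero.1 h0)) hp
      exact hno (Projectivization.mk k s' hs') (hbase.1 (h.isBasePoint_of_parallel hs
        (fun h0 => Projectivization.rep_nonzero _ (extVec_eq_zero.1 h0)) hp'))
        ⟨H, τ, hH, hτ, hct, h.containsLine_of_parallel hs.1 hHs hp'⟩
  · intro s hs l hl u hu w hw z hz u' hu' w' hw' z' hz' hb hb' v hv hv' t ht
    have hvl : v ∈ l := by
      rcases hv with rfl | rfl | rfl <;> assumption
    have htl : t ∈ l := by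
      rcases ht with rfl | rfl | rfl <;> assumption
    have hrep : ∀ {a b c d : ℙ k (Fin 3 → k)}, a ∈ ({b, c, d} : Set _) →
        a.rep = b.rep ∨ a.rep = c.rep ∨ a.rep = d.rep := by
      rintro a b c d (rfl | rfl | rfl) <;> simp
    have := IsObstructed.parallel_of_mem h hb hb' (hbase.2 hs) (hdot.1 hu) (hdot.1 hw) (hdot.1 hz)
      (hdot.1 hvl) (hQ l hl v hvl) (hrep hv) (hrep hv') (hdot.1 htl) (hrep ht)
    simpa only [← Projectivization.eq_iff_parallel, Set.mem_insert_iff, Set.mem_singleton_iff]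
      using this
  · intro s hs r hr hsr x z t m l hsm hrm hxm hl hxl hb hb'
    have hoff : ∀ y, evalVec Q (Projectivization.rep y) = 0 → l.rep ⬝ᵥ y.rep ≠ 0 :=
      fun y hy h0 => hQ l hl y (hdot.2 h0) hy
    exact h.not_isObstructed_both (hbase.2 hs) (hbase.2 hr) (hpar hsr) m.rep_nonzero (hdot.1 hsm)
      (hdot.1 hrm) (hdot.1 hxm) x.rep_nonzero (hQ l hl x hxl) (hdot.1 hxl) (hoff s hs)
      (hdot.1 hxl) (hoff r hr) hb hb'
  · intro s hs r hr hsr p hp q hq hpq x z l m m' hsm hrm hxm hpm hqm hxm' hsm' hl hxl hb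
    exact h.not_isObstructed_of_two_lines (hbase.2 hs) (hbase.2 hr) (hpar hsr) m.rep_nonzero
      (hdot.1 hsm) (hdot.1 hrm) (hdot.1 hxm) x.rep_nonzero (hQ l hl x hxl) (hdot.1 hxl)
      (fun h0 => hQ l hl s (hdot.2 h0) hs) (hbase.2 hp) (hbase.2 hq) (hpar hpq) m'.rep_nonzero
      (hdot.1 hpm) (hdot.1 hqm) (hdot.1 hxm') (fun h0 => hsm' (hdot.2 h0)) hb

end RationalPlaneModel

/-! ### Primality of smooth cubic forms and descent of common factors. -/

theorem exists_aeval_eq_zero_of_isHomogeneous {K σ : Type*} [Field K] [IsAlgClosed K] [Fintype σ]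
    {G : MvPolynomial σ K} {n : ℕ} (hG : G.IsHomogeneous n) (hn : n ≠ 0) {u w : σ → K}
    (huw : ¬ Parallel u w) : ∃ α β : K, α • u + β • w ≠ 0 ∧ aeval (α • u + β • w) G = 0 := by
  have hinf : Infinite K := IsAlgClosed.instInfinite
  have hne : ∀ a : K, u + a • w ≠ 0 := fun a h0 => huw (by
    rw [eq_neg_of_add_eq_zero_left h0, ← neg_smul]
    exact (Parallel.refl w).smul_left _)
  have heval : ∀ (v v' : σ → K) (a : K), (aeval (lineParam v v') G).eval a = aeval (v + a • v') G :=
    fun v v' a => by rw [eval_aeval, eval_lineParam]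
  -- If the restriction is a nonzero constant `c` on the affine part of the line, then `G(w + t u) =
  -- c * t ^ n`, so the zero is at infinity, namely `w`.
  by_cases hdeg : (aeval (lineParam u w) G).degree = 0
  · obtain ⟨c, hc⟩ : ∃ c, aeval (lineParam u w) G = Polynomial.C c :=
      ⟨_, Polynomial.eq_C_of_degree_eq_zero hdeg⟩
    have hpoly : Polynomial.X * (aeval (lineParam w u) G - Polynomial.C c * Polynomial.X ^ n) = 0 := by
      refine Polynomial.funext fun t => ?_
      rw [Polynomial.eval_mul, Polynomial.eval_sub, heval, Polynomial.eval_X, Polynomial.eval_zero]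
      by_cases ht : t = 0
      · rw [ht, zero_mul]
      have h1 : w + t • u = t • (u + t⁻¹ • w) := by
        rw [smul_add, smul_smul, mul_inv_cancel₀ ht, one_smul, add_comm]
      rw [h1, aeval_smul_of_isHomogeneous hG, ← heval, hc]
      simp only [Polynomial.eval_C, Polynomial.eval_mul, Polynomial.eval_pow, Polynomial.eval_X]
      ring
    have h0 := congrArg (Polynomial.eval 0) ((mul_eq_zero.1 hpoly).resolve_left Polynomial.X_ne_zero)
    refine ⟨0, 1, fun h0 => huw ?_, ?_⟩
    · rw [zero_smul, zero_add, one_smul] at h0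
      rw [h0]
      exact fun i j => by simp
    · rw [Polynomial.eval_sub, heval] at h0
      simpa [hn] using h0
  · obtain ⟨a, ha⟩ := IsAlgClosed.exists_root _ hdeg
    exact ⟨1, a, by rw [one_smul]; exact hne a, by rw [one_smul, ← heval]; exact ha⟩

theorem exists_not_parallel_dotProduct_eq_zero₄ {K : Type*} [Field K] (A : Fin 4 → K) :
    ∃ u w : Fin 4 → K, A ⬝ᵥ u = 0 ∧ A ⬝ᵥ w = 0 ∧ ¬ Parallel u w := by
  obtain ⟨u, hu0, hu⟩ := exists_ne_zero_forall_dotProduct_eq_zero (by norm_num : 1 < 4) ![A]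
  obtain ⟨i, hi⟩ := Function.ne_iff.1 hu0
  obtain ⟨w, hw0, hw⟩ := exists_ne_zero_forall_dotProduct_eq_zero (by norm_num : 2 < 4)
    ![A, Pi.single i (1 : K)]
  refine ⟨u, w, by simpa [dotProduct_comm] using hu 0, by simpa [dotProduct_comm] using hw 0,
    fun hp => hw0 (funext fun j => ?_)⟩
  have h1 : w i = 0 := by simpa using hw 1
  have h2 := hp i j
  rw [h1, mul_zero] at h2
  exact (mul_eq_zero.1 h2).resolve_left hi

theorem isUnit_of_isHomogeneous_zero {K σ : Type*} [Field K] {a : MvPolynomial σ K} (ha0 : a ≠ 0)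
    (ha : a.IsHomogeneous 0) : IsUnit a := by
  rw [← totalDegree_zero_iff_isHomogeneous, totalDegree_eq_zero_iff_eq_C] at ha
  rw [ha] at ha0 ⊢
  exact (IsUnit.mk0 _ fun h0 => ha0 (by rw [h0, C_0])).map C

/-- A smooth cubic form in four variables is prime. -/
theorem prime_of_smooth {K : Type*} [Field K] [IsAlgClosed K] {F : MvPolynomial (Fin 4) K}
    (hF : F.IsHomogeneous 3)
    (hsm : ∀ v : Fin 4 → K, v ≠ 0 → aeval v F = 0 → ∃ i, aeval v (pderiv i F) ≠ 0) : Prime F := by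
  have hF0 : F ≠ 0 := by
    rintro rfl
    obtain ⟨i, hi⟩ := hsm (fun _ => 1) (fun h0 => one_ne_zero (congrFun h0 0)) (map_zero _)
    exact hi (by rw [map_zero, map_zero])
  -- The other factor has a zero on the plane `a = 0`, and by the product rule it is a singular
  -- point.
  have hcommon : ∀ a b : MvPolynomial (Fin 4) K, F = a * b → a.IsHomogeneous 1 →
      ∀ j, j ≠ 0 → b.IsHomogeneous j → False := by
    rintro a b rfl ha j hj hb
    obtain ⟨A, rfl⟩ := ha.exists_eq_sum
    obtain ⟨u, w, hu, hw, huw⟩ := exists_not_parallel_dotProduct_eq_zero₄ A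
    obtain ⟨α, β, hne, hv⟩ := exists_aeval_eq_zero_of_isHomogeneous hb hj huw
    have hav : aeval (α • u + β • w) (linForm A) = 0 := by
      rw [aeval_linForm, extVec_self, dotProduct_add, dotProduct_smul, dotProduct_smul, hu, hw,
        smul_zero, smul_zero, add_zero]
    obtain ⟨i, hi⟩ := hsm _ hne (by rw [map_mul, hv, mul_zero])
    apply hi
    change aeval _ (pderiv i (linForm A * b)) = 0
    rw [Derivation.leibniz, smul_eq_mul, smul_eq_mul, map_add, map_mul, map_mul, hav, hv, zero_mul,
      zero_mul, add_zero]
  refine Irreducible.prime ⟨fun hu => ?_, fun a b hab => ?_⟩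
  · have h1 := hu.map (aeval (0 : Fin 4 → K))
    have h2 := aeval_smul_of_isHomogeneous hF (0 : K) (0 : Fin 4 → K)
    rw [zero_smul, zero_pow (by norm_num), zero_mul] at h2
    rw [h2] at h1
    exact not_isUnit_zero h1
  · obtain ⟨i, j, hi, hj, hij⟩ := isHomogeneous_of_mul (hab ▸ hF) (hab ▸ hF0)
    rw [hab] at hF0
    have ha0 := left_ne_zero_of_mul hF0
    have hb0 := right_ne_zero_of_mul hF0
    obtain rfl | rfl | rfl | rfl : i = 0 ∨ i = 1 ∨ i = 2 ∨ i = 3 := by omega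
    · exact Or.inl (isUnit_of_isHomogeneous_zero ha0 hi)
    · exact (hcommon a b hab hi j (by omega) hj).elim
    · obtain rfl : j = 1 := by omega
      exact (hcommon b a (hab.trans (mul_comm _ _)) hj 2 (by omega) hi).elim
    · obtain rfl : j = 0 := by omega
      exact Or.inr (isUnit_of_isHomogeneous_zero hb0 hj)

/-- Apply an additive map to the coefficients of a polynomial. -/
noncomputable def MvPolynomial.mapCoeff {k K σ : Type*} [CommSemiring k] [CommSemiring K]
    (φ : K →+ k) (P : MvPolynomial σ K) : MvPolynomial σ k :=
  ∑ m ∈ P.support, monomial m (φ (coeff m P))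

section mapCoeff

variable {k K σ : Type*} [Field k] [Field K] [Algebra k K]

omit [Algebra k K] in
theorem MvPolynomial.coeff_mapCoeff (φ : K →+ k) (P : MvPolynomial σ K) (m : σ →₀ ℕ) :
    coeff m (mapCoeff φ P) = φ (coeff m P) := by
  classical
  simp only [mapCoeff, coeff_sum, coeff_monomial, Finset.sum_ite_eq', mem_support_iff]
  split_ifs with h
  · rfl
  · rw [not_not] at h
    rw [h, map_zero]

/-- A `k`-linear functional on coefficients commutes with multiplication by polynomials over `k`; it
brings linear relations over `K` down to `k`. -/
theorem MvPolynomial.mapCoeff_map_mul (φ : K →ₗ[k] k) (q : MvPolynomial σ k)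
    (P : MvPolynomial σ K) :
    mapCoeff φ.toAddMonoidHom (map (algebraMap k K) q * P) = q * mapCoeff φ.toAddMonoidHom P := by
  classical
  refine MvPolynomial.ext _ _ fun m => ?_
  rw [coeff_mapCoeff, coeff_mul, coeff_mul, map_sum]
  refine Finset.sum_congr rfl fun p _ => ?_
  rw [coeff_mapCoeff, coeff_map, ← Algebra.smul_def]
  exact map_smul φ _ _

omit [Algebra k K] in
theorem MvPolynomial.IsHomogeneous.mapCoeff {P : MvPolynomial σ K} {n : ℕ} (h : P.IsHomogeneous n)
    (φ : K →+ k) : (mapCoeff φ P).IsHomogeneous n := fun m hm => h fun h0 => hm (by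
  rw [coeff_mapCoeff, h0, map_zero])

end mapCoeff

theorem exists_eq_mul_forall_isHomogeneous {K σ ι : Type*} [Field K] [Fintype ι] {e : ℕ}
    {q : ι → MvPolynomial σ K} (hq : ∀ i, (q i).IsHomogeneous e) (h0 : q ≠ 0) :
    ∃ (g : MvPolynomial σ K) (Q : ι → MvPolynomial σ K) (n : ℕ), g ≠ 0 ∧ (∀ i, q i = g * Q i) ∧
      (∀ i, (Q i).IsHomogeneous n) ∧ ∀ ϖ, Prime ϖ → ¬ ∀ i, ϖ ∣ Q i := by
  classical
  let _ : NormalizedGCDMonoid (MvPolynomial σ K) := Classical.choice inferInstance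
  obtain ⟨i₀, hi₀⟩ := Function.ne_iff.1 h0
  obtain ⟨Q, hQ, hg⟩ := Finset.extract_gcd q (s := Finset.univ) ⟨i₀, Finset.mem_univ _⟩
  replace hQ := fun i => hQ i (Finset.mem_univ _)
  set g := Finset.univ.gcd q
  have hg0 : g ≠ 0 := fun h => hi₀ (by rw [hQ i₀, h, zero_mul]; rfl)
  obtain ⟨a, n, ha, -, han⟩ := isHomogeneous_of_mul (hQ i₀ ▸ hq i₀) (hQ i₀ ▸ hi₀)
  refine ⟨g, Q, n, hg0, hQ, fun i => ?_, fun ϖ hϖ hall => ?_⟩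
  · by_cases hi : q i = 0
    · rw [hQ, mul_eq_zero] at hi
      rw [hi.resolve_left hg0]
      exact isHomogeneous_zero _ _ _
    · obtain ⟨a', n', ha', hn', han'⟩ := isHomogeneous_of_mul (hQ i ▸ hq i) (hQ i ▸ hi)
      obtain rfl := ha.inj_right ha' hg0
      obtain rfl : n = n' := by omega
      exact hn'
  · refine hϖ.not_isUnit (isUnit_of_dvd_one ?_)
    rw [← hg]
    exact Finset.dvd_gcd fun i _ => hall i

/-- The common factor of a family of forms over `k` can be removed over `k`, so that no common factor
remains over an extension. -/
theorem exists_map_eq_mul_map {k K σ ι : Type*} [Field k] [Field K] [Algebra k K] [Fintype ι]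
    {e : ℕ} {q : ι → MvPolynomial σ k} (hq : ∀ i, (q i).IsHomogeneous e) (h0 : q ≠ 0) :
    ∃ (g : MvPolynomial σ K) (Q : ι → MvPolynomial σ k) (n : ℕ), g ≠ 0 ∧
      (∀ i, map (algebraMap k K) (q i) = g * map (algebraMap k K) (Q i)) ∧
      (∀ i, (Q i).IsHomogeneous n) ∧ ∀ ϖ, Prime ϖ → ¬ ∀ i, ϖ ∣ map (algebraMap k K) (Q i) := by
  have hinj := map_injective (σ := σ) _ (algebraMap k K).injective
  obtain ⟨g, Q, n, hg, hgQ, hQ, hprime⟩ := exists_eq_mul_forall_isHomogeneous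
    (fun i => (hq i).map (algebraMap k K)) (fun h => h0 (funext fun i => hinj
      ((congrFun h i).trans (map_zero _).symm)))
  obtain ⟨i₀, hi₀⟩ := Function.ne_iff.1 h0
  have hQi₀ : Q i₀ ≠ 0 := fun h => hi₀ (hinj (by rw [hgQ, h, mul_zero, Pi.zero_apply, map_zero]))
  obtain ⟨m, hm⟩ := ne_zero_iff.1 hQi₀
  -- The functional is chosen not to kill a nonzero coefficient, so the descended family is nonzero.
  -- It is proportional to `Q` and of the same degree, so the multiplier is a constant.
  obtain ⟨φ, hφ⟩ : ∃ φ : K →ₗ[k] k, φ (coeff m (Q i₀)) ≠ 0 := by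
    by_contra! h
    exact hm ((Module.forall_dual_apply_eq_zero_iff k _).1 h)
  let Q' : ι → MvPolynomial σ k := fun i => mapCoeff φ.toAddMonoidHom (Q i)
  have hQ'i₀ : Q' i₀ ≠ 0 := ne_zero_iff.2 ⟨m, by rw [coeff_mapCoeff]; exact hφ⟩
  have hrel : ∀ i j, q i * Q' j = q j * Q' i := by
    intro i j
    simp only [Q', ← mapCoeff_map_mul, hgQ]
    congr 1
    ring
  have hrel' : ∀ i j, map (algebraMap k K) (Q' i) * Q j = map (algebraMap k K) (Q' j) * Q i := by
    intro i j
    have := congrArg (map (algebraMap k K)) (hrel i j)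
    rw [map_mul, map_mul, hgQ, hgQ] at this
    refine mul_left_cancel₀ hg ?_
    linear_combination -this
  obtain ⟨μ, hμ⟩ := exists_eq_mul_of_forall_mul_eq_mul hrel' ⟨i₀, hQi₀⟩ hprime
  have hμi₀ : μ * Q i₀ ≠ 0 := by
    rw [← hμ]
    exact fun h => hQ'i₀ (hinj (h.trans (map_zero _).symm))
  have hQ'h : ∀ i, (Q' i).IsHomogeneous n := fun i => (hQ i).mapCoeff _
  obtain ⟨a, b, ha, hb, hab⟩ := isHomogeneous_of_mul (hμ i₀ ▸ (hQ'h i₀).map (algebraMap k K)) hμi₀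
  obtain rfl : a = 0 := by
    have := hb.inj_right (hQ i₀) hQi₀
    omega
  rw [← totalDegree_zero_iff_isHomogeneous, totalDegree_eq_zero_iff_eq_C] at ha
  set c := coeff 0 μ
  have hc : c ≠ 0 := fun h => left_ne_zero_of_mul hμi₀ (by rw [ha, h, C_0])
  have hcc : (C c : MvPolynomial σ K) * C c⁻¹ = 1 := by rw [← C_mul, mul_inv_cancel₀ hc, C_1]
  refine ⟨g * C c⁻¹, Q', n, mul_ne_zero hg fun h => ?_, fun i => ?_, hQ'h, fun ϖ hϖ hall =>
    hprime ϖ hϖ fun i => ?_⟩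
  · rw [h, mul_zero] at hcc
    exact zero_ne_one hcc
  · rw [hμ, hgQ, ha]
    linear_combination -g * Q i * hcc
  · have := hall i
    rw [hμ, ha] at this
    refine (hϖ.dvd_or_dvd this).resolve_left fun hdvd => hϖ.not_isUnit (isUnit_of_dvd_unit hdvd ?_)
    exact IsUnit.of_mul_eq_one _ hcc

/-! ### The plane model of a birational morphism. -/

theorem Projectivization.parallel_of_mk_eq_mk {K : Type*} [Field K] {n : ℕ} {v w : Fin n → K}
    {hv : v ≠ 0} {hw : w ≠ 0}
    (h : Projectivization.mk K v hv = Projectivization.mk K w hw) : Parallel v w := by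
  obtain ⟨c, rfl⟩ := (Projectivization.mk_eq_mk_iff' K v w hv hw).1 h
  exact (Parallel.refl w).smul_left _

theorem Projectivization.mk_eq_mk_of_parallel {K : Type*} [Field K] {n : ℕ} {v w : Fin n → K}
    {hv : v ≠ 0} {hw : w ≠ 0} (h : Parallel v w) :
    Projectivization.mk K v hv = Projectivization.mk K w hw := by
  obtain ⟨c, hc⟩ := h.exists_smul hw
  exact (Projectivization.mk_eq_mk_iff' K v w hv hw).2 ⟨c, hc.symm⟩

theorem evalVec_smul {k A σ ι : Type*} [CommRing k] [CommRing A] [Algebra k A]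
    {f : ι → MvPolynomial σ k} {d : ℕ} (hf : ∀ i, (f i).IsHomogeneous d) (c : A) (v : σ → A) :
    evalVec f (c • v) = c ^ d • evalVec f v :=
  funext fun i => aeval_smul_of_isHomogeneous (hf i) c v

theorem parallel_zero_left {ι A : Type*} [CommRing A] (a : ι → A) : Parallel 0 a :=
  fun i j => by simp

namespace GeomPoint

variable {k : Type*} [Field k] {n : ℕ}

theorem exists_rep_mk_eq_smul {v : Fin (n + 1) → AlgebraicClosure k} (hv : v ≠ 0) :
    ∃ c : AlgebraicClosure k, c ≠ 0 ∧
      (Projectivization.mk (AlgebraicClosure k) v hv).rep = c • v := by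
  obtain ⟨c, hc⟩ := Projectivization.exists_smul_eq_mk_rep (AlgebraicClosure k) v hv
  exact ⟨c, c.ne_zero, hc.symm⟩

theorem vanishes_mk {f : MvPolynomial (Fin (n + 1)) k} {d : ℕ} (hf : f.IsHomogeneous d)
    {v : Fin (n + 1) → AlgebraicClosure k} (hv : v ≠ 0) :
    Vanishes f (Projectivization.mk (AlgebraicClosure k) v hv) ↔ aeval v f = 0 := by
  obtain ⟨c, hc, hcv⟩ := exists_rep_mk_eq_smul hv
  rw [Vanishes, hcv, aeval_smul_of_isHomogeneous hf, mul_eq_zero, or_iff_right (pow_ne_zero d hc)]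

end GeomPoint

namespace SmoothCubicSurface

variable {k : Type*} [Field k] {V : SmoothCubicSurface k}

theorem mk_mem_points {v : Fin 4 → AlgebraicClosure k} (hv : v ≠ 0) :
    (Projectivization.mk (AlgebraicClosure k) v hv : GeomPoint k 3) ∈ V.points
      ↔ aeval v V.form = 0 :=
  GeomPoint.vanishes_mk V.isHomogeneous hv

namespace MorphismToPlane

/-- The map on coordinate vectors induced by a morphism to the plane. -/
noncomputable def planeMap (p : V.MorphismToPlane) (v : Fin 4 → AlgebraicClosure k) :
    Fin 3 → AlgebraicClosure k := by
  classical
  exact if h : v ≠ 0 ∧ aeval v V.form = 0 then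
    (p.toFun ⟨Projectivization.mk (AlgebraicClosure k) v h.1, (mk_mem_points h.1).2 h.2⟩).rep else 0

theorem planeMap_of_mem (p : V.MorphismToPlane) {v : Fin 4 → AlgebraicClosure k} (hv : v ≠ 0)
    (hF : aeval v V.form = 0) : p.planeMap v
      = (p.toFun ⟨Projectivization.mk (AlgebraicClosure k) v hv, (mk_mem_points hv).2 hF⟩).rep :=
  dif_pos ⟨hv, hF⟩

theorem parallel_planeMap {p : V.MorphismToPlane} {d : ℕ} {f : Fin 3 → MvPolynomial (Fin 4) k}
    (hf : ∀ j, (f j).IsHomogeneous d)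
    (hw : ∀ (w : V.points) (hw : (fun j => aeval w.1.rep (f j)) ≠ 0),
      p.toFun w = Projectivization.mk (AlgebraicClosure k) _ hw)
    {w : V.points} {v : Fin 4 → AlgebraicClosure k} (hv : v ≠ 0)
    (hwv : w.1 = Projectivization.mk (AlgebraicClosure k) v hv)
    {y : Fin 3 → AlgebraicClosure k} {hy : y ≠ 0}
    (hpy : p.toFun w = Projectivization.mk (AlgebraicClosure k) y hy) :
    Parallel (evalVec f v) y := by
  obtain ⟨c, hc, hcv⟩ := GeomPoint.exists_rep_mk_eq_smul hv
  rw [← hwv] at hcv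
  have h1 : evalVec f w.1.rep = c ^ d • evalVec f v := by rw [hcv, evalVec_smul hf]
  by_cases h0 : evalVec f w.1.rep = 0
  · rw [h0] at h1
    rw [(smul_eq_zero.1 h1.symm).resolve_left (pow_ne_zero d hc)]
    exact parallel_zero_left _
  · have h2 := Projectivization.parallel_of_mk_eq_mk ((hw w h0).symm.trans hpy)
    refine Parallel.of_smul_left (pow_ne_zero d hc) ?_
    rw [← h1]
    exact h2

/-- A birational morphism from a smooth cubic surface to the plane gives a plane model. -/
theorem IsBirational.exists_rationalPlaneModel {p : V.MorphismToPlane} (hp : p.IsBirational) :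
    ∃ Q : Fin 4 → MvPolynomial (Fin 3) k,
      RationalPlaneModel (K := AlgebraicClosure k) V.form Q p.planeMap := by
  obtain ⟨e, q, hq, ⟨_, r, hr, ⟨v₀, hv₀⟩, hrV⟩, _, s, hs, hs0, hsy⟩ := hp
  set K := AlgebraicClosure k
  have hinf : Infinite K := IsAlgClosed.instInfinite
  have hA : ∀ y : Fin 3 → K, ∀ hy : y ≠ 0, aeval y s ≠ 0 → ∃ (w : V.points)
      (hne : evalVec q y ≠ 0), w.1 = Projectivization.mk K _ hne ∧
        p.toFun w = Projectivization.mk K y hy := by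
    intro y hy hsy0
    obtain ⟨c, hc, hcy⟩ := GeomPoint.exists_rep_mk_eq_smul hy
    obtain ⟨h, hV, heq⟩ := hsy (Projectivization.mk K y hy)
      fun h => hsy0 ((GeomPoint.vanishes_mk hs hy).1 h)
    have h1 : (fun i => aeval (Projectivization.mk K y hy).rep (q i)) = c ^ e • evalVec q y := by
      rw [hcy]
      exact evalVec_smul hq c y
    have hne : evalVec q y ≠ 0 := fun h0 => h (by rw [h1, h0, smul_zero])
    refine ⟨_, hne, Projectivization.mk_eq_mk_of_parallel ?_, heq⟩
    rw [h1]
    exact (Parallel.refl _).smul_left _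
  -- The factor `X 0` excludes the zero vector from the open set.
  have hsK : map (algebraMap k K) s * X 0 ≠ 0 := mul_ne_zero
    (fun h => hs0 (map_injective _ (algebraMap k K).injective (h.trans (map_zero _).symm)))
    (X_ne_zero 0)
  have hy0 : ∀ {y : Fin 3 → K}, aeval y (map (algebraMap k K) s * X 0) ≠ 0 →
      y ≠ 0 ∧ aeval y s ≠ 0 := by
    intro y hy
    rw [map_mul, aeval_map_algebraMap, aeval_X] at hy
    exact ⟨fun h0 => right_ne_zero_of_mul hy (congrFun h0 0), left_ne_zero_of_mul hy⟩
  have hq0 : q ≠ 0 := by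
    rintro rfl
    refine one_ne_zero (eq_zero_of_forall_aeval_eq_zero_of_ne hsK (G := 1) fun y hy => ?_)
    obtain ⟨hy0, hsy0⟩ := hy0 hy
    obtain ⟨-, hne, -⟩ := hA y hy0 hsy0
    exact (hne (funext fun i => map_zero _)).elim
  obtain ⟨g, Q, n, hg, hgQ, hQ, hcop⟩ := exists_map_eq_mul_map (K := K) hq hq0
  set QK : Fin 4 → MvPolynomial (Fin 3) K := fun i => map (algebraMap k K) (Q i) with hQK
  have hqQ : ∀ y : Fin 3 → K, evalVec q y = aeval y g • evalVec QK y := fun y => by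
    funext i
    have := congrArg (aeval y) (hgQ i)
    rwa [aeval_map_algebraMap, map_mul] at this
  have hsg : map (algebraMap k K) s * X 0 * g ≠ 0 := mul_ne_zero hsK hg
  have hB : ∀ y : Fin 3 → K, aeval y (map (algebraMap k K) s * X 0 * g) ≠ 0 → ∃ (w : V.points)
      (hne : evalVec QK y ≠ 0) (hy : y ≠ 0), w.1 = Projectivization.mk K _ hne ∧
        p.toFun w = Projectivization.mk K y hy := by
    intro y hy
    rw [map_mul] at hy
    obtain ⟨hy0, hsy0⟩ := hy0 (left_ne_zero_of_mul hy)
    obtain ⟨w, hne, h1, h2⟩ := hA y hy0 hsy0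
    refine ⟨w, fun h0 => hne (by rw [hqQ, h0, smul_zero]), hy0, h1.trans
      (Projectivization.mk_eq_mk_of_parallel ?_), h2⟩
    rw [hqQ]
    exact (Parallel.refl _).smul_left _
  have hinv : InverseData (map (algebraMap k K) V.form) QK p.planeMap n :=
    { cubic := V.isHomogeneous.map _
      smooth := fun v hv hF => by
        rw [aeval_map_algebraMap] at hF
        obtain ⟨i, hi⟩ := V.smooth v hv hF
        exact ⟨i, by rwa [pderiv_map, aeval_map_algebraMap]⟩
      homogeneous := fun i => (hQ i).map _
      coprime := hcop
      aeval_eq_zero := by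
        refine eq_zero_of_forall_aeval_eq_zero_of_ne hsg fun y hy => ?_
        obtain ⟨w, hne, -, hw, -⟩ := hB y hy
        have h1 := w.2
        rw [hw, mk_mem_points] at h1
        rw [aeval_aeval, aeval_map_algebraMap]
        exact h1
      ne_zero := fun v hv hF => by
        rw [aeval_map_algebraMap] at hF
        rw [p.planeMap_of_mem hv hF]
        exact Projectivization.rep_nonzero _
      exists_local := fun v hv hF => by
        rw [aeval_map_algebraMap] at hF
        obtain ⟨d, f, hf, ⟨j, hj⟩, hw⟩ := p.regular ⟨_, (mk_mem_points hv).2 hF⟩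
        refine ⟨d, fun j => map (algebraMap k K) (f j), fun j => (hf j).map _, ?_, ?_, ?_⟩
        · intro h0
          refine hj ((GeomPoint.vanishes_mk (hf j) hv).2 ?_)
          rw [← aeval_map_algebraMap K]
          exact congrFun h0 j
        · intro i j
          rw [← sub_eq_zero]
          refine eq_zero_of_forall_aeval_eq_zero_of_ne hsg fun y hy => ?_
          obtain ⟨w, hne, hy0, hw1, hw2⟩ := hB y hy
          have := parallel_planeMap hf hw hne hw1 hw2 i j
          simp only [map_sub, map_mul, aeval_X, aeval_aeval]
          simp only [aeval_map_algebraMap]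
          exact sub_eq_zero.2 this
        · intro v' hv' hF'
          rw [aeval_map_algebraMap] at hF'
          have := parallel_planeMap hf hw hv' (w := ⟨_, (mk_mem_points hv').2 hF'⟩) rfl
            (Projectivization.mk_rep _).symm
          rw [← p.planeMap_of_mem hv' hF'] at this
          simpa only [aeval_map_algebraMap] using this }
  obtain ⟨rfl, -⟩ := hinv.degree_eq_three
  refine ⟨Q, hQ, hinv, fun G hG => ?_⟩
  have hprime := prime_of_smooth hinv.cubic hinv.smooth
  -- Where `r` is nonzero, a point of the surface is recovered from its image by `Q`, so `G`
  -- vanishes there. As the form of the surface is prime and does not divide `r`, it divides `G`.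
  have hdvd : map (algebraMap k K) V.form ∣ map (algebraMap k K) r * G := by
    refine dvd_of_forall_aeval_eq_zero hprime fun v hF => ?_
    rw [map_mul, mul_eq_zero, aeval_map_algebraMap]
    rw [aeval_map_algebraMap] at hF
    have hcone : ∀ y : Fin 3 → K, aeval (evalVec QK y) G = 0 := fun y => by
      have := congrArg (aeval y) hG
      rwa [aeval_aeval, map_zero] at this
    by_cases hv : v = 0
    · right
      have h1 := evalVec_smul hinv.homogeneous (0 : K) (0 : Fin 3 → K)
      rw [zero_smul, zero_pow (by norm_num), zero_smul] at h1
      rw [hv, ← h1]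
      exact hcone 0
    · by_contra! hne
      obtain ⟨h, heq⟩ := hrV ⟨_, (mk_mem_points hv).2 hF⟩
        fun h0 => hne.1 ((GeomPoint.vanishes_mk hr hv).1 h0)
      set y := (p.toFun ⟨_, (mk_mem_points hv).2 hF⟩).rep
      obtain ⟨c, hc⟩ := (Projectivization.parallel_of_mk_eq_mk heq).symm.exists_smul h
      -- `G` need not be homogeneous, so the vector `v` itself must be a value of `Q`; the cubic
      -- scaling of `Q` requires a cube root.
      obtain ⟨b, hb⟩ := IsAlgClosed.exists_pow_nat_eq (c * aeval y g) (n := 3) (by norm_num)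
      apply hne.2
      have h2 : v = evalVec QK (b • y) := by
        rw [evalVec_smul hinv.homogeneous, hb, ← smul_smul, ← hqQ]
        exact hc
      rw [h2]
      exact hcone _
  refine (hprime.dvd_or_dvd hdvd).resolve_left fun ⟨a, ha⟩ => hv₀ ?_
  have := congrArg (aeval v₀.1.rep) ha
  have h0 : aeval v₀.1.rep V.form = 0 := v₀.2
  rwa [map_mul, aeval_map_algebraMap, aeval_map_algebraMap, h0, zero_mul] at this

end MorphismToPlane

end SmoothCubicSurface

/-! ### Exceptional lines as subspaces and the cubics cut out by planes. -/

/-- The exceptional line above the base point `s`. -/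
noncomputable def excLine {k K : Type*} [Field k] [Field K] [Algebra k K]
    (Q : Fin 4 → MvPolynomial (Fin 3) k) (s : Fin 3 → K) : Submodule K (Fin 4 → K) :=
  LinearMap.range
    ({ toFun := dirVec Q s
       map_add' := dirVec_add_right Q s
       map_smul' := fun c t => dirVec_smul_right Q s t c } : (Fin 3 → K) →ₗ[K] (Fin 4 → K))

theorem mem_excLine {k K : Type*} [Field k] [Field K] [Algebra k K]
    {Q : Fin 4 → MvPolynomial (Fin 3) k} {s : Fin 3 → K} {v : Fin 4 → K} :
    v ∈ excLine Q s ↔ ∃ t, dirVec Q s t = v := Iff.rfl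

theorem excLine_extVec {k K : Type*} [Field k] [Field K] [Algebra k K]
    (Q : Fin 4 → MvPolynomial (Fin 3) k) (s : Fin 3 → k) :
    excLine Q (extVec K s) = Submodule.span K (extVec K '' Set.range (dirVec Q s)) := by
  classical
  apply le_antisymm
  · rintro v ⟨t, rfl⟩
    have : t = ∑ j, t j • extVec K (Pi.single j (1 : k)) := by
      funext i
      simp [extVec, Pi.single_apply, apply_ite (algebraMap k K)]
    rw [this, map_sum]
    refine Submodule.sum_mem _ fun j _ => ?_
    rw [map_smul]
    exact Submodule.smul_mem _ _ (Submodule.subset_span ⟨_, ⟨_, rfl⟩, (dirVec_extVec Q s _).symm⟩)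
  · rw [Submodule.span_le]
    rintro _ ⟨_, ⟨t, rfl⟩, rfl⟩
    exact ⟨extVec K t, dirVec_extVec Q s t⟩

namespace RationalPlaneModel

variable {k K : Type*} [Field k] [Field K] [Algebra k K] {F : MvPolynomial (Fin 4) k}
  {Q : Fin 4 → MvPolynomial (Fin 3) k} {π : (Fin 4 → K) → (Fin 3 → K)}

theorem excLine_eq_of_parallel (h : RationalPlaneModel F Q π) {s s' : Fin 3 → K} (hs' : s' ≠ 0)
    (hp : Parallel s' s) (hs : s ≠ 0) : excLine Q s = excLine Q s' := by
  have key : ∀ {s s' : Fin 3 → K}, s ≠ 0 → Parallel s' s → excLine Q s' ≤ excLine Q s := by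
    rintro s s' hs hp v ⟨t, rfl⟩
    obtain ⟨c, rfl⟩ := hp.exists_smul hs
    refine ⟨c ^ 2 • t, ?_⟩
    change dirVec Q s (c ^ 2 • t) = dirVec Q (c • s) t
    rw [dirVec_smul_right, h.dirVec_smul_left]
  exact le_antisymm (key hs' hp.symm) (key hs hp)

variable [IsAlgClosed K]

theorem finrank_excLine (h : RationalPlaneModel F Q π) {s : Fin 3 → K} (hs : IsBasePoint Q s) :
    Module.finrank K (excLine Q s) = 2 := by
  have h1 := LinearMap.finrank_range_add_finrank_ker
    ({ toFun := dirVec Q s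
       map_add' := dirVec_add_right Q s
       map_smul' := fun c t => dirVec_smul_right Q s t c } : (Fin 3 → K) →ₗ[K] (Fin 4 → K))
  have h2 : LinearMap.ker ({ toFun := dirVec Q s
                             map_add' := dirVec_add_right Q s
                             map_smul' := fun c t => dirVec_smul_right Q s t c } :
      (Fin 3 → K) →ₗ[K] (Fin 4 → K)) = Submodule.span K {s} := by
    ext t
    rw [LinearMap.mem_ker, Submodule.mem_span_singleton]
    constructor
    · intro ht
      obtain ⟨c, rfl⟩ := (h.parallel_of_dirVec_eq_zero hs ht).symm.exists_smul hs.1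
      exact ⟨c, rfl⟩
    · rintro ⟨c, rfl⟩
      rw [map_smul]
      have := h.model.toInverseData.dirVec_self (s := s) (by rw [evalVec_map]; exact hs.2)
      rw [dirVec_map] at this
      change c • dirVec Q s s = 0
      rw [this, smul_zero]
  rw [h2, finrank_span_singleton hs.1, Module.finrank_fin_fun] at h1
  change _ + 1 = 3 at h1
  exact Nat.succ_injective h1

omit [IsAlgClosed K] in
theorem parallel_evalVec_apply (h : RationalPlaneModel F Q π) {v : Fin 4 → K} (hv : v ≠ 0)
    (hF : aeval v F = 0) : Parallel (evalVec Q (π v)) v := by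
  have := h.model.toInverseData.parallel_evalVec_apply h.model.dominant hv
    (by rwa [aeval_map_algebraMap])
  rwa [evalVec_map] at this

theorem mem_excLine_apply (h : RationalPlaneModel F Q π) {v : Fin 4 → K} (hv : v ≠ 0)
    (hF : aeval v F = 0) (hs : evalVec Q (π v) = 0) : v ∈ excLine Q (π v) := by
  obtain ⟨t, ht⟩ := h.model.toInverseData.exists_eq_dirVec h.model.dominant hv
    (by rwa [aeval_map_algebraMap]) (by rwa [evalVec_map])
  rw [dirVec_map] at ht
  exact ⟨t, ht.symm⟩

omit [IsAlgClosed K] in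
theorem apply_ne_zero (h : RationalPlaneModel F Q π) {v : Fin 4 → K} (hv : v ≠ 0)
    (hF : aeval v F = 0) : π v ≠ 0 := h.model.ne_zero v hv (by rwa [aeval_map_algebraMap])

omit [IsAlgClosed K] in
theorem aeval_eq_zero_of_mem_excLine (h : RationalPlaneModel F Q π) {s : Fin 3 → K}
    (hs : IsBasePoint Q s) {v : Fin 4 → K} (hv : v ∈ excLine Q s) : aeval v F = 0 := by
  obtain ⟨t, rfl⟩ := hv
  have := h.model.toInverseData.dirVec_mem (s := s) (by rw [evalVec_map]; exact hs.2) t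
  rwa [dirVec_map, aeval_map_algebraMap] at this

omit [IsAlgClosed K] in
theorem parallel_apply_of_mem_excLine (h : RationalPlaneModel F Q π) {s : Fin 3 → K}
    (hs : IsBasePoint Q s) {v : Fin 4 → K} (hv0 : v ≠ 0) (hv : v ∈ excLine Q s) :
    Parallel (π v) s := by
  obtain ⟨t, rfl⟩ := mem_excLine.1 hv
  have := h.model.toInverseData.parallel_apply_dirVec (s := s) (t := t)
    (by rw [evalVec_map]; exact hs.2) (by rwa [dirVec_map])
  rwa [dirVec_map] at this

omit [IsAlgClosed K] in
theorem parallel_apply_evalVec (h : RationalPlaneModel F Q π) {y : Fin 3 → K}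
    (hy : evalVec Q y ≠ 0) : Parallel (π (evalVec Q y)) y := by
  have := h.model.toInverseData.parallel_apply_evalVec (y := y) (by rwa [evalVec_map])
  rwa [evalVec_map] at this

omit [IsAlgClosed K] in
theorem aeval_evalVec (h : RationalPlaneModel F Q π) (y : Fin 3 → K) :
    aeval (evalVec Q y) F = 0 := by
  have := h.model.toInverseData.evalVec_mem y
  rwa [evalVec_map, aeval_map_algebraMap] at this

/-- A factor whose square divides a cubic form is homogeneous of degree zero or one, and
`not_sq_dvd` excludes degree one. -/
theorem squarefree_sectionForm (h : RationalPlaneModel F Q π) {H : Fin 4 → k} (hH : H ≠ 0) :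
    Squarefree (map (algebraMap k K) (sectionForm Q H)) := by
  have heq : map (algebraMap k K) (sectionForm Q H)
      = ∑ i, C (extVec K H i) * map (algebraMap k K) (Q i) := by
    simp [sectionForm, extVec]
  have hns : ∀ a : MvPolynomial (Fin 3) K, a.IsHomogeneous 1 → a ≠ 0 →
      ¬ a * a ∣ map (algebraMap k K) (sectionForm Q H) := fun a ha ha0 => by
    rw [heq]
    exact h.model.toInverseData.not_sq_dvd (fun h0 => hH (extVec_eq_zero.1 h0)) ha ha0
  have hg0 : map (algebraMap k K) (sectionForm Q H) ≠ 0 := fun h0 =>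
    hns (X 0) (isHomogeneous_X _ _) (X_ne_zero 0) (h0 ▸ dvd_zero _)
  rintro a ⟨c, hc⟩
  have hg := (isHomogeneous_sectionForm h.homogeneous H).map (algebraMap k K)
  rw [hc, mul_assoc] at hg hg0
  obtain ⟨i, j, hi, hj, hij⟩ := isHomogeneous_of_mul hg hg0
  obtain ⟨i', j', hi', -, hij'⟩ := isHomogeneous_of_mul hj (right_ne_zero_of_mul hg0)
  have ha0 := left_ne_zero_of_mul hg0
  obtain rfl := hi.inj_right hi' ha0
  obtain rfl | rfl : i = 0 ∨ i = 1 := by omega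
  · exact isUnit_of_isHomogeneous_zero ha0 hi
  · exact (hns a hi ha0 ⟨c, hc⟩).elim

end RationalPlaneModel

theorem linForm_smul {k σ : Type*} [CommRing k] [Fintype σ] (c : k) (A : σ → k) :
    linForm (c • A) = C c * linForm A := by
  simp [linForm, Finset.mul_sum, mul_assoc]

theorem GeomPoint.vanishes_linForm {k : Type*} [Field k] {n : ℕ} {A u : Fin (n + 1) → k}
    (hu : extVec (AlgebraicClosure k) u ≠ 0) (h : A ⬝ᵥ u = 0) :
    GeomPoint.Vanishes (linForm A) (Projectivization.mk (AlgebraicClosure k) _ hu) := by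
  rw [GeomPoint.vanishes_mk (isHomogeneous_linForm A), aeval_linForm, extVec_dotProduct, h, map_zero]

/-- Points of a line cut out by a plane section are collinear on the image of the section. -/
theorem Contact.collinearOnCubic {k : Type*} [Field k] {Q : Fin 4 → MvPolynomial (Fin 3) k}
    {Λ : Fin 3 → k} {H : Fin 4 → k} {τ : k} {u w z : Fin 3 → k} (h : Contact Q Λ H τ u w z)
    (hΛ : Λ ≠ 0) (hΛu : Λ ⬝ᵥ u = 0) (hΛw : Λ ⬝ᵥ w = 0) (hΛz : Λ ⬝ᵥ z = 0)
    (hu : extVec (AlgebraicClosure k) u ≠ 0) (hw : extVec (AlgebraicClosure k) w ≠ 0)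
    (hz : extVec (AlgebraicClosure k) z ≠ 0) :
    CollinearOnCubic (sectionForm Q H) (Projectivization.mk _ _ hu) (Projectivization.mk _ _ hw)
      (Projectivization.mk _ _ hz) := by
  obtain ⟨A, B, D, hA, hB, hD, hAu, hBw, hDz, hdvd⟩ := h
  refine ⟨linForm Λ, ⟨isHomogeneous_linForm Λ, fun h0 => hΛ (linForm_eq_zero.1 h0)⟩,
    GeomPoint.vanishes_linForm hu hΛu, GeomPoint.vanishes_linForm hw hΛw,
    GeomPoint.vanishes_linForm hz hΛz, ?_⟩
  by_cases hτ : τ = 0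
  · left
    simpa [hτ] using hdvd
  · right
    refine ⟨linForm (τ • A), linForm B, linForm D, isHomogeneous_linForm _, isHomogeneous_linForm _,
      isHomogeneous_linForm _, fun hd => hA ?_, fun hd => hB (parallel_of_linForm_dvd hd),
      fun hd => hD (parallel_of_linForm_dvd hd), GeomPoint.vanishes_linForm hu ?_,
      GeomPoint.vanishes_linForm hw hBw, GeomPoint.vanishes_linForm hz hDz, ?_⟩
    · exact ((parallel_of_linForm_dvd hd).symm.of_smul_left hτ).symm
    · rw [smul_dotProduct, hAu, smul_zero]
    · rwa [linForm_smul, mul_assoc, mul_assoc, ← mul_assoc (linForm A)]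

/-! ### Blown-down lines, images of sections and composition on the surface. -/

namespace SmoothCubicSurface.MorphismToPlane

variable {k : Type*} [Field k] {V : SmoothCubicSurface k} {p : V.MorphismToPlane}
  {Q : Fin 4 → MvPolynomial (Fin 3) k}

theorem planeMap_rep (p : V.MorphismToPlane) (w : V.points) :
    p.planeMap w.1.rep = (p.toFun w).rep := by
  rw [p.planeMap_of_mem w.1.rep_nonzero w.2]
  congr 2
  exact Subtype.ext w.1.mk_rep

theorem toFun_eq_of_parallel {w : V.points} {y : Fin 3 → AlgebraicClosure k} (hy : y ≠ 0)
    (h : Parallel (p.planeMap w.1.rep) y) : p.toFun w = Projectivization.mk _ y hy := by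
  rw [planeMap_rep] at h
  rw [← (p.toFun w).mk_rep]
  exact Projectivization.mk_eq_mk_of_parallel h

theorem isBlownDownLine_excLine
    (h : RationalPlaneModel (K := AlgebraicClosure k) V.form Q p.planeMap)
    {s : Fin 3 → AlgebraicClosure k} (hs : IsBasePoint Q s) : p.IsBlownDownLine (excLine Q s) := by
  have hle : ∀ {w : GeomPoint k 3}, w.submodule ≤ excLine Q s → w.rep ∈ excLine Q s := by
    intro w hw
    refine hw ?_
    rw [Projectivization.submodule_eq]
    exact Submodule.mem_span_singleton_self _
  exact ⟨h.finrank_excLine hs, fun w hw => h.aeval_eq_zero_of_mem_excLine hs (hle hw),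
    Projectivization.mk _ s hs.1, fun w hw => toFun_eq_of_parallel hs.1
      (h.parallel_apply_of_mem_excLine hs w.1.rep_nonzero (hle hw))⟩

/-- If `c` were not a base point, the inverse would recover every point of the line from `c`,
leaving a subspace of dimension at most one. Above a base point, the line lies in the exceptional
line and has the same dimension. -/
theorem IsBlownDownLine.exists_eq_excLine
    (h : RationalPlaneModel (K := AlgebraicClosure k) V.form Q p.planeMap)
    {L : Submodule (AlgebraicClosure k) (Fin 4 → AlgebraicClosure k)} (hL : p.IsBlownDownLine L) :
    ∃ s, IsBasePoint Q s ∧ L = excLine Q s := by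
  obtain ⟨hrank, hmem, c, hc⟩ := hL
  have hF : ∀ v ∈ L, v ≠ 0 → aeval v V.form = 0 ∧ Parallel (p.planeMap v) c.rep := by
    intro v hv hv0
    have hsub : (Projectivization.mk (AlgebraicClosure k) v hv0).submodule ≤ L := by
      rw [Projectivization.submodule_mk, Submodule.span_singleton_le_iff_mem]
      exact hv
    have h1 := hmem (Projectivization.mk _ v hv0) hsub
    have h2 := (mk_mem_points hv0).1 h1
    refine ⟨h2, ?_⟩
    rw [p.planeMap_of_mem hv0 h2, hc ⟨_, h1⟩ hsub]
    exact Parallel.refl _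
  have hQc : evalVec Q c.rep = 0 := by
    by_contra hne
    have hpar : ∀ v ∈ L, v ∈ Submodule.span (AlgebraicClosure k) {evalVec Q c.rep} := by
      intro v hv
      by_cases hv0 : v = 0
      · rw [hv0]
        exact Submodule.zero_mem _
      obtain ⟨h1, h2⟩ := hF v hv hv0
      obtain ⟨a, ha⟩ := h2.symm.exists_smul (h.apply_ne_zero hv0 h1)
      have h3 := h.parallel_evalVec_apply hv0 h1
      rw [ha, evalVec_smul h.homogeneous] at hne
      have hQπ : evalVec Q (p.planeMap v) ≠ 0 := fun h0 => hne (by rw [h0, smul_zero])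
      obtain ⟨b, hb⟩ := h3.symm.exists_smul hQπ
      rw [ha, evalVec_smul h.homogeneous, Submodule.mem_span_singleton]
      have ha0 : a ≠ 0 := by
        rintro rfl
        exact hne (by simp)
      refine ⟨b * (a ^ 3)⁻¹, ?_⟩
      rw [smul_smul, mul_assoc, inv_mul_cancel₀ (pow_ne_zero 3 ha0), mul_one]
      exact hb.symm
    have := Submodule.finrank_mono (R := AlgebraicClosure k) (show L ≤ _ from hpar)
    rw [hrank, finrank_span_singleton hne] at this
    omega
  have hb : IsBasePoint Q c.rep := ⟨c.rep_nonzero, hQc⟩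
  refine ⟨c.rep, hb, Submodule.eq_of_le_of_finrank_eq (fun v hv => ?_)
    (by rw [hrank, h.finrank_excLine hb])⟩
  by_cases hv0 : v = 0
  · rw [hv0]
    exact Submodule.zero_mem _
  obtain ⟨h1, h2⟩ := hF v hv hv0
  have hπ := h.apply_ne_zero hv0 h1
  have hbπ := h.isBasePoint_of_parallel hb hπ h2
  rw [h.excLine_eq_of_parallel hπ h2 c.rep_nonzero]
  exact h.mem_excLine_apply hv0 h1 hbπ.2

theorem lineInPlane_excLine {s : Fin 3 → AlgebraicClosure k} {H : Fin 4 → k} :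
    LineInPlane (excLine Q s) (linForm H) ↔ ContainsLine Q H s := by
  constructor
  · intro h t
    rw [← aeval_linForm]
    exact h _ ⟨t, rfl⟩
  · rintro h _ ⟨t, rfl⟩
    rw [aeval_linForm]
    exact h t

theorem isAdmissible_linForm
    (h : RationalPlaneModel (K := AlgebraicClosure k) V.form Q p.planeMap) {H : Fin 4 → k}
    (hH : H ≠ 0) (hHs : ∀ s : Fin 3 → AlgebraicClosure k, IsBasePoint Q s → ¬ ContainsLine Q H s) :
    p.IsAdmissible (linForm H) := by
  refine ⟨⟨isHomogeneous_linForm H, fun h0 => hH (linForm_eq_zero.1 h0)⟩, fun L hL hLH => ?_⟩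
  obtain ⟨s, hs, rfl⟩ := hL.exists_eq_excLine h
  exact hHs s hs (lineInPlane_excLine.1 hLH)

/-- Outside the base locus `Q` and `p` are inverse to each other. At a base point every section form
vanishes, and correspondingly every plane meets the exceptional line above it. -/
theorem isImageCubic_sectionForm
    (h : RationalPlaneModel (K := AlgebraicClosure k) V.form Q p.planeMap) {H : Fin 4 → k}
    (hH : H ≠ 0) : p.IsImageCubic (linForm H) (sectionForm Q H) := by
  classical
  refine ⟨isHomogeneous_sectionForm h.homogeneous H, h.squarefree_sectionForm hH, fun y => ?_⟩
  have hg : y.Vanishes (sectionForm Q H) ↔ extVec (AlgebraicClosure k) H ⬝ᵥ evalVec Q y.rep = 0 := by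
    rw [GeomPoint.Vanishes, aeval_sectionForm]
  rw [hg]
  have hpoint : ∀ {v : Fin 4 → AlgebraicClosure k} (hv : v ≠ 0), aeval v V.form = 0 →
      extVec (AlgebraicClosure k) H ⬝ᵥ v = 0 → Parallel (p.planeMap v) y.rep →
      ∃ v : V.points, v.1.Vanishes (linForm H) ∧ p.toFun v = y := by
    intro v hv hF hHv hp
    refine ⟨⟨Projectivization.mk _ v hv, (mk_mem_points hv).2 hF⟩, ?_, ?_⟩
    · rw [GeomPoint.vanishes_mk (isHomogeneous_linForm H), aeval_linForm, hHv]
    · rw [p.planeMap_of_mem hv hF] at hp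
      exact Projectivization.eq_iff_parallel.2 hp
  constructor
  · intro h0
    by_cases hQ : evalVec Q y.rep = 0
    · have hb : IsBasePoint Q y.rep := ⟨y.rep_nonzero, hQ⟩
      obtain ⟨t, ht, hty⟩ := exists_dotProduct_eq_zero_not_parallel (fun j =>
        aeval y.rep (pderiv j (sectionForm Q H))) y.rep_nonzero
      have hne : dirVec Q y.rep t ≠ 0 := fun h0 => hty (h.parallel_of_dirVec_eq_zero hb h0).symm
      have hmem : dirVec Q y.rep t ∈ excLine Q y.rep := ⟨t, rfl⟩
      refine hpoint hne (h.aeval_eq_zero_of_mem_excLine hb hmem) ?_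
        (h.parallel_apply_of_mem_excLine hb hne hmem)
      rw [← dirDeriv_sectionForm]
      exact ht
    · exact hpoint hQ (h.aeval_evalVec _) h0 (h.parallel_apply_evalVec hQ)
  · rintro ⟨v, hv, rfl⟩
    rw [GeomPoint.Vanishes, aeval_linForm] at hv
    rw [← planeMap_rep]
    exact dotProduct_eq_zero_of_parallel v.1.rep_nonzero
      (h.parallel_evalVec_apply v.1.rep_nonzero v.2) hv

/-- `x` is the point of the surface which corresponds to the rational point `a` of the plane outside
of the base locus. -/
def IsOver (p : V.MorphismToPlane) (Q : Fin 4 → MvPolynomial (Fin 3) k) (x : V.points)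
    (a : Fin 3 → k) : Prop :=
  ∃ (ha : extVec (AlgebraicClosure k) a ≠ 0)
    (hQ : extVec (AlgebraicClosure k) (evalVec Q a) ≠ 0),
    x.1 = Projectivization.mk _ _ hQ ∧ p.toFun x = Projectivization.mk _ _ ha

theorem IsOver.mem_complement
    (h : RationalPlaneModel (K := AlgebraicClosure k) V.form Q p.planeMap) {x : V.points}
    {a : Fin 3 → k} (hx : p.IsOver Q x a) : x ∈ p.complement := by
  obtain ⟨ha, hQ, hx1, hx2⟩ := hx
  refine ⟨⟨_, hQ, hx1⟩, fun L hL hle => ?_⟩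
  obtain ⟨s, hs, rfl⟩ := hL.exists_eq_excLine h
  rw [hx1, Projectivization.submodule_mk, Submodule.span_singleton_le_iff_mem] at hle
  rw [← evalVec_extVec] at hle hQ
  refine hQ (h.isBasePoint_of_parallel hs ha ?_).2
  have h1 := h.parallel_apply_of_mem_excLine hs hQ hle
  have h2 := h.parallel_apply_evalVec hQ
  exact h2.symm.trans (h.apply_ne_zero hQ (h.aeval_evalVec _)) h1

theorem exists_isOver
    (h : RationalPlaneModel (K := AlgebraicClosure k) V.form Q p.planeMap)
    {a : Fin 3 → k} (ha : a ≠ 0) (hQ : evalVec Q a ≠ 0) : ∃ x, p.IsOver Q x a := by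
  have ha' : extVec (AlgebraicClosure k) a ≠ 0 := fun h0 => ha (extVec_eq_zero.1 h0)
  have hQ' : extVec (AlgebraicClosure k) (evalVec Q a) ≠ 0 := fun h0 => hQ (extVec_eq_zero.1 h0)
  have hF : aeval (extVec (AlgebraicClosure k) (evalVec Q a)) V.form = 0 := by
    rw [← evalVec_extVec]
    exact h.aeval_evalVec _
  refine ⟨⟨Projectivization.mk _ _ hQ', (mk_mem_points hQ').2 hF⟩, ha', hQ', rfl, ?_⟩
  have h1 := h.parallel_apply_evalVec (y := extVec (AlgebraicClosure k) a)
    (by rwa [evalVec_extVec])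
  rw [evalVec_extVec, p.planeMap_of_mem hQ' hF] at h1
  rw [← (p.toFun _).mk_rep]
  exact Projectivization.mk_eq_mk_of_parallel h1

theorem IsOver.of_parallel
    (h : RationalPlaneModel (K := AlgebraicClosure k) V.form Q p.planeMap) {x : V.points}
    {a b : Fin 3 → k} (hx : p.IsOver Q x a) (hb : b ≠ 0) (hp : Parallel a b) : p.IsOver Q x b := by
  obtain ⟨ha, hQ, hx1, hx2⟩ := hx
  obtain ⟨c, rfl⟩ := hp.exists_smul hb
  have h1 : evalVec Q (c • b) = c ^ 3 • evalVec Q b := evalVec_smul h.homogeneous c b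
  refine ⟨fun h0 => hb (extVec_eq_zero.1 h0), fun h0 => hQ ?_, hx1.trans
    (Projectivization.mk_eq_mk_of_parallel ?_), hx2.trans
    (Projectivization.mk_eq_mk_of_parallel (parallel_extVec.2 hp))⟩
  · rw [h1, extVec_smul, h0, smul_zero]
  · rw [h1]
    exact parallel_extVec.2 ((Parallel.refl _).smul_left _)

/-- Local expressions of `p` have coefficients in `k`, so the image of a rational point is rational.
It is not a base point, since otherwise the point would lie on the exceptional line above it. -/
theorem exists_isOver_of_mem_complement
    (h : RationalPlaneModel (K := AlgebraicClosure k) V.form Q p.planeMap) {x : V.points}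
    (hx : x ∈ p.complement) : ∃ a : ℙ k (Fin 3 → k), p.IsOver Q x a.rep := by
  obtain ⟨⟨u, hu, hxu⟩, hL⟩ := hx
  change extVec (AlgebraicClosure k) u ≠ 0 at hu
  change x.1 = Projectivization.mk _ (extVec (AlgebraicClosure k) u) hu at hxu
  obtain ⟨d, f, hf, ⟨j, hj⟩, hw⟩ := p.regular x
  obtain ⟨c, hc, hcu⟩ := GeomPoint.exists_rep_mk_eq_smul hu
  rw [← hxu] at hcu
  have h1 : evalVec f x.1.rep = c ^ d • extVec (AlgebraicClosure k) (evalVec f u) := by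
    rw [hcu, evalVec_smul hf, evalVec_extVec]
  have hne : evalVec f x.1.rep ≠ 0 := fun h0 => hj (congrFun h0 j)
  have ha : extVec (AlgebraicClosure k) (evalVec f u) ≠ 0 := fun h0 => hne (by
    rw [h1, h0, smul_zero])
  have hpx : p.toFun x = Projectivization.mk _ _ ha := by
    refine (hw x hne).trans (Projectivization.mk_eq_mk_of_parallel ?_)
    change Parallel (evalVec f x.1.rep) _
    rw [h1]
    exact (Parallel.refl _).smul_left _
  have hπ : Parallel (p.planeMap x.1.rep) (extVec (AlgebraicClosure k) (evalVec f u)) := by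
    rw [planeMap_rep, hpx]
    exact Projectivization.parallel_rep_mk ha
  have hQ : evalVec Q (p.planeMap x.1.rep) ≠ 0 := by
    intro h0
    refine hL _ (isBlownDownLine_excLine h ⟨h.apply_ne_zero x.1.rep_nonzero x.2, h0⟩) ?_
    rw [Projectivization.submodule_eq, Submodule.span_singleton_le_iff_mem]
    exact h.mem_excLine_apply x.1.rep_nonzero x.2 h0
  have ha0 : evalVec f u ≠ 0 := fun h0 => ha (extVec_eq_zero.2 h0)
  obtain ⟨b, hb⟩ := hπ.exists_smul ha
  have hF2 := h.parallel_evalVec_apply x.1.rep_nonzero x.2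
  rw [hb, evalVec_smul h.homogeneous, evalVec_extVec] at hQ hF2
  have hb0 : b ^ 3 ≠ 0 := fun h0 => hQ (by rw [h0, zero_smul])
  have hQa : extVec (AlgebraicClosure k) (evalVec Q (evalVec f u)) ≠ 0 := fun h0 => hQ (by
    rw [h0, smul_zero])
  refine ⟨Projectivization.mk k _ ha0, IsOver.of_parallel h (a := evalVec f u) ⟨ha, hQa, ?_, hpx⟩
    (Projectivization.rep_nonzero _) (Projectivization.parallel_rep_mk ha0).symm⟩
  conv_lhs => rw [← x.1.mk_rep]
  exact Projectivization.mk_eq_mk_of_parallel (hF2.of_smul_left hb0).symm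

theorem mem_comp_of_contact
    (h : RationalPlaneModel (K := AlgebraicClosure k) V.form Q p.planeMap) {x y z : V.points}
    {u w t : Fin 3 → k} (hx : p.IsOver Q x u) (hy : p.IsOver Q y w) (hz : p.IsOver Q z t)
    {Λ : Fin 3 → k} {H : Fin 4 → k} {τ : k} (hΛ : Λ ≠ 0) (hH : H ≠ 0) (hu : Λ ⬝ᵥ u = 0)
    (hw : Λ ⬝ᵥ w = 0) (ht : Λ ⬝ᵥ t = 0) (hc : Contact Q Λ H τ u w t) :
    z ∈ p.comp (linForm H) x y := by
  have hvan : ∀ {v : V.points} {b : Fin 3 → k}, p.IsOver Q v b → aeval b (sectionForm Q H) = 0 →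
      v.1.Vanishes (linForm H) := by
    rintro v b ⟨-, hQ, hv, -⟩ h0
    rw [hv]
    exact GeomPoint.vanishes_linForm hQ (by rwa [aeval_sectionForm] at h0)
  refine ⟨hvan hx (hc.aeval_fst hu), hvan hy (hc.symm_left.aeval_fst hw),
    hvan hz (hc.rotate.aeval_fst ht), (hz.mem_complement h).1, sectionForm Q H,
    isImageCubic_sectionForm h hH, ?_⟩
  obtain ⟨hx, -, -, hpx⟩ := hx
  obtain ⟨hy, -, -, hpy⟩ := hy
  obtain ⟨hz, -, -, hpz⟩ := hz
  rw [hpx, hpy, hpz]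
  exact hc.collinearOnCubic hΛ hu hw ht hx hy hz

theorem GeneratedBy.mem_complement {x y : V.points} (hy : p.GeneratedBy x y)
    (hx : x ∈ p.complement) : y ∈ p.complement := by
  cases hy with
  | base => exact hx
  | step _ _ _ _ _ _ _ hz _ => exact hz

theorem generatedBy_of_mem_complement
    (h : RationalPlaneModel (K := AlgebraicClosure k) V.form Q p.planeMap) {x y : V.points}
    (hx : x ∈ p.complement) (hy : y ∈ p.complement) : p.GeneratedBy x y := by
  obtain ⟨a, ha⟩ := exists_isOver_of_mem_complement h hx
  obtain ⟨b, hb⟩ := exists_isOver_of_mem_complement h hy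
  -- The plane points below generated points are closed under contact with admissible sections,
  -- which is what the generation theorem in the plane requires.
  have hmem : b ∈ {c : ℙ k (Fin 3 → k) | ∃ y, p.IsOver Q y c.rep ∧ p.GeneratedBy x y} := by
    refine h.mem_of_contact _ ?_ (x := a) ⟨x, ha, .base⟩ ?_
    · rintro H Λ τ u w z hH hΛ hHs hu hw hz hQz hc ⟨u', hu', hug⟩ ⟨w', hw', hwg⟩
      obtain ⟨z', hz'⟩ := exists_isOver h z.rep_nonzero hQz
      exact ⟨z', hz', .step _ u' w' z' (isAdmissible_linForm h hH hHs) hug hwg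
        (hz'.mem_complement h) (mem_comp_of_contact h hu' hw' hz' hΛ hH hu hw hz hc)⟩
    · obtain ⟨-, hQ, -⟩ := hb
      exact fun h0 => hQ (extVec_eq_zero.2 h0)
  obtain ⟨y', hy', hg⟩ := hmem
  obtain ⟨-, _, h1, -⟩ := hb
  obtain ⟨-, _, h2, -⟩ := hy'
  rwa [show y = y' from Subtype.ext (h1.trans h2.symm)]

/-- The base point has a rational representative, and the images of rational directions under the
differential there span the line. -/
theorem lineDefinedOver_excLine
    (h : RationalPlaneModel (K := AlgebraicClosure k) V.form Q p.planeMap)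
    {s : Fin 3 → AlgebraicClosure k} (hs : IsBasePoint Q s) {H : Fin 4 → k} (hH : H ≠ 0)
    (hHs : ContainsLine Q H s) : LineDefinedOver (k := k) (excLine Q s) := by
  obtain ⟨s', hs', hp⟩ := h.exists_parallel_extVec hs hH hHs
  rw [h.excLine_eq_of_parallel (fun h0 => hs' (extVec_eq_zero.1 h0)) hp hs.1, excLine_extVec]
  exact ⟨_, rfl⟩

end SmoothCubicSurface.MorphismToPlane

theorem mainTheorem3 {k : Type*} [Field k] (V : SmoothCubicSurface k)
    (p : V.MorphismToPlane) (hp : p.IsBirational)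
    (x : V.points) (hx : x ∈ p.complement) :
    {y : V.points | p.GeneratedBy x y} = p.complement ∧
    ∀ y ∈ p.complement, ∃ H : MvPolynomial (Fin 4) k,
      IsLinearForm H ∧ y ∈ p.comp H x x ∧
      ∀ L : Submodule (AlgebraicClosure k) (Fin 4 → AlgebraicClosure k),
        p.IsBlownDownLine L → LineInPlane L H → LineDefinedOver L := by
  obtain ⟨Q, h⟩ := hp.exists_rationalPlaneModel
  refine ⟨Set.Subset.antisymm (fun y hy => hy.mem_complement hx) fun y hy =>
    SmoothCubicSurface.MorphismToPlane.generatedBy_of_mem_complement h hx hy, fun y hy => ?_⟩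
  obtain ⟨a, ha⟩ := SmoothCubicSurface.MorphismToPlane.exists_isOver_of_mem_complement h hx
  obtain ⟨b, hb⟩ := SmoothCubicSurface.MorphismToPlane.exists_isOver_of_mem_complement h hy
  -- A rational line through the images of `x` and `y`, which exists also when they coincide. The
  -- section is then chosen with contact twice at the image of `x` and once at that of `y`.
  obtain ⟨Λ, hΛ, hΛab⟩ := exists_ne_zero_forall_dotProduct_eq_zero (by norm_num : 2 < 3)
    ![a.rep, b.rep]
  have hΛa : Λ ⬝ᵥ a.rep = 0 := hΛab 0
  have hΛb : Λ ⬝ᵥ b.rep = 0 := hΛab 1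
  obtain ⟨H, τ, hH, hc⟩ := exists_contact h.homogeneous hΛ a.rep_nonzero hΛa a.rep b.rep
  refine ⟨linForm H, ⟨isHomogeneous_linForm H, fun h0 => hH (linForm_eq_zero.1 h0)⟩,
    SmoothCubicSurface.MorphismToPlane.mem_comp_of_contact h ha ha hb hΛ hH hΛa hΛa hΛb hc,
    fun L hL hLH => ?_⟩
  obtain ⟨s, hs, rfl⟩ := hL.exists_eq_excLine h
  exact SmoothCubicSurface.MorphismToPlane.lineDefinedOver_excLine h hs hH
    (SmoothCubicSurface.MorphismToPlane.lineInPlane_excLine.1 hLH)
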